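/- Let $0\le N\le d$ be integers, $W=\mathbb C_d[x]$ the space of complex polynomials of degree $\le d$, and $\mathrm{Gr}(N+1,W)$ the Grassmannian of $(N+1)$-dimensional subspaces of $W$. For $z\in\mathbb C$ let $F_u(z)=(x-z)^{d+1-u}\mathbb C[x]\cap W$, and let $F_u(\infty)$ be the space of polynomials of degree $<u$ ($0\le u\le d+1$). For integers $d-N\ge a_1\ge\dots\ge a_{N+1}\ge 0$ (a ramification sequence $\mathbf a$, with the conventions $a_0=d-N$, $a_{N+2}=0$) and $z\in\mathbb C\cup\{\infty\}$, the Schubert cell $\Omega^o_{\mathbf a}(F(z))\subset \mathrm{Gr}(N+1,W)$ is the smooth locally closed subvariety of those $V$ with $\operatorname{rk}(V\cap F_u(z))=\ell$ whenever $0\le\ell\le N+1$ and $d-N+\ell-a_\ell\le u<d-N+\ell+1-a_{\ell+1}$; its codimension is $|\mathbf a|=a_1+\dots+a_{N+1}$. On such a $V$ the subspaces $D_m(z)=V\cap F_{d-N+m-a_m}(z)$, $0\le m\le N+1$, form the distinguished complete flag of $V$ at $z$. Fix distinct points $z_1,\dots,z_n\in\mathbb C$ and ramification sequences $\mathbf a(z_1),\dots,\mathbf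 a(z_n),\mathbf a(\infty)$ with $$\sum_{s=1}^n|\mathbf a(z_s)|+|\mathbf a(\infty)|=\dim \mathrm{Gr}(N+1,W)=(N+1)(d-N).$$ Put $$K_i=\prod_{s=1}^n(x-z_s)^{\sum_{\ell=1}^i a_{N+1-i+\ell}(z_s)},\qquad T_i=\prod_{s=1}^n(x-z_s)^{a_{N+1-i}(z_s)-a_{N+2-i}(z_s)},$$ $$l_i=i(d-i+1)-\sum_{\ell=1}^i a_{N+1-i+\ell}(\infty)-\sum_{s=1}^n\sum_{\ell=1}^i a_{N+1-i+\ell}(z_s).$$ Let $\Omega$ be the scheme-theoretic intersection in $\mathrm{Gr}(N+1,W)$ of the Schubert cells $\Omega^o_{\mathbf a(z)}(F(z))$, $z\in\{z_1,\dots,z_n,\infty\}$, and let $\mathrm{Fl}\to\Omega$ be the bundle of complete flags $E_1\subset\dots\subset E_{N+1}=V$ of the tautological bundle. Let $\mathrm{Fl}^o\subset\mathrm{Fl}$ be the open subscheme whose points $(V,E_\bullet)$ satisfy: $E_i\oplus D_{N+1-i}(z)=V$ for $i=1,\dots,N+1$ and all $z\in\{z_1,\dots,z_n,\infty\}$ (that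 is, $E_\bullet$ lies in the open Schubert cells of the $n+1$ distinguished flags of $V$); and for $i=1,\dots,N-1$ the Wronskians $\mathrm{Wr}(E_i)$ and $\mathrm{Wr}(E_{i+1})$ have no common roots outside $\{z_1,\dots,z_n\}$. Let $R=\prod_{i=1}^N\mathbb P(\mathbb C_{l_i}[x])$ (empty if some $l_i<0$), put $y_0=y_{N+1}=1$, and let $R^o\subset R$ be the open subscheme of tuples $(y_1,\dots,y_N)$ such that, for all $i$, $y_i$ has degree exactly $l_i$, has no roots in $\{z_1,\dots,z_n\}$, has no common roots with $y_{i+1}$, and has no multiple roots. Let $\mathcal A\subset R^o$ be the closed subscheme defined by the conditions: $y_i$ divides $\mathrm{Wr}(y_i',\,T_i\,y_{i-1}\,y_{i+1})$ for $i=1,\dots,N$. All these schemes are understood as schemes of finite type over $\mathbb C$, with their standard sets of points in commutative $\mathbb C$-algebras. **Theorem.** The Wronskian map $$\Theta:\ \mathrm{Fl}^o\to\mathcal A,\qquad (V,E_\bullet)\mapsto\bigl(\mathrm{Wr}(E_1)/K_1,\dots,\mathrm{Wr}(E_N)/K_N\bigr)$$ is a well-defined morphism of schemes over $\mathbb C$,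 and it is an isomorphism of schemes. -/

import Mathlib

open Polynomial CategoryTheory AlgebraicGeometry Opposite

/-! ### Vector bundles of polynomials over a ring -/

namespace WronskiMap

section Polynomials

variable {A : Type} [CommRing A]

/-- `V` is an `A`-point of the Grassmannian of `k`-dimensional subspaces of the space of polynomials
of degree `< m`: an `A`-submodule of `A[x]_{< m}` whose quotient is projective (so that `V` is a
direct summand of the free module `A[x]_{< m}`, in particular finite projective) and which has
constant rank `k`. -/
def IsSubbundle (m k : ℕ) (V : Submodule A A[X]) : Prop :=
  V ≤ degreeLT A m ∧
  Module.Projective A (degreeLT A m ⧸ V.submoduleOf (degreeLT A m)) ∧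
  ∀ p : PrimeSpectrum A, Module.rankAtStalk (R := A) V p = k

/-- `rk (V ∩ F) = ℓ` in the scheme-theoretic sense, for subbundles `V`, `F` of `A[x]_{≤ d}`:
`V + F` is again a subbundle (equivalently the cokernel of `V → A[x]_{≤ d} / F` is projective, so
that `V ∩ F` is a subbundle and its formation commutes with every base change), and the rank of
`V ∩ F` is `ℓ`. If `A` is a field, the first part is automatic. -/
def MeetsInRank (d : ℕ) (V F : Submodule A A[X]) (ℓ : ℕ) : Prop :=
  Module.Projective A (degreeLT A (d + 1) ⧸ (V ⊔ F).submoduleOf (degreeLT A (d + 1))) ∧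
  ∀ p : PrimeSpectrum A, Module.rankAtStalk (R := A) (V ⊓ F : Submodule A A[X]) p = ℓ

/-- The Wronskian `det (f_c^{(r)})` of `k` polynomials. -/
noncomputable def wr {k : ℕ} (f : Fin k → A[X]) : A[X] :=
  Matrix.det (Matrix.of fun r c : Fin k => derivative^[(r : ℕ)] (f c))

/-- The Wronskian of a module `E` of polynomials of rank `k`, as the `A`-submodule of `A[x]`
spanned by the Wronskians of `k` elements of `E`. If `E` is free with basis `u_1, …, u_k`, it is
the line `A · Wr(u_1, …, u_k)`. -/
noncomputable def wrLine (k : ℕ) (E : Submodule A A[X]) : Submodule A A[X] :=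
  Submodule.span A {w | ∃ f : Fin k → A[X], (∀ j, f j ∈ E) ∧ w = wr f}

/-- The base change of a module of polynomials along a ring homomorphism `A → B`: the `B`-module
spanned by the images of its elements. For a subbundle `E` this is `B ⊗ E`. -/
noncomputable def baseChange {B : Type} [CommRing B] (φ : A →+* B) (E : Submodule A A[X]) : Submodule B B[X] :=
  Submodule.span B (Polynomial.map φ '' (E : Set A[X]))

end Polynomials

/-! ### The basic situation -/

/-- A ramification sequence `d - N ≥ a_1 ≥ ⋯ ≥ a_{N+1} ≥ 0`; here `a j` is `a_{j+1}`. -/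
structure RamificationSequence (N d : ℕ) where
  a : Fin (N + 1) → ℕ
  antitone : Antitone a
  le : ∀ j, a j ≤ d - N

namespace RamificationSequence

variable {N d : ℕ}

/-- The entry `a_j`, with the conventions `a_0 = d - N` and `a_j = 0` for `j ≥ N + 2`. -/
def entry (r : RamificationSequence N d) (j : ℕ) : ℕ :=
  if j = 0 then d - N else if h : j - 1 < N + 1 then r.a ⟨j - 1, h⟩ else 0

/-- `|a| = a_1 + ⋯ + a_{N+1}`, the codimension of the Schubert cell. -/
def size (r : RamificationSequence N d) : ℕ := ∑ j, r.a j

/-- The sum of the last `i` entries, `∑_{ℓ=1}^{i} a_{N+1-i+ℓ}`. -/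
def tail (r : RamificationSequence N d) (i : ℕ) : ℕ :=
  ∑ ℓ ∈ Finset.Icc 1 i, r.entry (N + 1 - i + ℓ)

end RamificationSequence

/-- The basic situation: `W = ℂ_d[x]`, the Grassmannian `Gr(N+1, W)`, distinct points `z_1, …, z_n`
of `ℂ`, a ramification sequence at each of them (`ram (some s)` belongs to `z_s`) and at `∞`
(`ram none`), of total codimension `dim Gr(N+1, W) = (N+1)(d-N)`. -/
structure BasicSituation where
  d : ℕ
  N : ℕ
  hN : N ≤ d
  n : ℕ
  z : Fin n → ℂ
  z_injective : Function.Injective z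
  ram : Option (Fin n) → RamificationSequence N d
  sum_size : ∑ p, (ram p).size = (N + 1) * (d - N)

namespace BasicSituation

variable (S : BasicSituation)

/-- `∏_s (x - z_s)^{e s}` with coefficients in a `ℂ`-algebra `A`. -/
noncomputable def zProd (A : Type) [CommRing A] [Algebra ℂ A] (e : Fin S.n → ℕ) : A[X] :=
  ∏ s, (X - C (algebraMap ℂ A (S.z s))) ^ e s

/-- `K_i = ∏_s (x - z_s)^{∑_{ℓ=1}^{i} a_{N+1-i+ℓ}(z_s)}`. -/
noncomputable def K (A : Type) [CommRing A] [Algebra ℂ A] (i : ℕ) : A[X] :=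
  S.zProd A fun s => (S.ram (some s)).tail i

/-- `T_i = ∏_s (x - z_s)^{a_{N+1-i}(z_s) - a_{N+2-i}(z_s)} = K_{i+1} K_{i-1} / K_i²`,
for `1 ≤ i ≤ N`. -/
noncomputable def T (A : Type) [CommRing A] [Algebra ℂ A] (i : ℕ) : A[X] :=
  S.zProd A fun s =>
    (S.ram (some s)).entry (S.N + 1 - i) - (S.ram (some s)).entry (S.N + 2 - i)

/-- `l_i = i (d - i + 1) - ∑_ℓ a_{N+1-i+ℓ}(∞) - ∑_s ∑_ℓ a_{N+1-i+ℓ}(z_s)`. -/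
def l (i : ℕ) : ℤ :=
  (i : ℤ) * ((S.d : ℤ) - i + 1) - ∑ p : Option (Fin S.n), ((S.ram p).tail i : ℤ)

/-! ### The points of `Fl^o` with values in a `ℂ`-algebra -/

section Points

variable {A : Type} [CommRing A] [Algebra ℂ A]

/-- The flags `F_u(z_s) = (x - z_s)^{d+1-u} A[x] ∩ A_d[x]` and `F_u(∞) = A[x]_{< u}`
(base changed to `A`), for `0 ≤ u ≤ d + 1`. -/
noncomputable def flag (S : BasicSituation) : Option (Fin S.n) → ℕ → Submodule A A[X]
  | none, u => degreeLT A u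
  | some s, u => degreeLT A (S.d + 1) ⊓
      (Ideal.span {(X - C (algebraMap ℂ A (S.z s))) ^ (S.d + 1 - u)}).restrictScalars A

/-- `V` lies in the Schubert cell of the ramification sequence at the point `p` of
`{z_1, …, z_n, ∞}`: `rk (V ∩ F_u(p)) = ℓ` whenever
`d - N + ℓ - a_ℓ ≤ u < d - N + ℓ + 1 - a_{ℓ+1}`, `ℓ = 0, …, N + 1`. -/
def InSchubertCell (p : Option (Fin S.n)) (V : Submodule A A[X]) : Prop :=
  ∀ ℓ u : ℕ, ℓ ≤ S.N + 1 →
    S.d - S.N + ℓ ≤ u + (S.ram p).entry ℓ →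
    u + (S.ram p).entry (ℓ + 1) < S.d - S.N + ℓ + 1 →
    MeetsInRank S.d V (S.flag p u) ℓ

/-- The `A`-points of `Ω`, the scheme-theoretic intersection of the Schubert cells in
`Gr(N+1, W)`. -/
def IsOmegaPoint (V : Submodule A A[X]) : Prop :=
  IsSubbundle (S.d + 1) (S.N + 1) V ∧ ∀ p, S.InSchubertCell p V

/-- The `A`-points of `Fl`, the bundle of complete flags `E_1 ⊂ ⋯ ⊂ E_{N+1} = V` over `Ω`; here
`E j` is `E_{j+1}`. -/
def IsFlPoint (E : Fin (S.N + 1) → Submodule A A[X]) : Prop :=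
  Monotone E ∧ (∀ j : Fin (S.N + 1), IsSubbundle (S.d + 1) (j + 1) (E j)) ∧ S.IsOmegaPoint (E (Fin.last S.N))

/-- The step `V ∩ F_{d-N+m-a_m}(p)`, of rank `m`, of the distinguished complete flag on `V`
at `p`. -/
noncomputable def distinguished (p : Option (Fin S.n)) (V : Submodule A A[X]) (m : ℕ) :
    Submodule A A[X] :=
  V ⊓ S.flag p (S.d - S.N + m - (S.ram p).entry m)

/-- The `A`-points of the open subscheme `U ⊂ Fl`: for each `p` in `{z_1, …, z_n, ∞}` the flag `E`
lies in the open Schubert cell of the distinguished flag `D` on `V` at `p`, that is, `E_i` is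
transversal to `D_{N+1-i}` in `V` for all `i`. -/
def IsUPoint (E : Fin (S.N + 1) → Submodule A A[X]) : Prop :=
  S.IsFlPoint E ∧ ∀ p, ∀ j : Fin (S.N + 1),
    E j ⊔ S.distinguished p (E (Fin.last S.N)) (S.N - j) = E (Fin.last S.N)

/-- The `A`-points of the open subscheme `Fl^o ⊂ U`: for `i = 1, …, N - 1` the Wronskians of `E_i`
and `E_{i+1}` have no common roots outside `{z_1, …, z_n}`. (By the Nullstellensatz this means
that `∏_s (x - z_s)` vanishes on the common zero locus of the two Wronskians in the affine line
over `Spec A`, so it lies in the radical of the ideal they generate.) -/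
def FlO (A : Type) [CommRing A] [Algebra ℂ A] : Set (Fin (S.N + 1) → Submodule A A[X]) :=
  {E | S.IsUPoint E ∧ ∀ i j : Fin (S.N + 1), (j : ℕ) = i + 1 → (j : ℕ) < S.N →
    S.zProd A (fun _ => 1) ∈
      (Ideal.span ((wrLine (i + 1) (E i) : Set A[X]) ∪ wrLine (j + 1) (E j))).radical}

/-! ### The points of `𝒜` with values in a `ℂ`-algebra -/

/-- The `A`-points of `R = ∏_{i=1}^N ℙ(ℂ_{l_i}[x])`: tuples of line subbundles of the `A_{l_i}[x]`.
Here `L j` is the line of `y_{j+1}`. (There are none over `A ≠ 0` if some `l_i` is negative.) -/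
def IsRPoint (L : Fin S.N → Submodule A A[X]) : Prop :=
  ∀ j : Fin S.N, IsSubbundle (S.l (j + 1) + 1).toNat 1 (L j)

/-- The `A`-points of the open subscheme `R^o ⊂ R`: in addition, at every point of `Spec A`,
(α) `y_i` has degree exactly `l_i`; (β) `y_i` has no roots in `{z_1, …, z_n}`;
(γ) `y_i`, `y_{i+1}` have no common roots; (δ) `y_i` has no multiple roots. -/
def IsROPoint (L : Fin S.N → Submodule A A[X]) : Prop :=
  S.IsRPoint L ∧
  (∀ j : Fin S.N, (L j).map (lcoeff A (S.l (j + 1)).toNat) = ⊤) ∧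
  (∀ (j : Fin S.N) (s : Fin S.n), (L j).map (leval (algebraMap ℂ A (S.z s))) = ⊤) ∧
  (∀ i j : Fin S.N, (j : ℕ) = i + 1 → Ideal.span ((L i : Set A[X]) ∪ L j) = ⊤) ∧
  (∀ j : Fin S.N, Ideal.span ((L j : Set A[X]) ∪ derivative '' (L j : Set A[X])) = ⊤)

/-- The line of `y_i`, `0 ≤ i ≤ N + 1`, with the convention `y_0 = y_{N+1} = 1`. -/
noncomputable def line (L : Fin S.N → Submodule A A[X]) (i : ℕ) : Submodule A A[X] :=
  if h : 1 ≤ i ∧ i ≤ S.N then L ⟨i - 1, by omega⟩ else Submodule.span A {1}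

/-- The `A`-points of the closed subscheme `𝒜 ⊂ R^o`: `y_i` divides
`Wr(y_i', T_i y_{i-1} y_{i+1})` for `i = 1, …, N`. -/
def AA (A : Type) [CommRing A] [Algebra ℂ A] : Set (Fin S.N → Submodule A A[X]) :=
  {L | S.IsROPoint L ∧ ∀ i : ℕ, 1 ≤ i → i ≤ S.N →
    ∀ y ∈ S.line L i, ∀ v ∈ S.line L (i - 1), ∀ w ∈ S.line L (i + 1),
      y ∣ wronskian (derivative y) (S.T A i * v * w)}

end Points

end BasicSituation

/-! ### Schemes over `ℂ` and their points -/

/-- A scheme over `ℂ`. -/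
abbrev SchemeC : Type 1 := Over (Spec (CommRingCat.of ℂ))

/-- An algebraic scheme over `ℂ`: a scheme of finite type over `ℂ`. -/
def IsAlgebraicScheme (X : SchemeC) : Prop := LocallyOfFiniteType X.hom ∧ QuasiCompact X.hom

/-- `X(A) = Hom_ℂ (Spec A, X)`. -/
abbrev PointsOf (X : SchemeC) (A : CommAlgCat.{0} ℂ) : Type :=
  (algSpec (CommRingCat.of ℂ)).obj (op A) ⟶ X

/-- `X` is the `ℂ`-scheme whose set of `A`-points is `F A`, for all commutative `ℂ`-algebras `A`:
bijections `X(A) ≃ F A` that are compatible with base change along all homomorphisms `A → B`. Here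
the elements of `F A` are tuples of modules of polynomials over `A`. (A `ℂ`-scheme together with
such bijections is determined by `F` up to a unique isomorphism.) -/
structure PointsIdentification {ι : Type} (X : SchemeC)
    (F : ∀ (A : Type) [CommRing A] [Algebra ℂ A], Set (ι → Submodule A A[X])) where
  /-- the tuple that corresponds to a point -/
  tuple : ∀ A : CommAlgCat.{0} ℂ, PointsOf X A → ι → Submodule A (Polynomial A)
  bijOn : ∀ A : CommAlgCat.{0} ℂ, Set.BijOn (tuple A) Set.univ (F A)
  natural : ∀ (A B : CommAlgCat.{0} ℂ) (φ : A ⟶ B) (p : PointsOf X A) (i : ι),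
    tuple B ((algSpec (CommRingCat.of ℂ)).map φ.op ≫ p) i =
      baseChange (φ.hom : A →+* B) (tuple A p i)

/-- A morphism `Θ : X → Y` of `ℂ`-schemes, where `X` is identified with `Fl^o` and `Y` with `𝒜`, is
the Wronskian map `(V, E) ↦ (Wr(E_i) / K_i)_{i = 1, …, N}`: on `A`-points, `K_i y_i = Wr(E_i)`.
(As `K_i` is monic, this determines `y_i`.) -/
def IsWronskianMap (S : BasicSituation) {X Y : SchemeC}
    (α : PointsIdentification X S.FlO) (β : PointsIdentification Y S.AA) (Θ : X ⟶ Y) : Prop :=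
  ∀ (A : CommAlgCat.{0} ℂ) (p : PointsOf X A) (i : Fin S.N),
    (β.tuple A (p ≫ Θ) i).map (LinearMap.mulLeft A (S.K A (i + 1))) =
      wrLine (i + 1) (α.tuple A p i.castSucc)

end WronskiMap

/-!
# The Wronskian map is an isomorphism

Both `Fl^o` and `𝒜` are compared, over an arbitrary `ℂ`-algebra `A`, with the set of tuples
`(y_1, …, y_N)` of monic polynomials over `A` that satisfy the conditions defining `𝒜`
(`IsSolution`). For `𝒜` this is immediate: a line subbundle whose coefficient of highest degree is
nowhere zero has exactly one monic generator.

Let `W_k = Wr(u_0, …, u_{k-1})` for a basis `u_0, …, u_N` of the flag, so that `W_k` should be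
`K_k y_k`. Everything rests on the Desnanot–Jacobi identity in the form

`W_k · Wr(u_0, …, u_k, h) = Wr(W_{k+1}, Wr(u_0, …, u_{k-1}, h))` (`seqWr_mul_seqWrWith`),

together with `K_i K_{i+2} = K_{i+1}² T_{i+1}` (`K_mul_K`).

*From flags to solutions.* A point `E` of `U` has, for each marked point `p`, a basis adapted to `p`:
one whose leading exponents in the expansion at `p` are those prescribed by the ramification
sequence, with units as leading coefficients (`IsUPoint.exists_isAdapted`); these come from the
jumps of the ranks of `V ∩ F_u`. The leading coefficient of a Wronskian is a Vandermonde determinant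
in the exponents, so all the `W_k` have the expected leading exponent at all the marked points
(`SpansFlag.hasLead_seqWr`). Hence `W_k = K_k y_k` with `y_k` monic of degree `l_k` and invertible at
the `z_s`. With `h = u_{k+1}` the identity says that `Wr(y_{k+1}, g) = T_{k+1} y_k y_{k+2}` for some
`g`, and this gives both the divisibility and the absence of multiple roots
(`exists_isSolution_of_mem_FlO`).

*From solutions to flags.* If `y` is prime to `y'` and divides `Wr(y', P)`, then `Wr(y, g) = P` has a
solution `g` (`exists_wronskian_eq`), unique up to multiples of `y`. To find `u_k` with
`Wr(u_0, …, u_k) = K_{k+1} y_{k+1}`, one goes down through the Wronskians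
`Wr(u_0, …, u_{t-1}, u_k)`, solving one such equation for each `t`; the divisibility is inherited
from step to step (`IsSolution.exists_seqWrWith_eq`). The freedom in each step can be used to give
`u_k` the prescribed leading exponent at one marked point. A flag is determined by the Wronskians of
its steps (`span_eq_span_of_seqWr_eq`), so the choices made at different marked points produce the
same flag, which therefore lies in `Fl^o` (`IsSolution.exists_mem_FlO`).

*Schemes.* The scheme `𝒜` is affine, of finite type: its coordinates are the coefficients of the
monic `y_i` and of the inverse of `y_i' y_{i+1} ∏_s (x - z_s)` modulo `y_i`, which encodes the open
conditions (`linesOf_bijOn`). As `Fl^o` has the same points, naturally in `A`, it is represented by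
the same scheme. Finally, a natural map between the points of two `ℂ`-schemes with values in
`ℂ`-algebras is induced by a unique morphism (`IsNaturalOnPoints.exists_hom`,
`hom_ext_of_points`), which is an isomorphism if the map is bijective.
-/

namespace WronskiMap

/-! ### Determinants -/

section Determinants

open Matrix

variable {R S : Type} [CommRing R] [CommRing S] {n : Type} [Fintype n] [DecidableEq n]

/-- The matrix `A` bordered by the `j`-th column of `B` and the `i`-th row of `C`. -/
def bordered (A : Matrix n n R) (B : Matrix n (Fin 2) R) (C : Matrix (Fin 2) n R)
    (D : Matrix (Fin 2) (Fin 2) R) (i j : Fin 2) : Matrix (n ⊕ Fin 1) (n ⊕ Fin 1) R :=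
  fromBlocks A (of fun r _ => B r j) (of fun _ c => C i c) (of fun _ _ => D i j)

theorem map_det_bordered (f : R →+* S) (A : Matrix n n R) (B : Matrix n (Fin 2) R)
    (C : Matrix (Fin 2) n R) (D : Matrix (Fin 2) (Fin 2) R) (i j : Fin 2) :
    f (bordered A B C D i j).det =
      (bordered (A.map f) (B.map f) (C.map f) (D.map f) i j).det := by
  rw [RingHom.map_det]
  congr 1
  ext (r | r) (c | c) <;> rfl

theorem map_det_fromBlocks (f : R →+* S) (A : Matrix n n R) (B : Matrix n (Fin 2) R)
    (C : Matrix (Fin 2) n R) (D : Matrix (Fin 2) (Fin 2) R) :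
    f (fromBlocks A B C D).det =
      (fromBlocks (A.map f) (B.map f) (C.map f) (D.map f)).det := by
  rw [RingHom.map_det]
  congr 1
  ext (r | r) (c | c) <;> rfl

theorem map_det_eq (f : R →+* S) (A : Matrix n n R) : f A.det = (A.map f).det := by
  rw [RingHom.map_det]
  rfl

theorem det_mul_det_fromBlocks_of_isUnit (A : Matrix n n R) (B : Matrix n (Fin 2) R)
    (C : Matrix (Fin 2) n R) (D : Matrix (Fin 2) (Fin 2) R) (hA : IsUnit A.det) :
    A.det * (fromBlocks A B C D).det =
      (bordered A B C D 0 0).det * (bordered A B C D 1 1).det -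
        (bordered A B C D 0 1).det * (bordered A B C D 1 0).det := by
  let := invertibleOfIsUnitDet A hA
  have key : ∀ i j, (bordered A B C D i j).det = A.det * (D - C * ⅟A * B) i j := by
    intro i j
    rw [bordered, det_fromBlocks₁₁]
    congr 1
    rw [det_unique]
    rfl
  rw [det_fromBlocks₁₁, det_fin_two, key, key, key, key]
  ring

/-- The **Desnanot–Jacobi identity**. If the corner `A` is invertible it is read off from the Schur
complement of `A`; the general case follows by replacing `A` with `X + A`. -/
theorem det_mul_det_fromBlocks (A : Matrix n n R) (B : Matrix n (Fin 2) R)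
    (C : Matrix (Fin 2) n R) (D : Matrix (Fin 2) (Fin 2) R) :
    A.det * (fromBlocks A B C D).det =
      (bordered A B C D 0 0).det * (bordered A B C D 1 1).det -
        (bordered A B C D 0 1).det * (bordered A B C D 1 0).det := by
  -- the identity for matrices whose corner has a regular determinant
  have regular : ∀ {S : Type} [CommRing S] (A : Matrix n n S)
      (B : Matrix n (Fin 2) S) (C : Matrix (Fin 2) n S) (D : Matrix (Fin 2) (Fin 2) S),
      A.det ∈ nonZeroDivisors S → A.det * (fromBlocks A B C D).det =
      (bordered A B C D 0 0).det * (bordered A B C D 1 1).det -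
        (bordered A B C D 0 1).det * (bordered A B C D 1 0).det := by
    intro S _ A B C D hA
    apply IsLocalization.injective (Localization (nonZeroDivisors S)) (le_refl _)
    simp only [map_mul, map_sub, map_det_bordered, map_det_fromBlocks]
    rw [map_det_eq]
    apply det_mul_det_fromBlocks_of_isUnit
    rw [← map_det_eq]
    exact IsLocalization.map_units (Localization (nonZeroDivisors S)) ⟨_, hA⟩
  have h := regular (charmatrix (-A)) (B.map Polynomial.C) (C.map Polynomial.C)
    (D.map Polynomial.C) (charpoly_monic (-A)).mem_nonZeroDivisors
  have h0 := congrArg (Polynomial.evalRingHom (0 : R)) h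
  have e1 : (charmatrix (-A)).map (Polynomial.evalRingHom (0 : R)) = A := by
    ext i j
    by_cases hij : i = j
    · subst hij; simp
    · simp [hij]
  have e2 : ∀ {m k : Type} (B : Matrix m k R),
      (B.map Polynomial.C).map (Polynomial.evalRingHom (0 : R)) = B := by
    intro m k B; ext; simp
  simp only [map_mul, map_sub, map_det_bordered, map_det_fromBlocks, e1, e2] at h0
  rwa [map_det_eq, e1] at h0

/-- The Leibniz rule for the determinant of a matrix of polynomials, row by row. -/
theorem derivative_det (M : Matrix n n R[X]) :
    derivative M.det = ∑ i, (M.updateRow i fun c => derivative (M i c)).det := by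
  rw [← det_transpose M, det_apply, map_sum]
  have h2 : ∀ i, (M.updateRow i fun c => derivative (M i c)).det =
      ∑ σ : Equiv.Perm n, Equiv.Perm.sign σ •
        ((∏ j ∈ Finset.univ.erase i, M j (σ j)) * derivative (M i (σ i))) := by
    intro i
    rw [← det_transpose, det_apply]
    refine Finset.sum_congr rfl fun σ _ => ?_
    congr 1
    rw [← Finset.mul_prod_erase _ _ (Finset.mem_univ i), mul_comm]
    congr 1
    · refine Finset.prod_congr rfl fun j hj => ?_
      rw [transpose_apply, updateRow_ne (Finset.ne_of_mem_erase hj)]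
    · rw [transpose_apply, updateRow_self]
  simp_rw [h2]
  rw [Finset.sum_comm]
  refine Finset.sum_congr rfl fun σ _ => ?_
  rw [← Finset.smul_sum]
  have : ∀ (s : ℤˣ) (f : R[X]), derivative (s • f) = s • derivative f := by
    intro s f
    rw [Units.smul_def, Units.smul_def, map_zsmul]
  rw [this, derivative_prod_finset]
  rfl

end Determinants

/-! ### Wronskians -/

section Wronskians

open Matrix

variable {A : Type} [CommRing A]

/-- `Wr(u_0, …, u_{k-1})`. -/
noncomputable def seqWr (u : ℕ → A[X]) (k : ℕ) : A[X] := wr fun j : Fin k => u j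

/-- `Wr(u_0, …, u_{k-1}, h)`. -/
noncomputable def seqWrWith (u : ℕ → A[X]) (k : ℕ) (h : A[X]) : A[X] :=
  wr fun j : Fin (k + 1) => if (j : ℕ) < k then u j else h

@[simp] theorem seqWr_zero (u : ℕ → A[X]) : seqWr u 0 = 1 := by simp [seqWr, wr]

theorem seqWrWith_zero (u : ℕ → A[X]) (h : A[X]) : seqWrWith u 0 h = h := by
  simp [seqWrWith, wr]

theorem seqWrWith_self (u : ℕ → A[X]) (k : ℕ) : seqWrWith u k (u k) = seqWr u (k + 1) := by
  unfold seqWrWith seqWr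
  congr 1
  funext j
  split_ifs with h
  · rfl
  · congr 1; omega

/-- The derivative of a Wronskian is obtained by differentiating its last row, as the other
differentiated rows repeat the row below them. -/
theorem derivative_wr {k : ℕ} (f : Fin (k + 1) → A[X]) :
    derivative (wr f) = Matrix.det (Matrix.of fun r c : Fin (k + 1) =>
      derivative^[if (r : ℕ) < k then (r : ℕ) else k + 1] (f c)) := by
  rw [wr, derivative_det, Finset.sum_eq_single (Fin.last k)]
  · congr 1
    ext1 r c
    by_cases hr : r = Fin.last k
    · subst hr
      simp [Function.iterate_succ_apply']
    · have : (r : ℕ) < k := by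
        have := r.2; have : (r : ℕ) ≠ k := fun h => hr (Fin.ext h); omega
      simp [updateRow_ne hr, this]
  · intro i _ hi
    have hik : (i : ℕ) < k := by
      have := i.2; have : (i : ℕ) ≠ k := fun h => hi (Fin.ext h); omega
    -- the differentiated row `i` coincides with row `i + 1`
    refine det_zero_of_row_eq (i := i) (j := ⟨i + 1, by omega⟩) ?_ ?_
    · intro h; have := congrArg Fin.val h; simp at this
    · ext1 c
      have hne : (⟨i + 1, by omega⟩ : Fin (k + 1)) ≠ i := by
        intro h; have := congrArg Fin.val h; simp at this
      rw [updateRow_self, updateRow_ne hne]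
      simp [Function.iterate_succ_apply']
  · simp

/-- `Wr(u_0..u_{k-1}) · Wr(u_0..u_k, h)` is the Wronskian of `Wr(u_0..u_k)` and
`Wr(u_0..u_{k-1}, h)`: this is the Desnanot–Jacobi identity, as the derivative of a Wronskian is
obtained by differentiating its last row. -/
theorem seqWr_mul_seqWrWith (u : ℕ → A[X]) (k : ℕ) (h : A[X]) :
    seqWr u k * seqWrWith u (k + 1) h =
      wronskian (seqWr u (k + 1)) (seqWrWith u k h) := by
  have key := det_mul_det_fromBlocks
    (Matrix.of fun r c : Fin k => derivative^[(r : ℕ)] (u c))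
    (Matrix.of fun (r : Fin k) (c : Fin 2) => derivative^[(r : ℕ)] (if c = 0 then u k else h))
    (Matrix.of fun (r : Fin 2) (c : Fin k) => derivative^[k + (r : ℕ)] (u c))
    (Matrix.of fun (r : Fin 2) (c : Fin 2) => derivative^[k + (r : ℕ)] (if c = 0 then u k else h))
  have e0 : (Matrix.of fun r c : Fin k => derivative^[(r : ℕ)] (u c)).det = seqWr u k := rfl
  have e1 : (fromBlocks (Matrix.of fun r c : Fin k => derivative^[(r : ℕ)] (u c))
      (Matrix.of fun (r : Fin k) (c : Fin 2) => derivative^[(r : ℕ)] (if c = 0 then u k else h))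
      (Matrix.of fun (r : Fin 2) (c : Fin k) => derivative^[k + (r : ℕ)] (u c))
      (Matrix.of fun (r : Fin 2) (c : Fin 2) =>
        derivative^[k + (r : ℕ)] (if c = 0 then u k else h))).det = seqWrWith u (k + 1) h := by
    rw [seqWrWith, wr, ← det_submatrix_equiv_self (finSumFinEquiv (m := k) (n := 2))]
    congr 1
    ext1 (r | r) (c | c)
    · simp
    · fin_cases c <;> simp
    · simp
    · fin_cases c <;> simp
  have f0 : ∀ (i j : Fin 2), (bordered
      (Matrix.of fun r c : Fin k => derivative^[(r : ℕ)] (u c))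
      (Matrix.of fun (r : Fin k) (c : Fin 2) => derivative^[(r : ℕ)] (if c = 0 then u k else h))
      (Matrix.of fun (r : Fin 2) (c : Fin k) => derivative^[k + (r : ℕ)] (u c))
      (Matrix.of fun (r : Fin 2) (c : Fin 2) =>
        derivative^[k + (r : ℕ)] (if c = 0 then u k else h)) i j).det =
      derivative^[(i : ℕ)] (seqWrWith u k (if j = 0 then u k else h)) := by
    intro i j
    have hd : derivative^[(i : ℕ)] (seqWrWith u k (if j = 0 then u k else h)) =
        (Matrix.of fun r c : Fin (k + 1) =>
          derivative^[if (r : ℕ) < k then (r : ℕ) else k + i]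
            (if (c : ℕ) < k then u c else if j = 0 then u k else h)).det := by
      fin_cases i
      · simp only [Function.iterate_zero, id, seqWrWith, wr]
        congr 1
        ext1 r c
        have : (if (r : ℕ) < k then (r : ℕ) else k + 0) = r := by
          have := r.2
          split_ifs <;> omega
        simp only [Matrix.of_apply, this]
      · simp only [Function.iterate_one, seqWrWith]
        rw [derivative_wr]
    rw [hd, bordered, ← det_submatrix_equiv_self (finSumFinEquiv (m := k) (n := 1))]
    congr 1
    ext1 (r | r) (c | c)
    · simp
    · simp
    · simp
    · simp
  rw [e0, e1, f0, f0, f0, f0] at key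
  rw [key]
  simp [seqWrWith_self, wronskian]
  ring

theorem map_wr {B : Type} [CommRing B] (φ : A[X] →+* B[X])
    (hφ : ∀ f, φ (derivative f) = derivative (φ f)) {k : ℕ} (f : Fin k → A[X]) :
    φ (wr f) = wr fun j => φ (f j) := by
  have hit : ∀ (r : ℕ) (f : A[X]), φ (derivative^[r] f) = derivative^[r] (φ f) := by
    intro r
    induction r with
    | zero => intro f; rfl
    | succ r ih => intro f; rw [Function.iterate_succ_apply, ih, hφ, Function.iterate_succ_apply]
  rw [wr, map_det_eq, wr]
  congr 1
  ext1 r c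
  simp [hit]

theorem derivative_taylor (r : A) (f : A[X]) : derivative (taylor r f) = taylor r (derivative f) := by
  simp [taylor_apply, derivative_comp]

theorem taylor_wr (r : A) {k : ℕ} (f : Fin k → A[X]) :
    taylor r (wr f) = wr fun j => taylor r (f j) :=
  map_wr (taylorEquiv r : A[X] →+* A[X]) (fun f => (derivative_taylor r f).symm) f

theorem taylor_wronskian (r : A) (f g : A[X]) :
    taylor r (wronskian f g) = wronskian (taylor r f) (taylor r g) := by
  simp [wronskian, derivative_taylor, taylor_mul]

theorem wr_sum_smul {k : ℕ} (u : Fin k → A[X]) (M : Matrix (Fin k) (Fin k) A) :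
    (wr fun c => ∑ j, M j c • u j) = C M.det * wr u := by
  rw [wr, wr, map_det_eq, mul_comm, ← det_mul]
  congr 1
  ext1 r c
  simp only [of_apply, mul_apply, map_apply, iterate_derivative_sum, iterate_derivative_smul]
  refine Finset.sum_congr rfl fun j _ => ?_
  rw [smul_eq_C_mul, mul_comm]

theorem wrLine_span_range {k : ℕ} (u : Fin k → A[X]) :
    wrLine k (Submodule.span A (Set.range u)) = Submodule.span A {wr u} := by
  apply le_antisymm
  · refine Submodule.span_le.2 ?_
    rintro _ ⟨f, hf, rfl⟩
    choose M hM using fun c => (Submodule.mem_span_range_iff_exists_fun A).1 (hf c)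
    have : wr f = wr fun c => ∑ j, (Matrix.of fun j c => M c j) j c • u j := by
      congr 1
      funext c
      simp [hM]
    rw [this, wr_sum_smul, ← smul_eq_C_mul]
    exact Submodule.smul_mem _ _ (Submodule.mem_span_singleton_self _)
  · refine Submodule.span_mono ?_
    rintro _ rfl
    exact ⟨u, fun j => Submodule.subset_span ⟨j, rfl⟩, rfl⟩

theorem seqWrWith_eq_det (u : ℕ → A[X]) (k : ℕ) (h : A[X]) :
    seqWrWith u k h = ((Matrix.of fun r c : Fin (k + 1) =>
      derivative^[(r : ℕ)] (if (c : ℕ) < k then u c else 0)).updateCol (Fin.last k)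
        fun r => derivative^[(r : ℕ)] h).det := by
  rw [seqWrWith, wr]
  congr 1
  ext1 r c
  by_cases hc : c = Fin.last k
  · subst hc; simp
  · have : (c : ℕ) < k := by
      have := c.2; have : (c : ℕ) ≠ k := fun h => hc (Fin.ext h); omega
    simp [updateCol_ne hc, this]

theorem seqWrWith_add (u : ℕ → A[X]) (k : ℕ) (f g : A[X]) :
    seqWrWith u k (f + g) = seqWrWith u k f + seqWrWith u k g := by
  rw [seqWrWith_eq_det, seqWrWith_eq_det, seqWrWith_eq_det, ← det_updateCol_add]
  congr 2
  funext r
  simp [iterate_map_add]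

theorem seqWrWith_smul (u : ℕ → A[X]) (k : ℕ) (a : A) (f : A[X]) :
    seqWrWith u k (a • f) = a • seqWrWith u k f := by
  rw [seqWrWith_eq_det, seqWrWith_eq_det, smul_eq_C_mul, smul_eq_C_mul, ← det_updateCol_smul]
  congr 2
  funext r
  simp

end Wronskians

/-! ### Leading terms at infinity and at the origin -/

section Leads

variable {A : Type} [CommRing A]

/-- The exponent `k` lies beyond `e`: it is higher than `e` for expansions at infinity (`b = true`),
and lower than `e` for expansions at the origin (`b = false`). -/
def Beyond (b : Bool) (k e : ℕ) : Prop := if b then e < k else k < e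

/-- `f` has leading term `c x ^ e`, where "leading" means highest if `b = true` and lowest if
`b = false`. The coefficient `c` is allowed to be zero. -/
structure HasLead (b : Bool) (e : ℕ) (c : A) (f : A[X]) : Prop where
  coeff_eq : f.coeff e = c
  coeff_beyond : ∀ k, Beyond b k e → f.coeff k = 0

theorem HasLead.mul {b : Bool} {e e' : ℕ} {c c' : A} {f g : A[X]} (hf : HasLead b e c f)
    (hg : HasLead b e' c' g) : HasLead b (e + e') (c * c') (f * g) := by
  constructor
  · rw [coeff_mul, Finset.sum_eq_single (e, e')]
    · rw [hf.coeff_eq, hg.coeff_eq]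
    · rintro ⟨i, j⟩ hij hne
      rw [Finset.HasAntidiagonal.mem_antidiagonal] at hij
      simp only at hij ⊢
      have : Beyond b i e ∨ Beyond b j e' := by
        have : i ≠ e ∨ j ≠ e' := by
          by_contra! h; exact hne (by rw [h.1, h.2])
        cases b <;> simp only [Beyond, if_true, Bool.false_eq_true, if_false] <;> omega
      rcases this with h | h
      · rw [hf.coeff_beyond i h, zero_mul]
      · rw [hg.coeff_beyond j h, mul_zero]
    · simp
  · intro k hk
    rw [coeff_mul]
    refine Finset.sum_eq_zero ?_
    rintro ⟨i, j⟩ hij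
    rw [Finset.HasAntidiagonal.mem_antidiagonal] at hij
    simp only at hij ⊢
    have : Beyond b i e ∨ Beyond b j e' := by
      cases b <;> simp only [Beyond, if_true, Bool.false_eq_true, if_false] at hk ⊢ <;> omega
    rcases this with h | h
    · rw [hf.coeff_beyond i h, zero_mul]
    · rw [hg.coeff_beyond j h, mul_zero]

theorem HasLead.sum {ι : Type} (s : Finset ι) {b : Bool} {e : ℕ} {c : ι → A} {f : ι → A[X]}
    (h : ∀ i, HasLead b e (c i) (f i)) : HasLead b e (∑ i ∈ s, c i) (∑ i ∈ s, f i) where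
  coeff_eq := by simp [fun i => (h i).coeff_eq]
  coeff_beyond k hk := by
    rw [finsetSum_coeff]
    exact Finset.sum_eq_zero fun i _ => (h i).coeff_beyond k hk

theorem HasLead.smul {b : Bool} {e : ℕ} {c : A} {f : A[X]} (a : A) (h : HasLead b e c f) :
    HasLead b e (a * c) (a • f) where
  coeff_eq := by simp [h.coeff_eq]
  coeff_beyond k hk := by simp [h.coeff_beyond k hk]

theorem HasLead.sub {b : Bool} {e : ℕ} {c c' : A} {f g : A[X]} (hf : HasLead b e c f)
    (hg : HasLead b e c' g) : HasLead b e (c - c') (f - g) where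
  coeff_eq := by simp [hf.coeff_eq, hg.coeff_eq]
  coeff_beyond k hk := by simp [hf.coeff_beyond k hk, hg.coeff_beyond k hk]

theorem hasLead_one (b : Bool) : HasLead b 0 (1 : A) 1 where
  coeff_eq := by simp
  coeff_beyond k hk := by
    rw [coeff_one, if_neg]
    rintro rfl
    cases b <;> simp [Beyond] at hk

theorem HasLead.prod {ι : Type} (s : Finset ι) {b : Bool} {e : ι → ℕ} {c : ι → A} {f : ι → A[X]}
    (h : ∀ i, HasLead b (e i) (c i) (f i)) :
    HasLead b (∑ i ∈ s, e i) (∏ i ∈ s, c i) (∏ i ∈ s, f i) := by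
  classical
  induction s using Finset.induction_on with
  | empty => simpa using hasLead_one b
  | insert i s hi ih =>
    rw [Finset.sum_insert hi, Finset.prod_insert hi, Finset.prod_insert hi]
    exact (h i).mul ih

theorem HasLead.det {n : Type} [Fintype n] [DecidableEq n] {b : Bool} {e : n → ℕ}
    {a : Matrix n n A} {M : Matrix n n A[X]} (h : ∀ r c, HasLead b (e c) (a r c) (M r c)) :
    HasLead b (∑ c, e c) a.det M.det := by
  rw [Matrix.det_apply', Matrix.det_apply']
  refine HasLead.sum _ fun σ => ?_
  have h1 := HasLead.prod Finset.univ fun c => h (σ c) c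
  have h2 := h1.smul ((Equiv.Perm.sign σ : ℤ) : A)
  rw [smul_eq_C_mul] at h2
  simpa using h2

theorem HasLead.X_pow_mul_derivative {b : Bool} {e : ℕ} {c : A} {f : A[X]} (h : HasLead b e c f)
    (r : ℕ) : HasLead b e (c * (e.descFactorial r : A)) (X ^ r * derivative^[r] f) := by
  have key : ∀ k, (X ^ r * derivative^[r] f).coeff k = f.coeff k * (k.descFactorial r : A) := by
    intro k
    rw [coeff_X_pow_mul']
    split_ifs with hk
    · rw [coeff_iterate_derivative, Nat.sub_add_cancel hk, nsmul_eq_mul, mul_comm]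
    · rw [Nat.descFactorial_eq_zero_iff_lt.2 (not_le.1 hk)]; simp
  exact ⟨by rw [key, h.coeff_eq], fun k hk => by rw [key, h.coeff_beyond k hk, zero_mul]⟩

theorem HasLead.X_pow_mul {b : Bool} {e : ℕ} {c : A} {f : A[X]} (h : HasLead b e c f) (r : ℕ) :
    HasLead b (r + e) c (X ^ r * f) := by
  have : HasLead b r (1 : A) (X ^ r) := by
    refine ⟨by simp, fun k hk => ?_⟩
    rw [coeff_X_pow, if_neg]
    rintro rfl
    cases b <;> simp [Beyond] at hk
  simpa using this.mul h

/-- The leading coefficient is a product of a Vandermonde determinant in the exponents with the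
leading coefficients of the `f j`. -/
theorem HasLead.wr [Algebra ℂ A] {k : ℕ} {b : Bool} {e : Fin k → ℕ} (he : Function.Injective e)
    {c : Fin k → A} (hc : ∀ j, IsUnit (c j)) {f : Fin k → A[X]}
    (h : ∀ j, HasLead b (e j) (c j) (f j)) :
    ∃ a : A, IsUnit a ∧ HasLead b (∑ j, e j) a (X ^ k.choose 2 * wr f) := by
  have hlead : HasLead b (∑ j, e j)
      (Matrix.of fun r j : Fin k => c j * ((e j).descFactorial r : A)).det
      (X ^ k.choose 2 * WronskiMap.wr f) := by
    have hX : (X : A[X]) ^ k.choose 2 = ∏ r : Fin k, X ^ (r : ℕ) := by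
      rw [Finset.prod_pow_eq_pow_sum, Fin.sum_univ_eq_sum_range (fun i => i), Finset.sum_range_id,
        Nat.choose_two_right]
    have h1 : (X : A[X]) ^ k.choose 2 * WronskiMap.wr f =
        (Matrix.of fun r c : Fin k => X ^ (r : ℕ) * derivative^[(r : ℕ)] (f c)).det := by
      rw [WronskiMap.wr, hX]
      exact (Matrix.det_mul_column (fun r : Fin k => (X : A[X]) ^ (r : ℕ)) _).symm
    rw [h1]
    exact HasLead.det fun r j => (h j).X_pow_mul_derivative r
  refine ⟨_, ?_, hlead⟩
  have h0 := Matrix.det_mul_row c (Matrix.of fun r j : Fin k => ((e j).descFactorial r : A))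
  simp only [Matrix.of_apply] at h0
  rw [h0]
  refine IsUnit.mul (IsUnit.prod_univ_iff.2 hc) ?_
  have h2 : (Matrix.of fun r j : Fin k => ((e j).descFactorial r : A)) =
      (Matrix.of fun r j : Fin k => ((e j).descFactorial r : ℂ)).map (algebraMap ℂ A) := by
    ext; simp
  rw [h2, ← map_det_eq]
  refine IsUnit.map _ (isUnit_iff_ne_zero.2 ?_)
  have h3 := Matrix.det_eval_matrixOfPolynomials_eq_det_vandermonde (fun j => (e j : ℂ))
    (fun i : Fin k => descPochhammer ℂ i) (fun i => descPochhammer_natDegree ℂ i)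
    (fun i => monic_descPochhammer ℂ i)
  rw [← Matrix.det_transpose]
  have h4 : (Matrix.of fun r j : Fin k => ((e j).descFactorial r : ℂ)).transpose =
      Matrix.of fun i j : Fin k => (descPochhammer ℂ j).eval (e i : ℂ) := by
    ext i j
    simp [descPochhammer_eval_eq_descFactorial]
  rw [h4, ← h3, Matrix.det_vandermonde_ne_zero_iff]
  exact Nat.cast_injective.comp he

/-- Among the exponents of `f` with property `P` there is one that no other such exponent lies
beyond. -/
theorem exists_extreme (b : Bool) (f : A[X]) (P : ℕ → Prop) (h : ∃ k, P k ∧ f.coeff k ≠ 0) :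
    ∃ k, P k ∧ f.coeff k ≠ 0 ∧ ∀ k', Beyond b k' k → P k' → f.coeff k' = 0 := by
  classical
  have hne : (f.support.filter P).Nonempty := by
    obtain ⟨k, hk, hk'⟩ := h
    exact ⟨k, by simp [hk, hk']⟩
  cases b
  · refine ⟨_, (Finset.mem_filter.1 (Finset.min'_mem _ hne)).2,
      mem_support_iff.1 (Finset.mem_filter.1 (Finset.min'_mem _ hne)).1, fun k' hk' hP => ?_⟩
    by_contra hc
    have := Finset.min'_le (f.support.filter P) k' (by simp [hP, hc])
    simp only [Beyond, Bool.false_eq_true, if_false] at hk'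
    omega
  · refine ⟨_, (Finset.mem_filter.1 (Finset.max'_mem _ hne)).2,
      mem_support_iff.1 (Finset.mem_filter.1 (Finset.max'_mem _ hne)).1, fun k' hk' hP => ?_⟩
    by_contra hc
    have := Finset.le_max' (f.support.filter P) k' (by simp [hP, hc])
    simp only [Beyond, if_true] at hk'
    omega

theorem HasLead.X_mul_wronskian {b : Bool} {e e' : ℕ} {c c' : A} {f g : A[X]}
    (hf : HasLead b e c f) (hg : HasLead b e' c' g) :
    HasLead b (e + e') (((e' : A) - e) * (c * c')) (X * wronskian f g) := by
  have h1 := hf.mul (hg.X_pow_mul_derivative 1)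
  have h2 := (hf.X_pow_mul_derivative 1).mul hg
  have h3 := h1.sub h2
  convert h3 using 1
  · simp; ring
  · simp [wronskian]; ring

theorem isUnit_natCast_sub [Algebra ℂ A] {m n : ℕ} (h : m ≠ n) : IsUnit ((m : A) - n) := by
  have : ((m : A) - n) = algebraMap ℂ A ((m : ℂ) - n) := by simp
  rw [this]
  exact IsUnit.map _ (isUnit_iff_ne_zero.2 (sub_ne_zero.2 (by exact_mod_cast h)))

/-- A solution `f` of `x Wr(W, f) = P` has no constant multiple of `W` left in it once its
coefficient at the leading exponent of `W` vanishes; its leading exponent is then the one that the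
leading exponents of `W` and `P` dictate. -/
theorem HasLead.of_X_mul_wronskian [Algebra ℂ A] {b : Bool} {w m : ℕ} {c c' : A} {W f P : A[X]}
    (hc : IsUnit c) (hc' : IsUnit c') (hW : HasLead b w c W) (hP : HasLead b (w + m) c' P)
    (h : X * wronskian W f = P) (hf : f.coeff w = 0) :
    ∃ a, IsUnit a ∧ HasLead b m a f := by
  have hbeyond : ∀ k, Beyond b k m → f.coeff k = 0 := by
    by_contra! hcon
    obtain ⟨k, hk, hk0, hext⟩ := exists_extreme b f (fun k => Beyond b k m) hcon
    have hlead : HasLead b k (f.coeff k) f := by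
      refine ⟨rfl, fun k' hk' => hext k' hk' ?_⟩
      cases b <;> simp only [Beyond, if_true, Bool.false_eq_true, if_false] at hk hk' ⊢ <;> omega
    have h1 := (hW.X_mul_wronskian hlead).coeff_eq
    rw [h, hP.coeff_beyond] at h1
    · have hkw : k ≠ w := fun hkw => hk0 (hkw ▸ hf)
      exact hk0 (((isUnit_natCast_sub hkw).mul_right_eq_zero.1
        h1.symm) |> fun h => hc.mul_right_eq_zero.1 h)
    · cases b <;> simp only [Beyond, if_true, Bool.false_eq_true, if_false] at hk ⊢ <;> omega
  have hlead : HasLead b m (f.coeff m) f := ⟨rfl, hbeyond⟩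
  refine ⟨_, ?_, hlead⟩
  have h1 := (hW.X_mul_wronskian hlead).coeff_eq
  rw [h, hP.coeff_eq] at h1
  rw [h1] at hc'
  exact isUnit_of_mul_isUnit_right (isUnit_of_mul_isUnit_right hc')

/-- The multiple of `W` is chosen to cancel the coefficient of `f` at the leading exponent of `W`; a
nonzero difference would have a leading exponent other than that of `W`, and a nonzero
Wronskian with `W`. -/
theorem eq_smul_of_wronskian_eq_zero [Algebra ℂ A] {b : Bool} {w : ℕ} {c : A} {W f : A[X]}
    (hc : IsUnit c) (hW : HasLead b w c W) (h : wronskian W f = 0) :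
    ∃ a : A, f = a • W := by
  obtain ⟨c, rfl⟩ := hc
  refine ⟨f.coeff w * ↑c⁻¹, ?_⟩
  rw [← sub_eq_zero]
  set g := f - (f.coeff w * ↑c⁻¹) • W with hg
  have hgw : g.coeff w = 0 := by simp [hg, hW.coeff_eq]
  have hwg : wronskian W g = 0 := by
    have : wronskian W g = wronskian W f - C (f.coeff w * ↑c⁻¹) * wronskian W W := by
      simp only [hg, wronskian, smul_eq_C_mul, derivative_sub, derivative_mul, derivative_C]
      ring
    rw [this, h, wronskian_self_eq_zero]; simp
  by_contra hg0
  have : ∃ k, True ∧ g.coeff k ≠ 0 := by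
    by_contra! hcon
    exact hg0 (Polynomial.ext fun k => by simpa using hcon k)
  obtain ⟨k, -, hk0, hext⟩ := exists_extreme b g (fun _ => True) this
  have hlead : HasLead b k (g.coeff k) g := ⟨rfl, fun k' hk' => hext k' hk' trivial⟩
  have h1 := (hW.X_mul_wronskian hlead).coeff_eq
  rw [hwg, mul_zero, coeff_zero] at h1
  have hkw : k ≠ w := fun hkw => hk0 (hkw ▸ hgw)
  exact hk0 (((isUnit_natCast_sub hkw).mul_right_eq_zero.1
        h1.symm) |> fun h => c.isUnit.mul_right_eq_zero.1 h)

/-- A linear differential equation with solutions `u_0, …, u_{k-1}`: its other solutions are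
combinations of these, if all the partial Wronskians are monic. -/
theorem mem_span_of_seqWrWith_eq_zero [Algebra ℂ A] (u : ℕ → A[X]) (k : ℕ)
    (hW : ∀ j ≤ k, (seqWr u j).Monic) (h : A[X]) (hh : seqWrWith u k h = 0) :
    h ∈ Submodule.span A (u '' Set.Iio k) := by
  induction k generalizing h with
  | zero => rw [seqWrWith_zero] at hh; rw [hh]; exact Submodule.zero_mem _
  | succ k ih =>
    have h1 := seqWr_mul_seqWrWith u k h
    rw [hh, mul_zero] at h1
    have hlead : HasLead true (seqWr u (k + 1)).natDegree (1 : A) (seqWr u (k + 1)) :=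
      ⟨hW _ le_rfl, fun j hj => coeff_eq_zero_of_natDegree_lt (by simpa [Beyond] using hj)⟩
    obtain ⟨a, ha⟩ := eq_smul_of_wronskian_eq_zero isUnit_one hlead h1.symm
    have h2 : seqWrWith u k (h + (-a) • u k) = 0 := by
      rw [seqWrWith_add, seqWrWith_smul, seqWrWith_self, ha]
      simp
    have h3 := ih (fun j hj => hW j (by omega)) _ h2
    have h4 : h = (h + (-a) • u k) + a • u k := by module
    rw [h4]
    refine Submodule.add_mem _ (Submodule.span_mono (Set.image_mono ?_) h3)
      (Submodule.smul_mem _ _ (Submodule.subset_span ⟨k, ?_, rfl⟩))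
    · intro j hj; simp only [Set.mem_Iio] at *; omega
    · simp

end Leads

/-! ### Ranks of direct summands -/

section Ranks

variable {A : Type} [CommRing A] {M : Type} [AddCommGroup M] [Module A M]

theorem exists_equiv_prod_of_projective {N : Type} [AddCommGroup N] [Module A N]
    [Module.Projective A N] (g : M →ₗ[A] N) (hg : Function.Surjective g) :
    Nonempty (M ≃ₗ[A] LinearMap.ker g × N) := by
  obtain ⟨s, hs⟩ := Module.projective_lifting_property g LinearMap.id hg
  have hs' : ∀ n, g (s n) = n := fun n => LinearMap.congr_fun hs n
  exact ⟨LinearEquiv.ofLinearMap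
    (LinearMap.prod ((LinearMap.id - s ∘ₗ g).codRestrict _ fun m => by simp [hs']) g)
    (LinearMap.coprod (LinearMap.ker g).subtype s)
    (by
      apply LinearMap.ext
      rintro ⟨⟨k, hk⟩, n⟩
      rw [LinearMap.mem_ker] at hk
      rw [LinearMap.comp_apply, LinearMap.id_apply]
      refine Prod.ext (Subtype.ext ?_) ?_ <;> simp [hs', hk])
    (by ext m; simp)⟩

theorem projective_of_projective_quotient [Module.Projective A M] (V : Submodule A M)
    [Module.Projective A (M ⧸ V)] : Module.Projective A V := by
  obtain ⟨e⟩ := exists_equiv_prod_of_projective V.mkQ V.mkQ_surjective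
  rw [Submodule.ker_mkQ] at e
  exact Module.Projective.of_split (e.symm.toLinearMap ∘ₗ LinearMap.inl A V (M ⧸ V))
    (LinearMap.fst A V (M ⧸ V) ∘ₗ e.toLinearMap) (by ext; simp)

theorem finite_of_projective_quotient [Module.Finite A M] (V : Submodule A M)
    [Module.Projective A (M ⧸ V)] : Module.Finite A V := by
  obtain ⟨e⟩ := exists_equiv_prod_of_projective V.mkQ V.mkQ_surjective
  rw [Submodule.ker_mkQ] at e
  exact Module.Finite.of_surjective (LinearMap.fst A V (M ⧸ V) ∘ₗ e.toLinearMap)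
    (Prod.fst_surjective.comp e.surjective)

theorem rankAtStalk_eq_add {N : Type} [AddCommGroup N] [Module A N] [Module.Projective A M]
    [Module.Finite A M] [Module.Projective A N] (g : M →ₗ[A] N) (hg : Function.Surjective g)
    (p : PrimeSpectrum A) :
    Module.rankAtStalk (R := A) M p =
      Module.rankAtStalk (R := A) (LinearMap.ker g) p + Module.rankAtStalk (R := A) N p := by
  obtain ⟨e⟩ := exists_equiv_prod_of_projective g hg
  have : Module.Finite A N := Module.Finite.of_surjective g hg
  have : Module.Finite A (LinearMap.ker g) :=
    Module.Finite.of_surjective (LinearMap.fst A (LinearMap.ker g) N ∘ₗ e.toLinearMap)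
      (Prod.fst_surjective.comp e.surjective)
  have : Module.Projective A (LinearMap.ker g) :=
    Module.Projective.of_split (e.symm.toLinearMap ∘ₗ LinearMap.inl A (LinearMap.ker g) N)
      (LinearMap.fst A (LinearMap.ker g) N ∘ₗ e.toLinearMap) (by ext; simp)
  rw [Module.rankAtStalk_eq_of_equiv e, Module.rankAtStalk_prod]
  rfl

theorem rankAtStalk_eq_quotient_add [Module.Projective A M] [Module.Finite A M]
    (V : Submodule A M) [Module.Projective A (M ⧸ V)] (p : PrimeSpectrum A) :
    Module.rankAtStalk (R := A) M p =
      Module.rankAtStalk (R := A) V p + Module.rankAtStalk (R := A) (M ⧸ V) p := by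
  have h := rankAtStalk_eq_add V.mkQ V.mkQ_surjective p
  rwa [Submodule.ker_mkQ] at h

theorem rankAtStalk_add_rankAtStalk [Module.Projective A M] [Module.Finite A M]
    (V F : Submodule A M) [Module.Projective A (M ⧸ V)] [Module.Projective A (M ⧸ F)]
    [Module.Projective A (M ⧸ (V ⊔ F))] (p : PrimeSpectrum A) :
    Module.rankAtStalk (R := A) V p + Module.rankAtStalk (R := A) F p =
      Module.rankAtStalk (R := A) (V ⊓ F : Submodule A M) p +
        Module.rankAtStalk (R := A) (V ⊔ F : Submodule A M) p := by
  have := projective_of_projective_quotient V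
  have := projective_of_projective_quotient F
  have := projective_of_projective_quotient (V ⊔ F)
  have := finite_of_projective_quotient V
  have := finite_of_projective_quotient F
  let g : V × F →ₗ[A] (V ⊔ F : Submodule A M) :=
    LinearMap.coprod (Submodule.inclusion le_sup_left) (Submodule.inclusion le_sup_right)
  have hg : Function.Surjective g := by
    rintro ⟨x, hx⟩
    obtain ⟨v, hv, f, hf, rfl⟩ := Submodule.mem_sup.1 hx
    exact ⟨(⟨v, hv⟩, ⟨f, hf⟩), rfl⟩
  have hval : ∀ (v : V) (f : F), (g (v, f) : M) = v + f := fun v f => rfl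
  let e : LinearMap.ker g ≃ₗ[A] (V ⊓ F : Submodule A M) :=
    { toFun := fun x => ⟨x.1.1, x.1.1.2, by
        have h := congrArg Subtype.val (LinearMap.mem_ker.1 x.2)
        rw [← Prod.mk.eta (p := x.1), hval] at h
        rw [eq_neg_of_add_eq_zero_left h]
        exact F.neg_mem x.1.2.2⟩
      map_add' := fun x y => rfl
      map_smul' := fun a x => rfl
      invFun := fun y => ⟨(⟨y.1, y.2.1⟩, ⟨-y.1, F.neg_mem y.2.2⟩), by
        rw [LinearMap.mem_ker]; apply Subtype.ext; rw [hval]; simp⟩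
      left_inv := fun x => by
        have h := congrArg Subtype.val (LinearMap.mem_ker.1 x.2)
        rw [← Prod.mk.eta (p := x.1), hval] at h
        apply Subtype.ext
        apply Prod.ext
        · rfl
        · apply Subtype.ext
          exact (eq_neg_of_add_eq_zero_right h).symm
      right_inv := fun y => rfl }
  have h := rankAtStalk_eq_add g hg p
  rw [Module.rankAtStalk_prod, Module.rankAtStalk_eq_of_equiv e] at h
  exact h

theorem eq_of_le_of_rankAtStalk_eq [Module.Projective A M] [Module.Finite A M]
    {S T : Submodule A M} (hST : S ≤ T) [Module.Projective A (M ⧸ S)] [Module.Projective A (M ⧸ T)]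
    (h : ∀ p, Module.rankAtStalk (R := A) S p = Module.rankAtStalk (R := A) T p) : S = T := by
  have hb : Function.Bijective (Submodule.factor hST) :=
    Module.bijective_of_surjective_of_rankAtStalk_eq (Submodule.factor_surjective hST) fun m _ => by
      have h1 := rankAtStalk_eq_quotient_add S ⟨m, inferInstance⟩
      have h2 := rankAtStalk_eq_quotient_add T ⟨m, inferInstance⟩
      have h3 := h ⟨m, inferInstance⟩
      omega
  refine le_antisymm hST fun x hx => ?_
  rw [← Submodule.Quotient.mk_eq_zero] at hx ⊢
  apply hb.1
  rw [map_zero]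
  exact hx

/-- If the rank of `V ∩ F` grows together with that of `F`, then `V + F` does not grow. -/
theorem sup_eq_sup_of_rankAtStalk [Module.Projective A M] [Module.Finite A M]
    (V F F' : Submodule A M) (hF : F ≤ F') [Module.Projective A (M ⧸ V)]
    [Module.Projective A (M ⧸ F)] [Module.Projective A (M ⧸ F')]
    [Module.Projective A (M ⧸ (V ⊔ F))] [Module.Projective A (M ⧸ (V ⊔ F'))]
    (h : ∀ p, Module.rankAtStalk (R := A) F' p +
        Module.rankAtStalk (R := A) (V ⊓ F : Submodule A M) p =
      Module.rankAtStalk (R := A) F p +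
        Module.rankAtStalk (R := A) (V ⊓ F' : Submodule A M) p) : V ⊔ F = V ⊔ F' := by
  refine eq_of_le_of_rankAtStalk_eq (sup_le_sup_left hF _) fun p => ?_
  have h1 := rankAtStalk_add_rankAtStalk V F p
  have h2 := rankAtStalk_add_rankAtStalk V F' p
  have h3 := h p
  omega

/-- A module `E` of rank `r` that contains `r` elements on which a linear map to `A ^ r` is
surjective is spanned by these elements. -/
theorem eq_span_of_rankAtStalk_eq (E : Submodule A M) [Module.Finite A E] [Module.Projective A E]
    {r : ℕ} (hr : ∀ p, Module.rankAtStalk (R := A) E p = r) (u : Fin r → M) (hu : ∀ i, u i ∈ E)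
    (φ : M →ₗ[A] (Fin r → A)) (hφ : Submodule.map φ (Submodule.span A (Set.range u)) = ⊤) :
    E = Submodule.span A (Set.range u) := by
  have hle : Submodule.span A (Set.range u) ≤ E :=
    Submodule.span_le.2 (by rintro _ ⟨i, rfl⟩; exact hu i)
  have hs : Function.Surjective (φ ∘ₗ E.subtype) := by
    intro a
    have ha : a ∈ Submodule.map φ (Submodule.span A (Set.range u)) := hφ ▸ Submodule.mem_top
    obtain ⟨x, hx, rfl⟩ := ha
    exact ⟨⟨x, hle hx⟩, rfl⟩
  have hb : Function.Bijective (φ ∘ₗ E.subtype) :=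
    Module.bijective_of_surjective_of_rankAtStalk_eq hs fun m hm => by
      have : Nontrivial A := ⟨⟨0, 1, fun h => hm.ne_top (Ideal.eq_top_of_isUnit_mem _ m.zero_mem
        (by rw [h]; exact isUnit_one))⟩⟩
      rw [hr, Module.rankAtStalk_eq_finrank_of_free]
      simp
  refine le_antisymm (fun x hx => ?_) hle
  have hx' : φ x ∈ Submodule.map φ (Submodule.span A (Set.range u)) := hφ ▸ Submodule.mem_top
  obtain ⟨y, hy, hxy⟩ := hx'
  have : (⟨y, hle hy⟩ : E) = ⟨x, hx⟩ := hb.1 hxy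
  have hyx : y = x := congrArg Subtype.val this
  exact hyx ▸ hy

end Ranks

/-! ### Submodules spanned by parts of a basis -/

section Spans

variable {A : Type} [CommRing A] {M : Type} [AddCommGroup M] [Module A M]

theorem span_image_inf_span_image {ι : Type} {b : ι → M} {T S S' : Set ι}
    (h : LinearIndepOn A b T) (hS : S ⊆ T) (hS' : S' ⊆ T) :
    Submodule.span A (b '' S) ⊓ Submodule.span A (b '' S') = Submodule.span A (b '' (S ∩ S')) := by
  refine le_antisymm ?_ (le_inf (Submodule.span_mono (Set.image_mono Set.inter_subset_left))
    (Submodule.span_mono (Set.image_mono Set.inter_subset_right)))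
  rintro x ⟨hx, hx'⟩
  obtain ⟨l, hl, rfl⟩ := (Finsupp.mem_span_image_iff_linearCombination A).1 hx
  obtain ⟨l', hl', hll⟩ := (Finsupp.mem_span_image_iff_linearCombination A).1 hx'
  have h0 : l' - l = 0 := by
    refine linearIndepOn_iff.1 h _ (Submodule.sub_mem _ ?_ ?_) ?_
    · exact Finsupp.supported_mono hS' hl'
    · exact Finsupp.supported_mono hS hl
    · rw [map_sub, hll, sub_self]
  rw [sub_eq_zero] at h0
  subst h0
  refine (Finsupp.mem_span_image_iff_linearCombination A).2 ⟨l', ?_, rfl⟩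
  rw [Finsupp.supported_inter]
  exact ⟨hl, hl'⟩

theorem free_span_image {ι : Type} {b : ι → M} {S : Set ι} (h : LinearIndepOn A b S) :
    Module.Free A (Submodule.span A (b '' S)) := by
  rw [Set.image_eq_range]
  exact Module.Free.of_basis (Module.Basis.span h)

theorem rankAtStalk_span_image {ι : Type} {b : ι → M} {S : Set ι} (hS : S.Finite)
    (h : LinearIndepOn A b S) (p : PrimeSpectrum A) :
    Module.rankAtStalk (R := A) (Submodule.span A (b '' S)) p = S.ncard := by
  have : Nontrivial A := p.nontrivial
  have := free_span_image h
  have : Module.Finite A (Submodule.span A (b '' S)) :=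
    Module.Finite.span_of_finite A (hS.image b)
  rw [Module.rankAtStalk_eq_finrank_of_free]
  have := hS.fintype
  rw [Set.image_eq_range]
  have h2 := finrank_span_eq_card h
  rw [Pi.natCast_apply, Nat.cast_id, h2, Set.ncard_eq_toFinset_card', Set.toFinset_card]

theorem projective_quotient_span_image {ι : Type} {b : ι → M} {S T : Set ι} (hST : S ⊆ T)
    (h : LinearIndepOn A b T) :
    Module.Projective A (Submodule.span A (b '' T) ⧸
      (Submodule.span A (b '' S)).submoduleOf (Submodule.span A (b '' T))) := by
  set Q := Submodule.span A (b '' T)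
  have hle : Submodule.span A (b '' (T \ S)) ≤ Q :=
    Submodule.span_mono (Set.image_mono Set.sdiff_subset)
  have hle' : Submodule.span A (b '' S) ≤ Q := Submodule.span_mono (Set.image_mono hST)
  have hc : IsCompl ((Submodule.span A (b '' S)).submoduleOf Q)
      ((Submodule.span A (b '' (T \ S))).submoduleOf Q) := by
    constructor
    · rw [disjoint_iff, Submodule.submoduleOf, Submodule.submoduleOf, ← Submodule.comap_inf,
        span_image_inf_span_image h hST Set.sdiff_subset, Set.inter_sdiff_self]
      simp
    · rw [codisjoint_iff, ← Submodule.submoduleOf_sup_of_le hle' hle, ← Submodule.span_union,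
        ← Set.image_union, Set.union_sdiff_cancel hST]
      exact Submodule.submoduleOf_self _
  have := free_span_image (h.mono (Set.sdiff_subset : T \ S ⊆ T))
  exact Module.Projective.of_equiv
    ((Submodule.quotientEquivOfIsCompl _ _ hc).trans (Submodule.submoduleOfEquivOfLe hle)).symm

end Spans

/-! ### Triangular systems -/

section Triangular

variable {A : Type} [CommRing A] {M : Type} [AddCommGroup M] [Module A M]

/-- The `u`-th step of the flag on `Q` given by coordinates `χ 0, …, χ (D - 1)`: the elements
all of whose coordinates from the `u`-th on vanish. -/
def coordFlag (Q : Submodule A M) (D : ℕ) (χ : ℕ → M →ₗ[A] A) (u : ℕ) : Submodule A M :=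
  Q ⊓ ⨅ k : {k // u ≤ k ∧ k < D}, LinearMap.ker (χ k)

theorem mem_coordFlag {Q : Submodule A M} {D : ℕ} {χ : ℕ → M →ₗ[A] A} {u : ℕ} {x : M} :
    x ∈ coordFlag Q D χ u ↔ x ∈ Q ∧ ∀ k, u ≤ k → k < D → χ k x = 0 := by
  simp [coordFlag, Submodule.mem_iInf]

/-- The elements `b 0, …, b (D - 1)` of `Q` are triangular with respect to the coordinates
`χ 0, …, χ (D - 1)`, which are jointly injective on `Q`: the `k`-th coordinate of `b k` is a unit and
the later ones vanish. Then the `b k` form a basis of `Q`. -/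
structure IsTriangular (Q : Submodule A M) (D : ℕ) (χ : ℕ → M →ₗ[A] A) (b : ℕ → M) : Prop where
  injective : ∀ x ∈ Q, (∀ k < D, χ k x = 0) → x = 0
  mem : ∀ k < D, b k ∈ Q
  isUnit : ∀ k < D, IsUnit (χ k (b k))
  eq_zero : ∀ k < D, ∀ j < D, k < j → χ j (b k) = 0

theorem IsTriangular.coordFlag_eq {Q : Submodule A M} {D : ℕ} {χ : ℕ → M →ₗ[A] A} {b : ℕ → M}
    (h : IsTriangular Q D χ b) {u : ℕ} (hu : u ≤ D) :
    coordFlag Q D χ u = Submodule.span A (b '' Set.Iio u) := by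
  induction u with
  | zero =>
    rw [eq_bot_iff.2 (show coordFlag Q D χ 0 ≤ ⊥ from fun x hx => ?_)]
    · rw [show Set.Iio (0 : ℕ) = ∅ by ext; simp]; simp
    · exact h.injective x (mem_coordFlag.1 hx).1 fun k hk => (mem_coordFlag.1 hx).2 k k.zero_le hk
  | succ u ih =>
    apply le_antisymm
    · intro x hx
      obtain ⟨hxQ, hx⟩ := mem_coordFlag.1 hx
      obtain ⟨c, hc⟩ := h.isUnit u (by omega)
      have hy : x - (χ u x * ↑c⁻¹) • b u ∈ coordFlag Q D χ u := by
        refine mem_coordFlag.2 ⟨Q.sub_mem hxQ (Q.smul_mem _ (h.mem u (by omega))), ?_⟩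
        intro k hk hkD
        rcases hk.eq_or_lt with rfl | hlt
        · rw [map_sub, map_smul, ← hc]; simp
        · rw [map_sub, map_smul, hx k hlt hkD, h.eq_zero u (by omega) k hkD hlt]; simp
      rw [ih (by omega)] at hy
      rw [← sub_add_cancel x ((χ u x * ↑c⁻¹) • b u)]
      refine Submodule.add_mem _ (Submodule.span_mono (Set.image_mono ?_) hy)
        (Submodule.smul_mem _ _ (Submodule.subset_span ⟨u, ?_, rfl⟩))
      · intro k hk; simp only [Set.mem_Iio] at *; omega
      · simp
    · refine Submodule.span_le.2 ?_
      rintro _ ⟨k, hk, rfl⟩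
      simp only [Set.mem_Iio] at hk
      exact mem_coordFlag.2 ⟨h.mem k (by omega), fun j hj hjD =>
        h.eq_zero k (by omega) j hjD (by omega)⟩

theorem coordFlag_top (Q : Submodule A M) (D : ℕ) (χ : ℕ → M →ₗ[A] A) :
    coordFlag Q D χ D = Q := by
  ext x
  rw [mem_coordFlag]
  exact ⟨fun h => h.1, fun h => ⟨h, fun k h1 h2 => by omega⟩⟩

theorem IsTriangular.linearIndepOn {Q : Submodule A M} {D : ℕ} {χ : ℕ → M →ₗ[A] A} {b : ℕ → M}
    (h : IsTriangular Q D χ b) : LinearIndepOn A b (Set.Iio D) := by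
  rw [linearIndepOn_iff]
  intro l hl h0
  by_contra hne
  have hs : l.support.Nonempty := Finsupp.support_nonempty_iff.2 hne
  set k := l.support.max' hs
  have hk : l k ≠ 0 := Finsupp.mem_support_iff.1 (Finset.max'_mem _ hs)
  have hsub : ∀ j ∈ l.support, j < D := fun j hj => (Finsupp.mem_supported _ _).1 hl hj
  have hkD : k < D := hsub k (Finset.max'_mem _ hs)
  have h1 := congrArg (χ k) h0
  rw [Finsupp.linearCombination_apply, Finsupp.sum, map_sum, map_zero,
    Finset.sum_eq_single_of_mem k (Finset.max'_mem _ hs)] at h1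
  · rw [map_smul, smul_eq_mul] at h1
    exact hk ((h.isUnit k hkD).mul_left_eq_zero.1 h1)
  · intro j hj hjk
    rw [map_smul, h.eq_zero j (hsub j hj) k hkD (lt_of_le_of_ne (Finset.le_max' _ j hj) hjk),
      smul_zero]

end Triangular

/-! ### Subbundles of the polynomials of bounded degree -/

section DegreeLT

variable {A : Type} [CommRing A]

theorem taylor_mem_degreeLT {r : A} {m : ℕ} {f : A[X]} (hf : f ∈ degreeLT A m) :
    taylor r f ∈ degreeLT A m := by
  rw [mem_degreeLT] at hf ⊢
  rwa [degree_taylor]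

theorem IsSubbundle.finite_and_projective {m k : ℕ} {V : Submodule A A[X]}
    (h : IsSubbundle m k V) : Module.Finite A V ∧ Module.Projective A V := by
  have := h.2.1
  have e := Submodule.submoduleOfEquivOfLe h.1
  have : Module.Finite A (degreeLT A m) := Module.Finite.equiv (degreeLTEquiv A m).symm
  have : Module.Projective A (degreeLT A m) := Module.Projective.of_equiv (degreeLTEquiv A m).symm
  have := finite_of_projective_quotient (V.submoduleOf (degreeLT A m))
  have := projective_of_projective_quotient (V.submoduleOf (degreeLT A m))
  exact ⟨Module.Finite.equiv e, Module.Projective.of_equiv e⟩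

end DegreeLT

/-! ### Ramification sequences -/

namespace RamificationSequence

variable {N d : ℕ} (r : RamificationSequence N d)

theorem entry_succ (j : ℕ) (hj : j < N + 1) : r.entry (j + 1) = r.a ⟨j, hj⟩ := by
  simp [entry, hj]

theorem entry_le (j : ℕ) : r.entry j ≤ d - N := by
  unfold entry
  split_ifs
  · exact le_rfl
  · exact r.le _
  · exact Nat.zero_le _

theorem entry_antitone : Antitone r.entry := by
  intro i j hij
  rcases Nat.eq_zero_or_pos i with rfl | hi
  · rw [show r.entry 0 = d - N by simp [entry]]
    exact r.entry_le j
  · obtain ⟨i, rfl⟩ := Nat.exists_eq_succ_of_ne_zero hi.ne'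
    obtain ⟨j, rfl⟩ := Nat.exists_eq_succ_of_ne_zero (show j ≠ 0 by omega)
    by_cases hj : j < N + 1
    · rw [Nat.succ_eq_add_one, Nat.succ_eq_add_one, r.entry_succ i (by omega), r.entry_succ j hj]
      exact r.antitone (by simpa using hij)
    · rw [show r.entry (Nat.succ j) = 0 by simp [entry, hj]]
      exact Nat.zero_le _

theorem tail_eq (i : ℕ) (hi : i ≤ N + 1) :
    r.tail i = ∑ k ∈ Finset.range i, r.entry (N + 1 - k) := by
  rw [tail]
  refine Finset.sum_bij (fun ℓ _ => i - ℓ) ?_ ?_ ?_ ?_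
  · intro ℓ hℓ; rw [Finset.mem_Icc] at hℓ; rw [Finset.mem_range]; omega
  · intro a ha b hb h; rw [Finset.mem_Icc] at ha hb; omega
  · intro k hk; rw [Finset.mem_range] at hk
    exact ⟨i - k, by rw [Finset.mem_Icc]; omega, by omega⟩
  · intro ℓ hℓ
    rw [Finset.mem_Icc] at hℓ
    congr 1
    omega

theorem tail_last : r.tail (N + 1) = r.size := by
  rw [tail_eq _ _ le_rfl, size, ← Finset.sum_range_reflect, Finset.sum_range]
  refine Finset.sum_congr rfl fun j _ => ?_
  rw [show N + 1 - (N + 1 - 1 - (j : ℕ)) = j + 1 by omega, r.entry_succ j j.2]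

end RamificationSequence

namespace BasicSituation

variable (S : BasicSituation)

/-! ### Expansions at the marked points -/

section Expansions

variable {A : Type} [CommRing A] [Algebra ℂ A]

/-- The marked point as the centre of the expansion; at infinity polynomials are expanded in powers
of `x`. -/
noncomputable def pt (A : Type) [CommRing A] [Algebra ℂ A] : Option (Fin S.n) → A
  | none => 0
  | some s => algebraMap ℂ A (S.z s)

/-- Leading terms are those of highest degree at infinity, and of lowest degree at the other marked
points. -/
def dir : Option (Fin S.n) → Bool
  | none => true
  | some _ => false

/-- The exponent that labels the `k`-th coordinate adapted to the flag at the point. -/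
def expAt : Option (Fin S.n) → ℕ → ℕ
  | none, k => k
  | some _, k => S.d - k

/-- The `k`-th coordinate adapted to the flag at the point: `F_u` is given by the vanishing of the
coordinates from the `u`-th on. -/
noncomputable def chi (p : Option (Fin S.n)) (k : ℕ) : A[X] →ₗ[A] A :=
  lcoeff A (S.expAt p k) ∘ₗ taylor (S.pt A p)

theorem chi_apply (p : Option (Fin S.n)) (k : ℕ) (f : A[X]) :
    S.chi p k f = (taylor (S.pt A p) f).coeff (S.expAt p k) := rfl

/-- The position in the flag at `p` of the leading term of the `k`-th element of an adapted
basis. -/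
def pos (p : Option (Fin S.n)) (k : ℕ) : ℕ := S.d - k - (S.ram p).entry (S.N + 1 - k)

/-- The leading exponent of the `k`-th element of an adapted basis at `p`. -/
def expo (p : Option (Fin S.n)) (k : ℕ) : ℕ := S.expAt p (S.pos p k)

theorem pos_add (p : Option (Fin S.n)) {k : ℕ} (hk : k ≤ S.N) :
    S.pos p k + k + (S.ram p).entry (S.N + 1 - k) = S.d := by
  have h1 := (S.ram p).entry_le (S.N + 1 - k)
  have h2 := S.hN
  unfold pos
  omega

theorem pos_lt_pos (p : Option (Fin S.n)) {k j : ℕ} (hk : k ≤ S.N) (hj : j ≤ S.N) (h : j < k) :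
    S.pos p k < S.pos p j := by
  have h1 := S.pos_add p hk
  have h2 := S.pos_add p hj
  have h3 := (S.ram p).entry_antitone (show S.N + 1 - k ≤ S.N + 1 - j by omega)
  omega

theorem pos_injOn (p : Option (Fin S.n)) : Set.InjOn (S.pos p) (Set.Iic S.N) := by
  intro k hk j hj h
  rcases lt_trichotomy j k with h' | h' | h'
  · have := S.pos_lt_pos p hk hj h'; omega
  · exact h'.symm
  · have := S.pos_lt_pos p hj hk h'; omega

theorem span_image_Iic_eq {B : Type} [CommRing B] {p : Option (Fin S.n)} {u b : ℕ → B[X]}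
    (hb : ∀ k ≤ S.N, b (S.pos p k) = u k) {j : ℕ} (hj : j ≤ S.N) :
    Submodule.span B (u '' Set.Iic j) = Submodule.span B (b '' (S.pos p '' Set.Iic j)) := by
  congr 1
  rw [← Set.image_comp]
  refine Set.image_congr fun k hk => ?_
  simp only [Set.mem_Iic] at hk
  exact (hb k (by omega)).symm

theorem expo_none {k : ℕ} (hk : k ≤ S.N) :
    S.expo none k + k + (S.ram none).entry (S.N + 1 - k) = S.d := S.pos_add none hk

theorem expo_some (s : Fin S.n) {k : ℕ} (hk : k ≤ S.N) :
    S.expo (some s) k = k + (S.ram (some s)).entry (S.N + 1 - k) := by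
  have := S.pos_add (some s) hk
  simp only [expo, expAt]
  omega

theorem flag_eq_coordFlag (p : Option (Fin S.n)) {u : ℕ} (hu : u ≤ S.d + 1) :
    (S.flag p u : Submodule A A[X]) =
      coordFlag (degreeLT A (S.d + 1)) (S.d + 1) (S.chi p) u := by
  ext f
  rw [mem_coordFlag]
  cases p with
  | none =>
    simp only [flag, chi_apply, pt, expAt, taylor_zero, mem_degreeLT, degree_lt_iff_coeff_zero]
    constructor
    · exact fun h => ⟨fun m hm => h m (by omega), fun k hk _ => h k hk⟩
    · intro h m hm
      by_cases hmd : m < S.d + 1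
      · exact h.2 m hm hmd
      · exact h.1 m (by omega)
  | some s =>
    simp only [flag, chi_apply, pt, expAt, Submodule.mem_inf, Submodule.restrictScalars_mem,
      Ideal.mem_span_singleton]
    refine and_congr_right fun hf => ?_
    rw [← map_dvd_iff (taylorEquiv (algebraMap ℂ A (S.z s)))]
    simp only [map_pow, map_sub]
    have hX : (taylorEquiv (algebraMap ℂ A (S.z s))) X -
        (taylorEquiv (algebraMap ℂ A (S.z s))) (C (algebraMap ℂ A (S.z s))) = X := by
      change taylor _ X - taylor _ (C _) = X
      simp
    rw [hX, X_pow_dvd_iff]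
    change (∀ e < S.d + 1 - u, (taylor _ f).coeff e = 0) ↔ _
    constructor
    · exact fun h k hk hkd => h _ (by omega)
    · intro h e he
      have := h (S.d - e) (by omega) (by omega)
      rwa [show S.d - (S.d - e) = e by omega] at this

/-- The basis of powers of the local parameter is triangular for the flag at the point. -/
theorem isTriangular_pow (p : Option (Fin S.n)) :
    IsTriangular (degreeLT A (S.d + 1)) (S.d + 1) (S.chi p)
      fun k => (X - C (S.pt A p)) ^ S.expAt p k := by
  have htaylor : ∀ e, taylor (S.pt A p) ((X - C (S.pt A p)) ^ e) = X ^ e := by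
    intro e
    rw [taylor_pow, map_sub, taylor_X, taylor_C]
    simp
  have hle : ∀ k < S.d + 1, S.expAt p k ≤ S.d := by
    intro k hk
    cases p <;> simp only [expAt] <;> omega
  constructor
  · intro f hf h
    rw [← taylor_eq_zero (S.pt A p)]
    ext e
    rw [coeff_zero]
    by_cases he : e < S.d + 1
    · cases p with
      | none => exact h e he
      | some s =>
        have := h (S.d - e) (by omega)
        rwa [chi_apply, expAt, show S.d - (S.d - e) = e by omega] at this
    · have := (taylor_mem_degreeLT (r := S.pt A p) hf)
      rw [mem_degreeLT, degree_lt_iff_coeff_zero] at this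
      exact this e (by omega)
  · intro k hk
    rw [mem_degreeLT]
    refine lt_of_le_of_lt (degree_pow_le _ _) ?_
    have h1 : (X - C (S.pt A p)).degree ≤ 1 := degree_X_sub_C_le _
    calc S.expAt p k • (X - C (S.pt A p)).degree ≤ S.expAt p k • (1 : WithBot ℕ) :=
          nsmul_le_nsmul_right h1 _
      _ = ((S.expAt p k : ℕ) : WithBot ℕ) := by simp
      _ < ((S.d + 1 : ℕ) : WithBot ℕ) := by
          have := hle k hk
          exact_mod_cast (by omega : S.expAt p k < S.d + 1)
  · intro k hk
    rw [chi_apply, htaylor]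
    simp
  · intro k hk j hj hkj
    rw [chi_apply, htaylor, coeff_X_pow, if_neg]
    cases p <;> simp only [expAt] <;> omega

/-- `u_0, …, u_N` are polynomials of degree at most `d` whose leading exponents at the marked point
`p` are those that the ramification sequence at `p` prescribes, with units as leading
coefficients. -/
structure IsAdapted (p : Option (Fin S.n)) (u : ℕ → A[X]) : Prop where
  mem : ∀ k ≤ S.N, u k ∈ degreeLT A (S.d + 1)
  lead : ∀ k ≤ S.N, ∃ c, IsUnit c ∧ HasLead (S.dir p) (S.expo p k) c (taylor (S.pt A p) (u k))

/-- `E_j` is spanned by `u_0, …, u_j`. -/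
def SpansFlag (u : ℕ → A[X]) (E : Fin (S.N + 1) → Submodule A A[X]) : Prop :=
  ∀ j, E j = Submodule.span A (u '' Set.Iic (j : ℕ))

variable {S} in
theorem IsAdapted.isUnit_chi {p : Option (Fin S.n)} {u : ℕ → A[X]} (h : S.IsAdapted p u) {k : ℕ}
    (hk : k ≤ S.N) : IsUnit (S.chi p (S.pos p k) (u k)) := by
  obtain ⟨c, hc, hl⟩ := h.lead k hk
  rw [chi_apply, ← expo, hl.coeff_eq]
  exact hc

variable {S} in
theorem IsAdapted.chi_eq_zero {p : Option (Fin S.n)} {u : ℕ → A[X]} (h : S.IsAdapted p u) {k : ℕ}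
    (hk : k ≤ S.N) {j : ℕ} (hj : j < S.d + 1) (hkj : S.pos p k < j) : S.chi p j (u k) = 0 := by
  obtain ⟨c, hc, hl⟩ := h.lead k hk
  rw [chi_apply]
  apply hl.coeff_beyond
  cases p <;> simp only [Beyond, dir, expo, expAt, if_true, Bool.false_eq_true, if_false] <;> omega

/-- Adaptedness in terms of the coordinates at `p`. -/
theorem isAdapted_of_chi {p : Option (Fin S.n)} {u : ℕ → A[X]}
    (hmem : ∀ k ≤ S.N, u k ∈ degreeLT A (S.d + 1))
    (hunit : ∀ k ≤ S.N, IsUnit (S.chi p (S.pos p k) (u k)))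
    (hzero : ∀ k ≤ S.N, ∀ j < S.d + 1, S.pos p k < j → S.chi p j (u k) = 0) :
    S.IsAdapted p u := by
  refine ⟨hmem, fun k hk => ⟨_, hunit k hk, rfl, fun e he => ?_⟩⟩
  have h1 := S.pos_add p hk
  by_cases hed : e < S.d + 1
  · cases p with
    | none =>
      simp only [Beyond, dir, expo, expAt, if_true] at he
      exact hzero k hk e hed he
    | some s =>
      simp only [Beyond, dir, expo, expAt, Bool.false_eq_true, if_false] at he
      have := hzero k hk (S.d - e) (by omega) (by omega)
      rwa [chi_apply, expAt, show S.d - (S.d - e) = e by omega] at this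
  · have := taylor_mem_degreeLT (r := S.pt A p) (hmem k hk)
    rw [mem_degreeLT, degree_lt_iff_coeff_zero] at this
    exact this e (by omega)

end Expansions

/-! ### Flags in general position and adapted bases -/

section Adapted

variable {A : Type} [CommRing A] [Algebra ℂ A]

variable {S} in
/-- An adapted basis at `p`, completed to a basis of the space of polynomials of degree at most `d`
by powers of the local parameter. -/
theorem IsAdapted.exists_isTriangular {p : Option (Fin S.n)} {u : ℕ → A[X]}
    (h : S.IsAdapted p u) :
    ∃ b : ℕ → A[X], IsTriangular (degreeLT A (S.d + 1)) (S.d + 1) (S.chi p) b ∧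
      ∀ k ≤ S.N, b (S.pos p k) = u k := by
  classical
  have h0 := S.isTriangular_pow (A := A) p
  let b : ℕ → A[X] := fun j => if hj : ∃ k, k ≤ S.N ∧ S.pos p k = j then u hj.choose else
    (X - C (S.pt A p)) ^ S.expAt p j
  have hb1 : ∀ k ≤ S.N, b (S.pos p k) = u k := by
    intro k hk
    have hex : ∃ k', k' ≤ S.N ∧ S.pos p k' = S.pos p k := ⟨k, hk, rfl⟩
    have := S.pos_injOn p hex.choose_spec.1 hk hex.choose_spec.2
    simp only [b, dif_pos hex]
    rw [this]
  have hb2 : ∀ j, (∃ k ≤ S.N, S.pos p k = j) ∨ b j = (X - C (S.pt A p)) ^ S.expAt p j := by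
    intro j
    by_cases hj : ∃ k, k ≤ S.N ∧ S.pos p k = j
    · exact Or.inl hj
    · exact Or.inr (dif_neg hj)
  refine ⟨b, ⟨h0.injective, ?_, ?_, ?_⟩, hb1⟩
  · intro j hj
    rcases hb2 j with ⟨k, hk, rfl⟩ | hj'
    · rw [hb1 k hk]; exact h.mem k hk
    · rw [hj']; exact h0.mem j hj
  · intro j hj
    rcases hb2 j with ⟨k, hk, rfl⟩ | hj'
    · rw [hb1 k hk]; exact h.isUnit_chi hk
    · rw [hj']; exact h0.isUnit j hj
  · intro j hj i hi hji
    rcases hb2 j with ⟨k, hk, rfl⟩ | hj'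
    · rw [hb1 k hk]; exact h.chi_eq_zero hk hi hji
    · rw [hj']; exact h0.eq_zero j hj i hi hji

theorem pos_image_subset (p : Option (Fin S.n)) {j : ℕ} (hj : j ≤ S.N) :
    S.pos p '' Set.Iic j ⊆ Set.Iio (S.d + 1) := by
  rintro _ ⟨k, hk, rfl⟩
  simp only [Set.mem_Iic, Set.mem_Iio] at *
  have := S.pos_add p (show k ≤ S.N by omega)
  omega

variable {S} in
theorem IsAdapted.isSubbundle {p : Option (Fin S.n)} {u : ℕ → A[X]}
    (h : S.IsAdapted p u) {j : ℕ} (hj : j ≤ S.N) :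
    IsSubbundle (S.d + 1) (j + 1) (Submodule.span A (u '' Set.Iic j)) := by
  obtain ⟨b, hb, hbu⟩ := h.exists_isTriangular
  have hQ := hb.coordFlag_eq le_rfl
  rw [coordFlag_top] at hQ
  have hsub := S.pos_image_subset p hj
  refine ⟨?_, ?_, fun q => ?_⟩
  · refine Submodule.span_le.2 ?_
    rintro _ ⟨k, hk, rfl⟩
    simp only [Set.mem_Iic] at hk
    exact h.mem k (by omega)
  · rw [S.span_image_Iic_eq hbu hj, hQ]
    exact projective_quotient_span_image hsub hb.linearIndepOn
  · rw [S.span_image_Iic_eq hbu hj, rankAtStalk_span_image ((Set.finite_Iic j).image _)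
      (hb.linearIndepOn.mono hsub), Set.InjOn.ncard_image
      ((S.pos_injOn p).mono (Set.Iic_subset_Iic.2 hj)), Set.ncard_eq_toFinset_card']
    simp

variable {S} in
theorem IsAdapted.inSchubertCell {p : Option (Fin S.n)} {u : ℕ → A[X]}
    (h : S.IsAdapted p u) : S.InSchubertCell p (Submodule.span A (u '' Set.Iic S.N)) := by
  intro ℓ v hℓ hv1 hv2
  obtain ⟨b, hb, hbu⟩ := h.exists_isTriangular
  have hQ := hb.coordFlag_eq le_rfl
  rw [coordFlag_top] at hQ
  have hsub := S.pos_image_subset p le_rfl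
  have hN := S.hN
  have hle := (S.ram p).entry_le ℓ
  have hvD : v ≤ S.d + 1 := by omega
  have hsub' : Set.Iio v ⊆ Set.Iio (S.d + 1) := Set.Iio_subset_Iio hvD
  rw [S.span_image_Iic_eq hbu le_rfl, S.flag_eq_coordFlag p hvD, hb.coordFlag_eq hvD]
  constructor
  · rw [← Submodule.span_union, ← Set.image_union, hQ]
    exact projective_quotient_span_image (Set.union_subset hsub hsub') hb.linearIndepOn
  · intro q
    rw [span_image_inf_span_image hb.linearIndepOn hsub hsub', rankAtStalk_span_image
      (((Set.finite_Iic _).image _).subset Set.inter_subset_left)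
      (hb.linearIndepOn.mono (Set.inter_subset_left.trans hsub))]
    -- the positions below `v` are those of the last `ℓ` elements of the adapted basis
    have hset : S.pos p '' Set.Iic S.N ∩ Set.Iio v = S.pos p '' Set.Icc (S.N + 1 - ℓ) S.N := by
      ext e
      constructor
      · rintro ⟨⟨k, hk, rfl⟩, hkv⟩
        simp only [Set.mem_Iic, Set.mem_Iio] at hk hkv
        refine ⟨k, ⟨?_, hk⟩, rfl⟩
        by_contra hcon
        have h1 := S.pos_add p hk
        have h2 := (S.ram p).entry_antitone (show ℓ + 1 ≤ S.N + 1 - k by omega)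
        omega
      · rintro ⟨k, ⟨hk1, hk2⟩, rfl⟩
        refine ⟨⟨k, hk2, rfl⟩, ?_⟩
        simp only [Set.mem_Iio]
        have h1 := S.pos_add p hk2
        have h2 := (S.ram p).entry_antitone (show S.N + 1 - k ≤ ℓ by omega)
        omega
    rw [hset, Set.InjOn.ncard_image ((S.pos_injOn p).mono fun k hk => hk.2),
      Set.ncard_eq_toFinset_card']
    simp
    omega

/-- A flag with an adapted basis at each marked point is a point of the open subscheme `U`. -/
theorem isUPoint_of_isAdapted {E : Fin (S.N + 1) → Submodule A A[X]}
    (h : ∀ p, ∃ u, S.IsAdapted p u ∧ S.SpansFlag u E) : S.IsUPoint E := by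
  refine ⟨⟨?_, ?_, ?_, ?_⟩, ?_⟩
  · obtain ⟨u, hu, hE⟩ := h none
    intro i j hij
    rw [hE, hE]
    exact Submodule.span_mono (Set.image_mono (Set.Iic_subset_Iic.2 hij))
  · intro j
    obtain ⟨u, hu, hE⟩ := h none
    rw [hE]
    exact hu.isSubbundle (by omega)
  · obtain ⟨u, hu, hE⟩ := h none
    rw [hE]
    exact hu.isSubbundle (by simp)
  · intro p
    obtain ⟨u, hu, hE⟩ := h p
    rw [hE]
    exact hu.inSchubertCell
  · intro p j
    obtain ⟨u, hu, hE⟩ := h p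
    rw [distinguished, hE, hE, Fin.val_last]
    have hj : (j : ℕ) ≤ S.N := by omega
    have hN := S.hN
    apply le_antisymm
    · exact sup_le (Submodule.span_mono (Set.image_mono (Set.Iic_subset_Iic.2 hj))) inf_le_left
    · refine Submodule.span_le.2 ?_
      rintro _ ⟨k, hk, rfl⟩
      simp only [Set.mem_Iic] at hk
      by_cases hkj : k ≤ j
      · exact Submodule.mem_sup_left (Submodule.subset_span ⟨k, hkj, rfl⟩)
      · refine Submodule.mem_sup_right ⟨Submodule.subset_span ⟨k, hk, rfl⟩, ?_⟩
        have h1 := S.pos_add p hk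
        have h2 := (S.ram p).entry_antitone (show S.N + 1 - k ≤ S.N - j by omega)
        have h3 := (S.ram p).entry_le (S.N - j)
        rw [SetLike.mem_coe, S.flag_eq_coordFlag p (by omega), mem_coordFlag]
        exact ⟨hu.mem k hk, fun i hi hid => hu.chi_eq_zero hk hid (by omega)⟩

end Adapted

end BasicSituation

/-! ### Adapted bases of points of `U` -/

theorem image_Iic_eq_range {B : Type} (u : ℕ → B) (j : ℕ) :
    u '' Set.Iic j = Set.range fun i : Fin (j + 1) => u i := by
  ext x
  constructor
  · rintro ⟨k, hk, rfl⟩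
    simp only [Set.mem_Iic] at hk
    exact ⟨⟨k, by omega⟩, rfl⟩
  · rintro ⟨i, rfl⟩
    exact ⟨i, by simp only [Set.mem_Iic]; omega, rfl⟩

theorem rankAtStalk_submoduleOf {A : Type} [CommRing A] {Q V : Submodule A A[X]} (h : V ≤ Q)
    (q : PrimeSpectrum A) :
    Module.rankAtStalk (R := A) (V.submoduleOf Q) q = Module.rankAtStalk (R := A) V q := by
  rw [Module.rankAtStalk_eq_of_equiv (Submodule.submoduleOfEquivOfLe h)]

namespace BasicSituation

variable (S : BasicSituation)

section Adapted

variable {A : Type} [CommRing A] [Algebra ℂ A]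

theorem flag_le (p : Option (Fin S.n)) {v : ℕ} (hv : v ≤ S.d + 1) :
    (S.flag p v : Submodule A A[X]) ≤ degreeLT A (S.d + 1) := by
  rw [S.flag_eq_coordFlag p hv]
  exact inf_le_left

theorem flag_mono (p : Option (Fin S.n)) {v w : ℕ} (hvw : v ≤ w) (hw : w ≤ S.d + 1) :
    (S.flag p v : Submodule A A[X]) ≤ S.flag p w := by
  rw [S.flag_eq_coordFlag p hw, S.flag_eq_coordFlag p (hvw.trans hw)]
  intro x hx
  rw [mem_coordFlag] at hx ⊢
  exact ⟨hx.1, fun k hk hkd => hx.2 k (hvw.trans hk) hkd⟩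

theorem projective_quotient_flag (p : Option (Fin S.n)) {v : ℕ} (hv : v ≤ S.d + 1) :
    Module.Projective A (degreeLT A (S.d + 1) ⧸
      (S.flag p v : Submodule A A[X]).submoduleOf (degreeLT A (S.d + 1))) := by
  have h0 := S.isTriangular_pow (A := A) p
  have hQ := h0.coordFlag_eq le_rfl
  rw [coordFlag_top] at hQ
  rw [S.flag_eq_coordFlag p hv, h0.coordFlag_eq hv, hQ]
  exact projective_quotient_span_image (Set.Iio_subset_Iio hv) h0.linearIndepOn

theorem rankAtStalk_flag (p : Option (Fin S.n)) {v : ℕ} (hv : v ≤ S.d + 1) (q : PrimeSpectrum A) :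
    Module.rankAtStalk (R := A) (S.flag p v : Submodule A A[X]) q = v := by
  have h0 := S.isTriangular_pow (A := A) p
  rw [S.flag_eq_coordFlag p hv, h0.coordFlag_eq hv, rankAtStalk_span_image (Set.finite_Iio v)
    (h0.linearIndepOn.mono (Set.Iio_subset_Iio hv)), Set.ncard_eq_toFinset_card']
  simp

/-- A point of the intersection of the Schubert cells contains a polynomial whose leading term is at
each of the prescribed positions: there the rank of `V ∩ F_u` jumps together with that of `F_u`, so
that `V + F_u` does not grow. -/
theorem IsOmegaPoint.exists_chi_eq_one {V : Submodule A A[X]} (h : S.IsOmegaPoint V)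
    (p : Option (Fin S.n)) {k : ℕ} (hk : k ≤ S.N) :
    ∃ v ∈ V, S.chi p (S.pos p k) v = 1 ∧
      ∀ j < S.d + 1, S.pos p k < j → S.chi p j v = 0 := by
  set Q := degreeLT A (S.d + 1) with hQdef
  have hpos := S.pos_add p hk
  have hN := S.hN
  set e := S.pos p k
  have hsucc : S.N - k + 1 = S.N + 1 - k := by omega
  have hanti := (S.ram p).entry_antitone
  have hm1 : MeetsInRank S.d V (S.flag p e) (S.N - k) := by
    refine h.2 p (S.N - k) e (by omega) ?_ ?_
    · have := hanti (show S.N - k ≤ S.N + 1 - k by omega)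
      omega
    · rw [hsucc]; omega
  have hm2 : MeetsInRank S.d V (S.flag p (e + 1)) (S.N - k + 1) := by
    refine h.2 p (S.N - k + 1) (e + 1) (by omega) ?_ ?_
    · rw [hsucc]; omega
    · have := hanti (show S.N - k + 1 ≤ S.N - k + 1 + 1 by omega)
      rw [hsucc] at *
      omega
  have hVQ : V ≤ Q := h.1.1
  have hF : (S.flag p e : Submodule A A[X]) ≤ Q := S.flag_le p (by omega)
  have hF' : (S.flag p (e + 1) : Submodule A A[X]) ≤ Q := S.flag_le p (by omega)
  have : Module.Finite A Q := Module.Finite.equiv (degreeLTEquiv A (S.d + 1)).symm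
  have : Module.Projective A Q := Module.Projective.of_equiv (degreeLTEquiv A (S.d + 1)).symm
  have := h.1.2.1
  have := S.projective_quotient_flag (A := A) p (show e ≤ S.d + 1 by omega)
  have := S.projective_quotient_flag (A := A) p (show e + 1 ≤ S.d + 1 by omega)
  have h1 := hm1.1
  have h2 := hm2.1
  rw [Submodule.submoduleOf_sup_of_le hVQ hF] at h1
  rw [Submodule.submoduleOf_sup_of_le hVQ hF'] at h2
  have key := sup_eq_sup_of_rankAtStalk (V.submoduleOf Q) ((S.flag p e).submoduleOf Q)
    ((S.flag p (e + 1)).submoduleOf Q)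
    (Submodule.comap_mono (S.flag_mono p (Nat.le_succ e) (by omega))) (fun q => by
      have e1 : V.submoduleOf Q ⊓ (S.flag p e).submoduleOf Q = (V ⊓ S.flag p e).submoduleOf Q := rfl
      have e2 : V.submoduleOf Q ⊓ (S.flag p (e + 1)).submoduleOf Q =
        (V ⊓ S.flag p (e + 1)).submoduleOf Q := rfl
      rw [e1, e2, rankAtStalk_submoduleOf hF, rankAtStalk_submoduleOf hF',
        rankAtStalk_submoduleOf (inf_le_left.trans hVQ),
        rankAtStalk_submoduleOf (inf_le_left.trans hVQ), hm1.2, hm2.2,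
        S.rankAtStalk_flag p (by omega), S.rankAtStalk_flag p (by omega)]
      ring)
  rw [← Submodule.submoduleOf_sup_of_le hVQ hF, ← Submodule.submoduleOf_sup_of_le hVQ hF'] at key
  -- the power of the local parameter at position `e` lies in `V + F_e`
  have h0 := S.isTriangular_pow (A := A) p
  set x := (X - C (S.pt A p)) ^ S.expAt p e with hx
  have hxF : x ∈ S.flag p (e + 1) := by
    rw [S.flag_eq_coordFlag p (by omega), mem_coordFlag]
    exact ⟨h0.mem e (by omega), fun j hj hjd => h0.eq_zero e (by omega) j hjd (by omega)⟩
  have hxQ : x ∈ Q := hF' hxF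
  have hx1 : S.chi p e x = 1 := by
    rw [chi_apply, hx, taylor_pow, map_sub, taylor_X, taylor_C]
    simp
  have hmem : (⟨x, hxQ⟩ : Q) ∈ (V ⊔ S.flag p e).submoduleOf Q := by
    rw [key]
    exact Submodule.mem_sup_right (S := V) hxF
  obtain ⟨v, hv, f, hf, hvf⟩ := Submodule.mem_sup.1 (show x ∈ V ⊔ S.flag p e from hmem)
  rw [S.flag_eq_coordFlag p (by omega), mem_coordFlag] at hf hxF
  have hvx : v = x - f := by rw [← hvf]; simp
  refine ⟨v, hv, ?_, fun j hj hej => ?_⟩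
  · rw [hvx, map_sub, hx1, hf.2 e le_rfl (by omega), sub_zero]
  · rw [hvx, map_sub, hxF.2 j (by omega) hj, hf.2 j (by omega) hj, sub_zero]

/-- The images of the first elements of an adapted basis under the coordinates at their positions
generate. -/
theorem IsAdapted.map_span_eq_top {p : Option (Fin S.n)} {u : ℕ → A[X]}
    (hu : S.IsAdapted p u) {r : ℕ} (hr : r ≤ S.N + 1) :
    Submodule.map (LinearMap.pi fun i : Fin r => S.chi p (S.pos p i))
      (Submodule.span A (Set.range fun i : Fin r => u i)) = ⊤ := by
  set φ : A[X] →ₗ[A] (Fin r → A) := LinearMap.pi fun i : Fin r => S.chi p (S.pos p i)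
  let χ : ℕ → (Fin r → A) →ₗ[A] A := fun k => if hk : k < r then
    LinearMap.proj (⟨r - 1 - k, by omega⟩ : Fin r) else 0
  have hχ : ∀ k, ∀ hk : k < r, ∀ x : Fin r → A, χ k x = x ⟨r - 1 - k, by omega⟩ := by
    intro k hk x
    simp only [χ, dif_pos hk]
    rfl
  have ht : IsTriangular (⊤ : Submodule A (Fin r → A)) r χ fun k => φ (u (r - 1 - k)) := by
    constructor
    · intro x _ hx
      funext i
      have := hx (r - 1 - i) (by omega)
      rw [hχ _ (by omega)] at this
      rwa [show (⟨r - 1 - (r - 1 - i), by omega⟩ : Fin r) = i from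
        Fin.ext (by simp only; omega)] at this
    · exact fun _ _ => Submodule.mem_top
    · intro k hk
      rw [hχ k hk]
      exact hu.isUnit_chi (k := r - 1 - k) (by omega)
    · intro k hk j hj hkj
      rw [hχ j hj]
      have h1 := S.pos_add p (show r - 1 - j ≤ S.N by omega)
      exact hu.chi_eq_zero (by omega) (by simp only; omega)
        (S.pos_lt_pos p (by omega) (by simp only; omega) (by simp only; omega))
  have h1 := ht.coordFlag_eq le_rfl
  rw [coordFlag_top] at h1
  rw [eq_top_iff, h1, Submodule.map_span]
  refine Submodule.span_mono ?_
  rintro _ ⟨k, hk, rfl⟩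
  simp only [Set.mem_Iio] at hk
  exact ⟨_, ⟨⟨r - 1 - k, by omega⟩, rfl⟩, rfl⟩

/-- A point of the open subscheme `U` has an adapted basis at each marked point. -/
theorem IsUPoint.exists_isAdapted {E : Fin (S.N + 1) → Submodule A A[X]} (h : S.IsUPoint E)
    (p : Option (Fin S.n)) : ∃ u, S.IsAdapted p u ∧ S.SpansFlag u E := by
  have hN := S.hN
  have key : ∀ k : ℕ, ∃ u : A[X], ∀ hk : k ≤ S.N, u ∈ E ⟨k, by omega⟩ ∧
      S.chi p (S.pos p k) u = 1 ∧ ∀ j < S.d + 1, S.pos p k < j → S.chi p j u = 0 := by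
    intro k
    by_cases hk : k ≤ S.N
    swap
    · exact ⟨0, fun h => absurd h hk⟩
    obtain ⟨v, hv, hv1, hv2⟩ := IsOmegaPoint.exists_chi_eq_one S h.1.2.2 p hk
    rw [← h.2 p ⟨k, by omega⟩] at hv
    obtain ⟨u, hu, w, hw, huw⟩ := Submodule.mem_sup.1 hv
    have hpos := S.pos_add p hk
    have hle := (S.ram p).entry_le (S.N - k)
    have hanti := (S.ram p).entry_antitone (show S.N - k ≤ S.N + 1 - k by omega)
    have hwF := hw.2
    rw [S.flag_eq_coordFlag p (by simp only; omega), SetLike.mem_coe, mem_coordFlag] at hwF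
    simp only at hwF
    have huv : u = v - w := by rw [← huw]; simp
    refine ⟨u, fun _ => ⟨hu, ?_, fun j hj hjk => ?_⟩⟩
    · rw [huv, map_sub, hv1, hwF.2 _ (by omega) (by omega), sub_zero]
    · rw [huv, map_sub, hv2 j hj hjk, hwF.2 j (by omega) hj, sub_zero]
  choose u hu using key
  have had : S.IsAdapted p u := by
    refine S.isAdapted_of_chi (fun k hk => (h.1.2.1 ⟨k, by omega⟩).1 (hu k hk).1)
      (fun k hk => ?_) (fun k hk => (hu k hk).2.2)
    rw [(hu k hk).2.1]
    exact isUnit_one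
  refine ⟨u, had, fun j => ?_⟩
  obtain ⟨hfin, hproj⟩ := (h.1.2.1 j).finite_and_projective
  rw [image_Iic_eq_range]
  refine eq_span_of_rankAtStalk_eq (E j) (h.1.2.1 j).2.2 _ (fun i => ?_) _
    (IsAdapted.map_span_eq_top S had (by omega))
  have hij : (⟨i, by omega⟩ : Fin (S.N + 1)) ≤ j := Fin.mk_le_of_le_val (by omega)
  exact h.1.1 hij (hu i (by omega)).1

end Adapted

end BasicSituation

/-! ### The equation `Wr(y, g) = P` -/

section WronskianEquation

variable {A : Type} [CommRing A]

theorem exists_derivative_eq [Algebra ℂ A] (f : A[X]) : ∃ g, derivative g = f := by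
  induction f using Polynomial.induction_on' with
  | add p q hp hq =>
    obtain ⟨g, rfl⟩ := hp
    obtain ⟨h, rfl⟩ := hq
    exact ⟨g + h, derivative_add⟩
  | monomial n a =>
    refine ⟨monomial (n + 1) (a * algebraMap ℂ A ((n : ℂ) + 1)⁻¹), ?_⟩
    rw [derivative_monomial]
    congr 1
    have h1 : ((n + 1 : ℕ) : A) = algebraMap ℂ A ((n : ℂ) + 1) := by simp
    rw [h1, mul_assoc, ← map_mul, inv_mul_cancel₀ (by exact_mod_cast Nat.succ_ne_zero n)]
    simp

/-- If `y` has no multiple roots, `Wr(y, g) = P` can be solved for `g` as soon as `y` divides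
`Wr(y', P)`, the condition that `P / y²` has no residues. A first approximation is the solution
modulo `y`, and the divisibility makes the error a multiple of `y²`, which an antiderivative
removes. -/
theorem exists_wronskian_eq [Algebra ℂ A] {y P : A[X]} (hy : IsCoprime y (derivative y))
    (h : y ∣ wronskian (derivative y) P) : ∃ g, wronskian y g = P := by
  have hco := hy
  obtain ⟨a, b, hab⟩ := hy
  set g₀ := -(b * P)
  set q := a * P
  have h1 : derivative y * g₀ = -P + y * q := by
    simp only [g₀, q]
    linear_combination -P * hab
  have h2 : derivative (derivative y) * g₀ + derivative y * derivative g₀ =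
      -derivative P + derivative y * q + y * derivative q := by
    have := congrArg derivative h1
    simp only [derivative_mul, derivative_add, derivative_neg] at this
    linear_combination this
  have h3 : y ∣ derivative y ^ 2 * (derivative g₀ - q) := by
    have h4 : derivative y ^ 2 * (derivative g₀ - q) = -wronskian (derivative y) P +
        y * (derivative y * derivative q - derivative (derivative y) * q) := by
      simp only [wronskian]
      linear_combination derivative y * h2 - derivative (derivative y) * h1
    rw [h4]
    exact dvd_add ((dvd_neg).2 h) (dvd_mul_right _ _)
  obtain ⟨m, hm⟩ := (hco.pow_right (n := 2)).dvd_of_dvd_mul_left h3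
  obtain ⟨k, hk⟩ := exists_derivative_eq (-m)
  refine ⟨g₀ + y * k, ?_⟩
  simp only [wronskian, derivative_add, derivative_mul, hk]
  linear_combination y * hm - h1

/-- The divisibility that makes the equation solvable passes from `y₂` to any `g` whose Wronskian
with `y₂` is divisible by `y`. -/
theorem dvd_wronskian_of_dvd_wronskian {y y₂ g P : A[X]} (hco : IsCoprime y y₂)
    (h : y ∣ wronskian (derivative y) (P * y₂)) (hg : y ∣ wronskian y₂ g) :
    y ∣ wronskian (derivative y) (P * g) := by
  refine hco.dvd_of_dvd_mul_left ?_
  have : y₂ * wronskian (derivative y) (P * g) = g * wronskian (derivative y) (P * y₂) +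
      derivative y * P * wronskian y₂ g := by
    simp only [wronskian, derivative_mul]
    ring
  rw [this]
  exact dvd_add (h.mul_left _) (hg.mul_left _)

theorem dvd_wronskian_derivative_wronskian (y g : A[X]) :
    y ∣ wronskian (derivative y) (wronskian y g) := by
  refine ⟨derivative y * derivative (derivative g) - derivative (derivative y) * derivative g, ?_⟩
  simp only [wronskian, derivative_sub, derivative_mul]
  ring

theorem wronskian_mul_mul (h f g : A[X]) :
    wronskian (h * f) (h * g) = h ^ 2 * wronskian f g := by
  simp only [wronskian, derivative_mul]
  ring

/-- Solutions of `x Wr(W, f) = P` are determined up to multiples of `W`, and one of them has the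
leading exponent dictated by those of `W` and `P`. -/
theorem HasLead.exists_sub_smul [Algebra ℂ A] {b : Bool} {w m : ℕ} {c c' : A} {W f P : A[X]}
    (hc : IsUnit c) (hc' : IsUnit c') (hW : HasLead b w c W) (hP : HasLead b (w + m) c' P)
    (h : X * wronskian W f = P) :
    ∃ a₀ a : A, IsUnit a ∧ HasLead b m a (f - a₀ • W) := by
  obtain ⟨c, rfl⟩ := hc
  refine ⟨f.coeff w * ↑c⁻¹, ?_⟩
  refine HasLead.of_X_mul_wronskian c.isUnit hc' hW hP ?_ ?_
  · rw [← h]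
    simp only [wronskian, smul_eq_C_mul, derivative_sub, derivative_mul, derivative_C]
    ring
  · simp [hW.coeff_eq]

end WronskianEquation

/-! ### Sequences with the same partial Wronskians -/

section Uniqueness

variable {A : Type} [CommRing A]

/-- The factor is the determinant of the transition matrix; it does not depend on the last entry. -/
theorem exists_seqWrWith_eq_smul (u v : ℕ → A[X]) (k : ℕ)
    (h : ∀ j < k, v j ∈ Submodule.span A (u '' Set.Iio k)) :
    ∃ c : A, ∀ f, seqWrWith v k f = c • seqWrWith u k f := by
  have hr : u '' Set.Iio k = Set.range fun i : Fin k => u i := by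
    ext x
    constructor
    · rintro ⟨j, hj, rfl⟩; exact ⟨⟨j, hj⟩, rfl⟩
    · rintro ⟨i, rfl⟩; exact ⟨i, i.2, rfl⟩
  have hM : ∀ j : Fin k, ∃ c : Fin k → A, ∑ i, c i • u i = v j := fun j =>
    (Submodule.mem_span_range_iff_exists_fun A).1 (hr ▸ h j j.2)
  choose M hM using hM
  let M' : Matrix (Fin (k + 1)) (Fin (k + 1)) A := Matrix.of fun i j =>
    if hj : (j : ℕ) < k then (if hi : (i : ℕ) < k then M ⟨j, hj⟩ ⟨i, hi⟩ else 0)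
    else if (i : ℕ) < k then 0 else 1
  refine ⟨M'.det, fun f => ?_⟩
  rw [seqWrWith, seqWrWith, smul_eq_C_mul, ← wr_sum_smul]
  congr 1
  funext j
  rw [Fin.sum_univ_castSucc]
  by_cases hj : (j : ℕ) < k
  · simpa [M', hj] using (hM ⟨j, hj⟩).symm
  · simp [M', hj]

theorem seqWr_eq_smul_of_span_le (u v : ℕ → A[X]) (k : ℕ)
    (h : ∀ j < k, v j ∈ Submodule.span A (u '' Set.Iio k)) : ∃ c : A, seqWr v k = c • seqWr u k := by
  have hr : u '' Set.Iio k = Set.range fun i : Fin k => u i := by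
    ext x
    constructor
    · rintro ⟨j, hj, rfl⟩; exact ⟨⟨j, hj⟩, rfl⟩
    · rintro ⟨i, rfl⟩; exact ⟨i, i.2, rfl⟩
  have h1 : seqWr v k ∈ wrLine k (Submodule.span A (Set.range fun i : Fin k => u i)) :=
    Submodule.subset_span ⟨_, fun j => hr ▸ h j j.2, rfl⟩
  rw [wrLine_span_range] at h1
  obtain ⟨c, hc⟩ := Submodule.mem_span_singleton.1 h1
  exact ⟨c, hc.symm⟩

/-- A flag is determined by the Wronskians of its steps. -/
theorem span_eq_span_of_seqWr_eq [Algebra ℂ A] (u v : ℕ → A[X]) (n : ℕ)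
    (hmonic : ∀ k ≤ n, (seqWr u k).Monic) (h : ∀ k ≤ n, seqWr u k = seqWr v k) :
    ∀ k ≤ n, Submodule.span A (u '' Set.Iio k) = Submodule.span A (v '' Set.Iio k) := by
  have step : ∀ (u v : ℕ → A[X]), (∀ k ≤ n, (seqWr u k).Monic) → (∀ k ≤ n, seqWr u k = seqWr v k) →
      ∀ k, k + 1 ≤ n → Submodule.span A (u '' Set.Iio k) = Submodule.span A (v '' Set.Iio k) →
        Submodule.span A (v '' Set.Iio (k + 1)) ≤ Submodule.span A (u '' Set.Iio (k + 1)) := by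
    intro u v hmonic h k hk heq
    have hmono : Submodule.span A (u '' Set.Iio k) ≤ Submodule.span A (u '' Set.Iio (k + 1)) :=
      Submodule.span_mono (Set.image_mono (Set.Iio_subset_Iio (Nat.le_succ k)))
    refine Submodule.span_le.2 ?_
    rintro _ ⟨j, hj, rfl⟩
    simp only [Set.mem_Iio] at hj
    by_cases hjk : j < k
    · refine hmono ?_
      rw [heq]
      exact Submodule.subset_span ⟨j, hjk, rfl⟩
    · obtain rfl : j = k := by omega
      obtain ⟨c, hc⟩ := exists_seqWrWith_eq_smul v u j fun i hi => by
        rw [← heq]; exact Submodule.subset_span ⟨i, hi, rfl⟩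
      have h1 : seqWrWith u j (v j + (-c) • u j) = 0 := by
        rw [seqWrWith_add, seqWrWith_smul, hc, seqWrWith_self, seqWrWith_self, ← h _ hk]
        simp
      have h2 := mem_span_of_seqWrWith_eq_zero u j (fun i hi => hmonic i (by omega)) _ h1
      rw [show v j = (v j + (-c) • u j) + c • u j by module]
      exact Submodule.add_mem _ (hmono h2)
        (Submodule.smul_mem _ _ (Submodule.subset_span ⟨j, by simp, rfl⟩))
  intro k hk
  induction k with
  | zero => simp
  | succ k ih =>
    refine le_antisymm ?_ (step u v hmonic h k hk (ih (by omega)))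
    exact step v u (fun k hk => h k hk ▸ hmonic k hk) (fun k hk => (h k hk).symm) k hk
      (ih (by omega)).symm

theorem seqWr_smul (a : ℕ → A) (u : ℕ → A[X]) (k : ℕ) :
    seqWr (fun j => a j • u j) k = (∏ j ∈ Finset.range k, a j) • seqWr u k := by
  have h := Matrix.det_mul_row (fun j : Fin k => C (a j))
    (Matrix.of fun r c : Fin k => derivative^[(r : ℕ)] (u c))
  rw [seqWr, seqWr, wr, wr, smul_eq_C_mul, map_prod, Finset.prod_range, ← h]
  congr 1
  ext1 r c
  simp [smul_eq_C_mul]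

end Uniqueness

/-! ### Binomial coefficients -/

theorem choose_two_succ (n : ℕ) : (n + 1).choose 2 = n + n.choose 2 := by
  rw [Nat.choose_succ_succ' n 1, Nat.choose_one_right]

theorem choose_two_mul_two (n : ℕ) : ((n.choose 2 : ℕ) : ℤ) * 2 = n * (n - 1) := by
  induction n with
  | zero => simp
  | succ n ih => rw [choose_two_succ]; push_cast; linarith

/-! ### Factors at a point, and leading terms of monic polynomials -/

section PowMul

variable {A : Type} [CommRing A]

theorem hasLead_taylor_pow_mul (r : A) (t : ℕ) (q : A[X]) :
    HasLead false t (q.eval r) (taylor r ((X - C r) ^ t * q)) := by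
  have h0 : HasLead false 0 (q.eval r) (taylor r q) :=
    ⟨taylor_coeff_zero r q, fun k hk => by simp [Beyond] at hk⟩
  have h1 := h0.X_pow_mul t
  rw [add_zero] at h1
  convert h1 using 1
  rw [taylor_mul, taylor_pow, map_sub, taylor_X, taylor_C]
  simp

theorem pow_dvd_of_coeff_taylor {r : A} {t : ℕ} {f : A[X]}
    (h : ∀ k < t, (taylor r f).coeff k = 0) : (X - C r) ^ t ∣ f := by
  rw [← map_dvd_iff (taylorEquiv r)]
  have hX : (taylorEquiv r) ((X - C r) ^ t) = X ^ t := by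
    change taylor r ((X - C r) ^ t) = _
    rw [taylor_pow, map_sub, taylor_X, taylor_C]
    simp
  rw [hX, X_pow_dvd_iff]
  exact h

theorem isCoprime_X_sub_C {y : A[X]} {a : A} : IsCoprime y (X - C a) ↔ IsUnit (y.eval a) := by
  constructor
  · rintro ⟨u, v, h⟩
    have := congrArg (eval a) h
    simp only [eval_add, eval_mul, eval_sub, eval_X, eval_C, sub_self, mul_zero, add_zero,
      eval_one] at this
    exact IsUnit.of_mul_eq_one_right _ this
  · intro h
    obtain ⟨q, hq⟩ := X_sub_C_dvd_sub_C_eval (a := a) (p := y)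
    have h1 : IsCoprime (C (y.eval a)) (X - C a) := by
      obtain ⟨c, hc⟩ := (h.map C).exists_left_inv
      exact ⟨c, 0, by rw [hc, zero_mul, add_zero]⟩
    rw [show y = C (y.eval a) + (X - C a) * q by rw [← hq]; ring]
    exact h1.add_mul_left_left q

theorem hasLead_of_monic {f : A[X]} (hf : f.Monic) : HasLead true f.natDegree 1 f :=
  ⟨hf, fun k hk => coeff_eq_zero_of_natDegree_lt (by simpa [Beyond] using hk)⟩

theorem HasLead.natDegree_eq [Nontrivial A] {e : ℕ} {c : A} (hc : IsUnit c) {f : A[X]}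
    (h : HasLead true e c f) : f.natDegree = e := by
  apply le_antisymm
  · rw [natDegree_le_iff_coeff_eq_zero]
    exact fun k hk => h.coeff_beyond k (by simpa [Beyond] using hk)
  · exact le_natDegree_of_ne_zero (by rw [h.coeff_eq]; exact hc.ne_zero)

end PowMul

namespace BasicSituation

variable (S : BasicSituation)

/-! ### The polynomials `K_i` and `T_i` -/

section Products

variable (A : Type) [CommRing A] [Algebra ℂ A]

theorem zProd_monic (e : Fin S.n → ℕ) : (S.zProd A e).Monic :=
  monic_prod_of_monic _ _ fun _ _ => (monic_X_sub_C _).pow _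

theorem K_monic (i : ℕ) : (S.K A i).Monic := S.zProd_monic A _

theorem zProd_mul (e e' : Fin S.n → ℕ) :
    S.zProd A e * S.zProd A e' = S.zProd A fun s => e s + e' s := by
  simp only [zProd, ← Finset.prod_mul_distrib, pow_add]

theorem zProd_pow (e : Fin S.n → ℕ) (m : ℕ) :
    S.zProd A e ^ m = S.zProd A fun s => e s * m := by
  simp only [zProd, ← Finset.prod_pow, pow_mul]

theorem zProd_dvd {e e' : Fin S.n → ℕ} (h : ∀ s, e s ≤ e' s) : S.zProd A e ∣ S.zProd A e' :=
  Finset.prod_dvd_prod_of_dvd _ _ fun s _ => pow_dvd_pow _ (h s)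

theorem natDegree_zProd [Nontrivial A] (e : Fin S.n → ℕ) :
    (S.zProd A e).natDegree = ∑ s, e s := by
  rw [zProd, natDegree_prod_of_monic _ _ fun s _ => (monic_X_sub_C _).pow _]
  refine Finset.sum_congr rfl fun s _ => ?_
  rw [(monic_X_sub_C _).natDegree_pow, natDegree_X_sub_C, mul_one]

theorem isUnit_algebraMap_sub {s s' : Fin S.n} (h : s ≠ s') :
    IsUnit (algebraMap ℂ A (S.z s) - algebraMap ℂ A (S.z s')) := by
  rw [← map_sub]
  exact IsUnit.map _ (isUnit_iff_ne_zero.2 (sub_ne_zero.2 (S.z_injective.ne h)))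

theorem zProd_eq_pow_mul (e : Fin S.n → ℕ) (s : Fin S.n) :
    ∃ q, S.zProd A e = (X - C (algebraMap ℂ A (S.z s))) ^ e s * q ∧
      IsUnit (q.eval (algebraMap ℂ A (S.z s))) := by
  classical
  refine ⟨_, (Finset.mul_prod_erase _ _ (Finset.mem_univ s)).symm, ?_⟩
  rw [eval_prod]
  refine Finset.prod_induction _ IsUnit (fun a b => IsUnit.mul) isUnit_one fun s' hs' => ?_
  rw [eval_pow, eval_sub, eval_X, eval_C]
  exact (S.isUnit_algebraMap_sub A (Finset.ne_of_mem_erase hs').symm).pow _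

theorem isCoprime_zProd {y : A[X]} (hy : ∀ s, IsUnit (y.eval (algebraMap ℂ A (S.z s))))
    (e : Fin S.n → ℕ) : IsCoprime y (S.zProd A e) := by
  refine IsCoprime.prod_right fun s _ => IsCoprime.pow_right (isCoprime_X_sub_C.2 (hy s))

theorem tail_succ (r : RamificationSequence S.N S.d) {i : ℕ} (hi : i ≤ S.N) :
    r.tail (i + 1) = r.tail i + r.entry (S.N + 1 - i) := by
  rw [r.tail_eq _ (by omega), r.tail_eq _ (by omega), Finset.sum_range_succ]

/-- This is the relation `T_i = K_{i+1} K_{i-1} / K_i²`. -/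
theorem K_mul_K {i : ℕ} (hi : i + 1 ≤ S.N) :
    S.K A i * S.K A (i + 2) = S.K A (i + 1) ^ 2 * S.T A (i + 1) := by
  rw [K, K, K, T, zProd_pow, zProd_mul, zProd_mul]
  congr 1
  funext s
  have h1 := S.tail_succ (S.ram (some s)) (show i + 1 ≤ S.N by omega)
  have h2 := S.tail_succ (S.ram (some s)) (show i ≤ S.N by omega)
  have h3 := (S.ram (some s)).entry_antitone (show S.N + 1 - (i + 1) ≤ S.N + 1 - i by omega)
  rw [show S.N + 2 - (i + 1) = S.N + 1 - i by omega]
  rw [show i + 1 + 1 = i + 2 by rfl] at h1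
  omega

theorem K_zero : S.K A 0 = 1 := by simp [K, zProd, RamificationSequence.tail]

end Products

/-! ### Numerology of exponents -/

section Exponents

/-- The sum of the first `k` leading exponents at the marked point. -/
def sumExpo (p : Option (Fin S.n)) (k : ℕ) : ℕ := ∑ j ∈ Finset.range k, S.expo p j

theorem sumExpo_succ (p : Option (Fin S.n)) (k : ℕ) :
    S.sumExpo p (k + 1) = S.sumExpo p k + S.expo p k := Finset.sum_range_succ _ _

theorem sumExpo_some (s : Fin S.n) {k : ℕ} (hk : k ≤ S.N + 1) :
    S.sumExpo (some s) k = k.choose 2 + (S.ram (some s)).tail k := by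
  induction k with
  | zero => simp [sumExpo, RamificationSequence.tail]
  | succ k ih =>
    rw [sumExpo_succ, ih (by omega), choose_two_succ, S.tail_succ _ (by omega),
      S.expo_some s (by omega)]
    ring

theorem sumExpo_none {k : ℕ} (hk : k ≤ S.N + 1) :
    S.sumExpo none k + k.choose 2 + (S.ram none).tail k = k * S.d := by
  induction k with
  | zero => simp [sumExpo, RamificationSequence.tail]
  | succ k ih =>
    have h1 := ih (by omega)
    have h2 := S.expo_none (show k ≤ S.N by omega)
    rw [sumExpo_succ, choose_two_succ, S.tail_succ _ (by omega), add_mul, one_mul, ← h1]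
    omega

theorem l_add {k : ℕ} (hk : k ≤ S.N + 1) :
    S.l k + ∑ s, ((S.ram (some s)).tail k : ℤ) + k.choose 2 = S.sumExpo none k := by
  have h1 := S.sumExpo_none hk
  have h2 := choose_two_mul_two k
  have h3 : ((S.sumExpo none k : ℕ) : ℤ) + k.choose 2 + (S.ram none).tail k = k * S.d := by
    exact_mod_cast h1
  rw [l, Fintype.sum_option]
  linarith

theorem l_zero : S.l 0 = 0 := by simp [l, RamificationSequence.tail]

/-- Here the assumption on the total codimension enters. -/
theorem l_last : S.l (S.N + 1) = 0 := by
  rw [l, Finset.sum_congr rfl fun p _ => by rw [(S.ram p).tail_last]]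
  have h1 := S.sum_size
  have h2 := S.hN
  have h3 : ((∑ p, (S.ram p).size : ℕ) : ℤ) = ((S.N : ℤ) + 1) * ((S.d : ℤ) - S.N) := by
    rw [h1]; push_cast [Nat.cast_sub h2]; ring
  rw [← Nat.cast_sum, h3]
  push_cast
  ring

theorem expo_injOn (p : Option (Fin S.n)) : Set.InjOn (S.expo p) (Set.Iic S.N) := by
  intro i hi j hj h
  apply S.pos_injOn p hi hj
  simp only [Set.mem_Iic] at hi hj
  have h1 := S.pos_add p hi
  have h2 := S.pos_add p hj
  unfold expo at h
  cases p <;> simp only [expAt] at h <;> omega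

end Exponents

/-! ### Monic solutions of the divisibility conditions -/

section Solutions

variable {A : Type} [CommRing A] [Algebra ℂ A]

/-- A point of `𝒜`, given by the monic generators `y_i` of its lines; `y_0 = y_{N+1} = 1`. -/
structure IsSolution (y : ℕ → A[X]) : Prop where
  zero : y 0 = 1
  last : y (S.N + 1) = 1
  monic : ∀ i ≤ S.N + 1, (y i).Monic
  natDegree : ∀ i ≤ S.N + 1, ((y i).natDegree : ℤ) = S.l i
  isUnit_eval : ∀ i ≤ S.N + 1, ∀ s, IsUnit ((y i).eval (algebraMap ℂ A (S.z s)))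
  isCoprime : ∀ i ≤ S.N, IsCoprime (y i) (y (i + 1))
  isCoprime_derivative : ∀ i ≤ S.N + 1, IsCoprime (y i) (derivative (y i))
  dvd : ∀ i, i + 1 ≤ S.N →
    y (i + 1) ∣ wronskian (derivative (y (i + 1))) (S.T A (i + 1) * y i * y (i + 2))

variable {S}

theorem IsSolution.hasLead [Nontrivial A] {y : ℕ → A[X]} (hy : S.IsSolution y)
    (p : Option (Fin S.n)) {k : ℕ} (hk : k ≤ S.N + 1) :
    ∃ c, IsUnit c ∧ HasLead (S.dir p) (S.sumExpo p k) c
      (X ^ k.choose 2 * taylor (S.pt A p) (S.K A k * y k)) := by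
  cases p with
  | none =>
    refine ⟨1, isUnit_one, ?_⟩
    have hm : (S.K A k * y k).Monic := (S.K_monic A k).mul (hy.monic k hk)
    have h1 := (hasLead_of_monic hm).X_pow_mul (k.choose 2)
    rw [pt, taylor_zero, dir]
    convert h1 using 1
    rw [(S.K_monic A k).natDegree_mul (hy.monic k hk), K, natDegree_zProd]
    have h2 := S.l_add hk
    have h3 := hy.natDegree k hk
    have h4 : ((∑ s, (S.ram (some s)).tail k : ℕ) : ℤ) = ∑ s, ((S.ram (some s)).tail k : ℤ) := by
      push_cast; rfl
    omega
  | some s =>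
    obtain ⟨q, hq, hu⟩ := S.zProd_eq_pow_mul A (fun s => (S.ram (some s)).tail k) s
    refine ⟨(q * y k).eval (algebraMap ℂ A (S.z s)), ?_, ?_⟩
    · rw [eval_mul]; exact hu.mul (hy.isUnit_eval k hk s)
    · rw [S.sumExpo_some s hk, K, hq, mul_assoc]
      exact (hasLead_taylor_pow_mul _ _ _).X_pow_mul _

theorem IsSolution.wronskian_K_mul {y : ℕ → A[X]} {t : ℕ} (ht : t + 1 ≤ S.N)
    {g h : A[X]} (hg : wronskian (y (t + 1)) g = S.T A (t + 1) * y t * h) :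
    wronskian (S.K A (t + 1) * y (t + 1)) (S.K A (t + 1) * g) =
      (S.K A t * y t) * (S.K A (t + 2) * h) := by
  rw [wronskian_mul_mul, hg]
  linear_combination (-(y t * h)) * S.K_mul_K A ht

/-- Passing to a lower Wronskian `Wr(u_0, …, u_{t-1}, u) = K_{t+1} g` of an unknown `u` amounts to
solving `Wr(y_t, g') = T_t y_{t-1} g`; iterating this down to `t = 0` produces `u` itself. At each
stage the solution is normalised at the marked point `p`, which gives `u` its leading exponent. -/
theorem IsSolution.exists_seqWrWith_eq [Nontrivial A] {y : ℕ → A[X]} (hy : S.IsSolution y)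
    (p : Option (Fin S.n)) (e : ℕ) {t : ℕ} (ht : t ≤ S.N) (g : A[X])
    (hdvd : y t ∣ wronskian (y (t + 1)) g)
    (hg : ∃ c, IsUnit c ∧ HasLead (S.dir p) (S.sumExpo p t + e) c
      (X ^ (t + 1).choose 2 * taylor (S.pt A p) (S.K A (t + 1) * g))) :
    ∃ u, (∃ c, IsUnit c ∧ HasLead (S.dir p) e c (taylor (S.pt A p) u)) ∧
      ∀ U : ℕ → A[X], (∀ k ≤ t, seqWr U k = S.K A k * y k) →
        seqWrWith U t u = S.K A (t + 1) * g := by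
  induction t generalizing g with
  | zero =>
    refine ⟨S.K A 1 * g, ?_, fun U _ => seqWrWith_zero U _⟩
    simpa [sumExpo] using hg
  | succ t ih =>
    have hdvd' : y (t + 1) ∣ wronskian (derivative (y (t + 1))) (S.T A (t + 1) * y t * g) :=
      dvd_wronskian_of_dvd_wronskian (hy.isCoprime (t + 1) ht) (hy.dvd t ht) hdvd
    obtain ⟨g₀, hg₀⟩ := exists_wronskian_eq (hy.isCoprime_derivative (t + 1) (by omega)) hdvd'
    obtain ⟨c₁, hc₁, hW⟩ := hy.hasLead p (show t + 1 ≤ S.N + 1 by omega)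
    obtain ⟨c₀, hc₀, hW₀⟩ := hy.hasLead p (show t ≤ S.N + 1 by omega)
    obtain ⟨c₂, hc₂, hG⟩ := hg
    have hP := hW₀.mul hG
    rw [show S.sumExpo p t + (S.sumExpo p (t + 1) + e) =
      S.sumExpo p (t + 1) + (S.sumExpo p t + e) by ring] at hP
    have heq : X * wronskian
        (X ^ (t + 1).choose 2 * taylor (S.pt A p) (S.K A (t + 1) * y (t + 1)))
        (X ^ (t + 1).choose 2 * taylor (S.pt A p) (S.K A (t + 1) * g₀)) =
        (X ^ t.choose 2 * taylor (S.pt A p) (S.K A t * y t)) *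
        (X ^ (t + 1 + 1).choose 2 * taylor (S.pt A p) (S.K A (t + 1 + 1) * g)) := by
      rw [wronskian_mul_mul, ← taylor_wronskian, IsSolution.wronskian_K_mul ht hg₀, taylor_mul,
        choose_two_succ (t + 1), choose_two_succ t]
      ring
    obtain ⟨a₀, a, ha, hlead⟩ := HasLead.exists_sub_smul hc₁ (hc₀.mul hc₂) hW hP heq
    have hg₁ : wronskian (y (t + 1)) (g₀ - a₀ • y (t + 1)) = S.T A (t + 1) * y t * g := by
      rw [← hg₀]
      simp only [wronskian, smul_eq_C_mul, derivative_sub, derivative_mul, derivative_C]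
      ring
    have hlead' : HasLead (S.dir p) (S.sumExpo p t + e) a
        (X ^ (t + 1).choose 2 *
          taylor (S.pt A p) (S.K A (t + 1) * (g₀ - a₀ • y (t + 1)))) := by
      convert hlead using 1
      rw [mul_sub, map_sub, mul_smul_comm, map_smul, smul_eq_C_mul, smul_eq_C_mul]
      ring
    obtain ⟨u, hu, hU⟩ := ih (by omega) (g₀ - a₀ • y (t + 1))
      (by rw [hg₁]; exact ⟨S.T A (t + 1) * g, by ring⟩) ⟨a, ha, hlead'⟩
    refine ⟨u, hu, fun U hUk => ?_⟩
    have h1 := seqWr_mul_seqWrWith U t u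
    rw [hUk t (by omega), hUk (t + 1) le_rfl, hU U fun k hk => hUk k (by omega),
      IsSolution.wronskian_K_mul ht hg₁] at h1
    exact ((S.K_monic A t).mul (hy.monic t (by omega))).isRegular.left h1

/-- A solution is the tuple of Wronskians of a flag; for each marked point `p` the flag can be
spanned by polynomials with the prescribed leading exponents at `p`. -/
theorem IsSolution.exists_seqWr_eq [Nontrivial A] {y : ℕ → A[X]} (hy : S.IsSolution y)
    (p : Option (Fin S.n)) :
    ∃ U : ℕ → A[X], (∀ k ≤ S.N + 1, seqWr U k = S.K A k * y k) ∧
      ∀ k ≤ S.N, ∃ c, IsUnit c ∧ HasLead (S.dir p) (S.expo p k) c (taylor (S.pt A p) (U k)) := by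
  have key : ∀ k, ∃ u : A[X], k ≤ S.N →
      (∃ c, IsUnit c ∧ HasLead (S.dir p) (S.expo p k) c (taylor (S.pt A p) u)) ∧
      ∀ U : ℕ → A[X], (∀ j ≤ k, seqWr U j = S.K A j * y j) →
        seqWrWith U k u = S.K A (k + 1) * y (k + 1) := by
    intro k
    by_cases hk : k ≤ S.N
    · obtain ⟨u, hu⟩ := hy.exists_seqWrWith_eq p (S.expo p k) hk (y (k + 1))
        (by rw [wronskian_self_eq_zero]; exact dvd_zero _)
        (by rw [← sumExpo_succ]; exact hy.hasLead p (by omega))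
      exact ⟨u, fun _ => hu⟩
    · exact ⟨0, fun h => absurd h hk⟩
  choose U hU using key
  refine ⟨U, ?_, fun k hk => (hU k hk).1⟩
  intro k
  induction k using Nat.strong_induction_on with
  | _ k ih =>
    intro hk
    cases k with
    | zero => rw [seqWr_zero, hy.zero, K_zero, mul_one]
    | succ k =>
      rw [← seqWrWith_self]
      exact (hU k (by omega)).2 U fun j hj => ih j (by omega) (by omega)

end Solutions

end BasicSituation

theorem image_Iic_eq_image_Iio {B : Type} (u : ℕ → B) (j : ℕ) :
    u '' Set.Iic j = u '' Set.Iio (j + 1) := by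
  congr 1
  ext k
  simp only [Set.mem_Iic, Set.mem_Iio]
  omega

namespace BasicSituation

variable (S : BasicSituation)

/-! ### From solutions to flags -/

section ToFlags

variable {A : Type} [CommRing A] [Algebra ℂ A]

variable {S} in
omit [Algebra ℂ A] in
theorem SpansFlag.wrLine_eq {u : ℕ → A[X]} {E : Fin (S.N + 1) → Submodule A A[X]}
    (h : S.SpansFlag u E) (j : Fin (S.N + 1)) :
    wrLine (j + 1) (E j) = Submodule.span A {seqWr u (j + 1)} := by
  rw [h j, image_Iic_eq_range, wrLine_span_range]
  rfl

variable {S} in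
/-- The monic partial Wronskians determine the flag. -/
theorem SpansFlag.eq_of_seqWr_eq {u v : ℕ → A[X]} {E E' : Fin (S.N + 1) → Submodule A A[X]}
    (hu : S.SpansFlag u E) (hv : S.SpansFlag v E') (hm : ∀ k ≤ S.N + 1, (seqWr u k).Monic)
    (h : ∀ k ≤ S.N + 1, seqWr u k = seqWr v k) : E = E' := by
  funext j
  rw [hu j, hv j, image_Iic_eq_image_Iio, image_Iic_eq_image_Iio]
  exact span_eq_span_of_seqWr_eq u v (S.N + 1) hm h _ (by omega)

variable {S} in
/-- Adapted bases at different marked points have the same Wronskians, hence span the same flag. -/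
theorem IsSolution.exists_mem_FlO [Nontrivial A] {y : ℕ → A[X]} (hy : S.IsSolution y) :
    ∃ E ∈ S.FlO A, ∃ U, S.SpansFlag U E ∧ ∀ k ≤ S.N + 1, seqWr U k = S.K A k * y k := by
  obtain ⟨U, hU, hlead⟩ := hy.exists_seqWr_eq none
  let E : Fin (S.N + 1) → Submodule A A[X] := fun j => Submodule.span A (U '' Set.Iic (j : ℕ))
  have hmon : ∀ k ≤ S.N + 1, (seqWr U k).Monic := fun k hk => by
    rw [hU k hk]; exact (S.K_monic A k).mul (hy.monic k hk)
  have hdeg : ∀ k ≤ S.N, U k ∈ degreeLT A (S.d + 1) := by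
    intro k hk
    obtain ⟨c, hc, hl⟩ := hlead k hk
    have := S.expo_none hk
    rw [mem_degreeLT, degree_lt_iff_coeff_zero]
    intro m hm
    have h1 := hl.coeff_beyond m (by simp only [Beyond, dir, if_true]; omega)
    rwa [pt, taylor_zero] at h1
  refine ⟨E, ⟨S.isUPoint_of_isAdapted fun p => ?_, ?_⟩, U, fun j => rfl, hU⟩
  · obtain ⟨V, hV, hleadV⟩ := hy.exists_seqWr_eq p
    have hspan := span_eq_span_of_seqWr_eq U V (S.N + 1) hmon fun k hk => by rw [hU k hk, hV k hk]
    refine ⟨V, ⟨fun k hk => ?_, hleadV⟩, fun j => ?_⟩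
    · have hk' : V k ∈ Submodule.span A (V '' Set.Iio (k + 1)) :=
        Submodule.subset_span ⟨k, by simp, rfl⟩
      rw [← hspan (k + 1) (by omega)] at hk'
      refine Submodule.span_le.2 ?_ hk'
      rintro _ ⟨i, hi, rfl⟩
      simp only [Set.mem_Iio] at hi
      exact hdeg i (by omega)
    · simp only [E]
      rw [image_Iic_eq_image_Iio, image_Iic_eq_image_Iio]
      exact hspan _ (by omega)
  · intro i j hij hjN
    have hspan : S.SpansFlag U E := fun j => rfl
    rw [hspan.wrLine_eq, hspan.wrLine_eq, hU _ (by omega), hU _ (by omega), hij]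
    obtain ⟨a, b, hab⟩ := hy.isCoprime (i + 1) (by omega)
    set I := Ideal.span ((Submodule.span A {S.K A (i + 1) * y (i + 1)} : Set A[X]) ∪
      Submodule.span A {S.K A (i + 1 + 1) * y (i + 1 + 1)})
    have h1 : S.K A (i + 1) * y (i + 1) ∈ I :=
      Ideal.subset_span (Or.inl (Submodule.mem_span_singleton_self _))
    have h2 : S.K A (i + 1 + 1) * y (i + 1 + 1) ∈ I :=
      Ideal.subset_span (Or.inr (Submodule.mem_span_singleton_self _))
    have h3 : S.K A (i + 1) * S.K A (i + 1 + 1) ∈ I := by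
      have : S.K A (i + 1) * S.K A (i + 1 + 1) =
          (a * S.K A (i + 1 + 1)) * (S.K A (i + 1) * y (i + 1)) +
          (b * S.K A (i + 1)) * (S.K A (i + 1 + 1) * y (i + 1 + 1)) := by
        linear_combination (-(S.K A (i + 1) * S.K A (i + 1 + 1))) * hab
      rw [this]
      exact I.add_mem (I.mul_mem_left _ h1) (I.mul_mem_left _ h2)
    let e : Fin S.n → ℕ := fun s => (S.ram (some s)).tail (i + 1) + (S.ram (some s)).tail (i + 1 + 1)
    refine ⟨∑ s, e s, ?_⟩
    rw [zProd_pow]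
    refine I.mem_of_dvd (S.zProd_dvd A fun s => ?_) (show S.zProd A e ∈ I from ?_)
    · rw [one_mul]; exact Finset.single_le_sum (fun _ _ => Nat.zero_le _) (Finset.mem_univ s)
    · rw [← zProd_mul]; exact h3

end ToFlags

/-! ### From flags to solutions -/

section ToSolutions

variable {A : Type} [CommRing A] [Algebra ℂ A]

variable {S} in
theorem IsAdapted.hasLead_seqWr {p : Option (Fin S.n)} {u : ℕ → A[X]} (h : S.IsAdapted p u) {k : ℕ}
    (hk : k ≤ S.N + 1) : ∃ c, IsUnit c ∧ HasLead (S.dir p) (S.sumExpo p k) c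
      (X ^ k.choose 2 * taylor (S.pt A p) (seqWr u k)) := by
  have h1 : ∀ j : Fin k, ∃ c, IsUnit c ∧
      HasLead (S.dir p) (S.expo p j) c (taylor (S.pt A p) (u j)) := fun j => h.lead j (by omega)
  choose c hc hl using h1
  have h2 := HasLead.wr (e := fun j : Fin k => S.expo p j) (fun i j hij => Fin.ext
    (S.expo_injOn p (show (i : ℕ) ≤ S.N by omega) (show (j : ℕ) ≤ S.N by omega) hij)) hc hl
  rw [← taylor_wr] at h2
  rw [sumExpo, Finset.sum_range]
  exact h2

variable {S} in
omit [Algebra ℂ A] in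
theorem SpansFlag.mem_span {u v : ℕ → A[X]} {E : Fin (S.N + 1) → Submodule A A[X]}
    (hu : S.SpansFlag u E) (hv : S.SpansFlag v E) {k : ℕ} (hk : k ≤ S.N + 1) {j : ℕ} (hj : j < k) :
    v j ∈ Submodule.span A (u '' Set.Iio k) := by
  have h1 : v j ∈ E ⟨j, by omega⟩ := by
    rw [hv]; exact Submodule.subset_span ⟨j, by simp, rfl⟩
  rw [hu] at h1
  refine Submodule.span_mono (Set.image_mono ?_) h1
  intro i hi
  simp only [Set.mem_Iic, Set.mem_Iio] at *
  omega

variable {S} in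
/-- The Wronskians of the steps of a point of `U` have the expected leading exponent at each marked
point, whichever bases are used to compute them. -/
theorem SpansFlag.hasLead_seqWr {u : ℕ → A[X]} {E : Fin (S.N + 1) → Submodule A A[X]}
    (hu : S.SpansFlag u E) (hE : S.IsUPoint E) (p : Option (Fin S.n)) {k : ℕ} (hk : k ≤ S.N + 1) :
    ∃ c, IsUnit c ∧ HasLead (S.dir p) (S.sumExpo p k) c
      (X ^ k.choose 2 * taylor (S.pt A p) (seqWr u k)) := by
  obtain ⟨v, hv, hvE⟩ := IsUPoint.exists_isAdapted S hE p
  obtain ⟨c, hc, hl⟩ := hv.hasLead_seqWr hk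
  obtain ⟨a, ha⟩ := seqWr_eq_smul_of_span_le v u k fun j hj => hvE.mem_span hu hk hj
  obtain ⟨a', ha'⟩ := seqWr_eq_smul_of_span_le u v k fun j hj => hu.mem_span hvE hk hj
  have h1 := hl.smul a
  rw [← mul_smul_comm, ← map_smul, ← ha] at h1
  refine ⟨_, ?_, h1⟩
  have h2 := h1.smul a'
  rw [← mul_smul_comm, ← map_smul, ← ha'] at h2
  have h3 := hl.coeff_eq.symm.trans h2.coeff_eq
  rw [h3] at hc
  exact isUnit_of_mul_isUnit_right hc

theorem zProd_dvd_of_coeff_taylor {e : Fin S.n → ℕ} {f : A[X]}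
    (h : ∀ s, ∀ k < e s, (taylor (algebraMap ℂ A (S.z s)) f).coeff k = 0) : S.zProd A e ∣ f := by
  refine Finset.prod_dvd_of_coprime (fun s _ s' _ hs => ?_) fun s _ =>
    pow_dvd_of_coeff_taylor (h s)
  exact (isCoprime_X_sub_C_of_isUnit_sub (S.isUnit_algebraMap_sub A hs)).pow

/-- A point of the open subscheme `U` has a basis adapted at infinity whose partial Wronskians are
monic. -/
theorem IsUPoint.exists_monic [Nontrivial A] {E : Fin (S.N + 1) → Submodule A A[X]}
    (hE : S.IsUPoint E) :
    ∃ U, S.SpansFlag U E ∧ ∀ k ≤ S.N + 1, (seqWr U k).Monic := by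
  classical
  obtain ⟨u, hu, huE⟩ := IsUPoint.exists_isAdapted S hE none
  have hunit : ∀ k ≤ S.N + 1, IsUnit (seqWr u k).leadingCoeff := by
    intro k hk
    obtain ⟨c, hc, hl⟩ := hu.hasLead_seqWr hk
    have hd := hl.natDegree_eq hc
    have h1 := hl.coeff_eq
    rw [← hd, coeff_natDegree, leadingCoeff_monic_mul (monic_X_pow _)] at h1
    rw [pt, taylor_zero] at h1
    rwa [h1]
  let c : ℕ → Aˣ := fun k => if h : IsUnit (seqWr u k).leadingCoeff then h.unit else 1
  have hc : ∀ k ≤ S.N + 1, (c k : A) = (seqWr u k).leadingCoeff := by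
    intro k hk
    simp [c, hunit k hk]
  -- the factors telescope in the Wronskians
  let U : ℕ → A[X] := fun j => ((c j / c (j + 1) : Aˣ) : A) • u j
  have hU : ∀ k, seqWr U k = ((c 0 / c k : Aˣ) : A) • seqWr u k := by
    intro k
    rw [seqWr_smul (fun j => ((c j / c (j + 1) : Aˣ) : A)), ← Units.coe_prod, Finset.prod_range_div']
  refine ⟨U, fun j => ?_, fun k hk => ?_⟩
  · rw [huE j]
    apply le_antisymm
    · refine Submodule.span_le.2 ?_
      rintro _ ⟨k, hk, rfl⟩
      have : u k = ((c (k + 1) / c k : Aˣ) : A) • U k := by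
        simp only [U]
        rw [smul_smul, ← Units.val_mul]
        simp
      rw [this]
      exact Submodule.smul_mem _ _ (Submodule.subset_span ⟨k, hk, rfl⟩)
    · refine Submodule.span_le.2 ?_
      rintro _ ⟨k, hk, rfl⟩
      exact Submodule.smul_mem _ _ (Submodule.subset_span ⟨k, hk, rfl⟩)
  · have h0 : c 0 = 1 := Units.ext (by rw [hc 0 (by omega)]; simp)
    rw [hU, h0, one_div, Monic]
    rw [leadingCoeff_smul_of_smul_regular _ ((c k)⁻¹.isUnit.isSMulRegular A), ← hc k hk,
      smul_eq_mul, Units.inv_mul]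

variable {S} in
theorem SpansFlag.K_dvd_seqWr {U : ℕ → A[X]} {E : Fin (S.N + 1) → Submodule A A[X]}
    (hU : S.SpansFlag U E) (hE : S.IsUPoint E) {k : ℕ} (hk : k ≤ S.N + 1) :
    S.K A k ∣ seqWr U k := by
  refine S.zProd_dvd_of_coeff_taylor fun s m hm => ?_
  obtain ⟨c, hc, hl⟩ := hU.hasLead_seqWr hE (some s) hk
  have h1 := hl.coeff_beyond (m + k.choose 2) (by
    rw [S.sumExpo_some s hk]
    simp only [Beyond, dir, Bool.false_eq_true, if_false]
    omega)
  rwa [coeff_X_pow_mul] at h1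

variable {S} in
/-- The Wronskian of `u_0, …, u_{t-1}, u_{t+1}` vanishes to the same order as the one of
`u_0, …, u_t`, as one sees from the leading term of its Wronskian with the latter. -/
theorem SpansFlag.K_dvd_seqWrWith {U : ℕ → A[X]} {E : Fin (S.N + 1) → Submodule A A[X]}
    (hU : S.SpansFlag U E) (hE : S.IsUPoint E) {t : ℕ} (ht : t + 1 ≤ S.N) :
    S.K A (t + 1) ∣ seqWrWith U t (U (t + 1)) := by
  set f := seqWrWith U t (U (t + 1)) with hf
  have h1 := seqWr_mul_seqWrWith U t (U (t + 1))
  rw [seqWrWith_self, ← hf] at h1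
  refine S.zProd_dvd_of_coeff_taylor fun s m hm => ?_
  obtain ⟨c₀, hc₀, hW₀⟩ := hU.hasLead_seqWr hE (some s) (show t ≤ S.N + 1 by omega)
  obtain ⟨c₁, hc₁, hW₁⟩ := hU.hasLead_seqWr hE (some s) (show t + 1 ≤ S.N + 1 by omega)
  obtain ⟨c₂, hc₂, hW₂⟩ := hU.hasLead_seqWr hE (some s) (show t + 1 + 1 ≤ S.N + 1 by omega)
  have hP := hW₀.mul hW₂
  rw [S.sumExpo_succ (some s) (t + 1), show S.sumExpo (some s) t +
    (S.sumExpo (some s) (t + 1) + S.expo (some s) (t + 1)) =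
    S.sumExpo (some s) (t + 1) + (S.sumExpo (some s) t + S.expo (some s) (t + 1)) by ring] at hP
  have heq : X * wronskian
      (X ^ (t + 1).choose 2 * taylor (S.pt A (some s)) (seqWr U (t + 1)))
      (X ^ (t + 1).choose 2 * taylor (S.pt A (some s)) f) =
      (X ^ t.choose 2 * taylor (S.pt A (some s)) (seqWr U t)) *
      (X ^ (t + 1 + 1).choose 2 * taylor (S.pt A (some s)) (seqWr U (t + 1 + 1))) := by
    rw [wronskian_mul_mul, ← taylor_wronskian, ← h1, taylor_mul,
      choose_two_succ (t + 1), choose_two_succ t]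
    ring
  obtain ⟨a₀, a, ha, hl⟩ := HasLead.exists_sub_smul hc₁ (hc₀.mul hc₂) hW₁ hP heq
  have e0 := S.expo_some s (show t ≤ S.N by omega)
  have e1 := S.expo_some s ht
  have e2 := (S.ram (some s)).entry_antitone
    (show S.N + 1 - (t + 1) ≤ S.N + 1 - t by omega)
  have e3 := S.sumExpo_some s (show t + 1 ≤ S.N + 1 by omega)
  have e4 := S.sumExpo_succ (some s) t
  have z1 := hl.coeff_beyond (m + (t + 1).choose 2) (by
    simp only [Beyond, dir, Bool.false_eq_true, if_false]
    omega)
  have z2 := hW₁.coeff_beyond (m + (t + 1).choose 2) (by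
    simp only [Beyond, dir, Bool.false_eq_true, if_false]
    omega)
  rw [coeff_sub, coeff_smul, z2, smul_zero, sub_zero, coeff_X_pow_mul] at z1
  exact z1

variable {S} in
theorem SpansFlag.natDegree_eq [Nontrivial A] {U : ℕ → A[X]}
    {E : Fin (S.N + 1) → Submodule A A[X]} (hU : S.SpansFlag U E) (hE : S.IsUPoint E) {k : ℕ}
    (hk : k ≤ S.N + 1) {y : A[X]} (hmon : y.Monic) (hy : seqWr U k = S.K A k * y) :
    (y.natDegree : ℤ) = S.l k := by
  obtain ⟨c, hc, hl⟩ := hU.hasLead_seqWr hE none hk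
  have h1 := hl.natDegree_eq hc
  rw [pt, taylor_zero, hy, (monic_X_pow _).natDegree_mul
    ((S.K_monic A k).mul hmon), natDegree_X_pow, (S.K_monic A k).natDegree_mul
    hmon, K, natDegree_zProd] at h1
  have h2 := S.l_add hk
  have h4 : ((∑ s, (S.ram (some s)).tail k : ℕ) : ℤ) = ∑ s, ((S.ram (some s)).tail k : ℤ) := by
    push_cast; rfl
  omega

variable {S} in
theorem SpansFlag.isUnit_eval {U : ℕ → A[X]} {E : Fin (S.N + 1) → Submodule A A[X]}
    (hU : S.SpansFlag U E) (hE : S.IsUPoint E) {k : ℕ} (hk : k ≤ S.N + 1) {y : A[X]}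
    (hy : seqWr U k = S.K A k * y) (s : Fin S.n) : IsUnit (y.eval (algebraMap ℂ A (S.z s))) := by
  obtain ⟨c, hc, hl⟩ := hU.hasLead_seqWr hE (some s) hk
  obtain ⟨q, hq, hu⟩ := S.zProd_eq_pow_mul A (fun s => (S.ram (some s)).tail k) s
  rw [hy, K, hq, mul_assoc, S.sumExpo_some s hk] at hl
  have h1 := ((hasLead_taylor_pow_mul (algebraMap ℂ A (S.z s)) ((S.ram (some s)).tail k)
    (q * y)).X_pow_mul (k.choose 2)).coeff_eq
  have h2 := hl.coeff_eq
  rw [pt] at h2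
  rw [← h2, h1, eval_mul] at hc
  exact isUnit_of_mul_isUnit_right hc

variable {S} in
/-- The condition on `Fl^o` allows common roots of the Wronskians at the `z_s`, but `y` has no roots
there. -/
theorem SpansFlag.isCoprime {U : ℕ → A[X]} {E : Fin (S.N + 1) → Submodule A A[X]}
    (hU : S.SpansFlag U E) (hE : E ∈ S.FlO A) {i : ℕ} (hi : i + 1 < S.N) {y y' : A[X]}
    (hy : seqWr U (i + 1) = S.K A (i + 1) * y) (hy' : seqWr U (i + 2) = S.K A (i + 2) * y') :
    IsCoprime y y' := by
  obtain ⟨m, hm⟩ := hE.2 ⟨i, by omega⟩ ⟨i + 1, by omega⟩ rfl hi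
  rw [hU.wrLine_eq, hU.wrLine_eq] at hm
  have hle : Ideal.span ((Submodule.span A {seqWr U (i + 1)} : Set A[X]) ∪
      Submodule.span A {seqWr U (i + 1 + 1)}) ≤ Ideal.span {y, y'} := by
    refine Ideal.span_le.2 (Set.union_subset ?_ ?_)
    · intro f hf
      obtain ⟨a, rfl⟩ := Submodule.mem_span_singleton.1 hf
      rw [hy, smul_eq_C_mul, ← mul_assoc]
      exact Ideal.mul_mem_left _ _ (Ideal.subset_span (by simp))
    · intro f hf
      obtain ⟨a, rfl⟩ := Submodule.mem_span_singleton.1 hf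
      rw [hy', smul_eq_C_mul, ← mul_assoc]
      exact Ideal.mul_mem_left _ _ (Ideal.subset_span (by simp))
  obtain ⟨a, b, hab⟩ := Ideal.mem_span_pair.1 (hle hm)
  have h2 := S.isCoprime_zProd A (hU.isUnit_eval hE.1 (by omega) hy) (fun s => 1 * m)
  rw [← zProd_pow, ← hab] at h2
  exact (IsCoprime.of_mul_add_right_right h2).of_mul_right_right

variable {S} in
/-- The Wronskian identity for `h = u_{t+1}`, divided by `K_{t+1}²`. -/
theorem SpansFlag.exists_wronskian_eq {U y : ℕ → A[X]} {E : Fin (S.N + 1) → Submodule A A[X]}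
    (hU : S.SpansFlag U E) (hE : S.IsUPoint E)
    (hy : ∀ k ≤ S.N + 1, seqWr U k = S.K A k * y k) {t : ℕ} (ht : t + 1 ≤ S.N) :
    ∃ g, wronskian (y (t + 1)) g = S.T A (t + 1) * y t * y (t + 2) := by
  obtain ⟨g, hg⟩ := hU.K_dvd_seqWrWith hE ht
  have h1 := seqWr_mul_seqWrWith U t (U (t + 1))
  rw [seqWrWith_self, hg, hy _ (by omega), hy _ (by omega), hy (t + 1) (by omega),
    wronskian_mul_mul] at h1
  refine ⟨g, ((S.K_monic A (t + 1)).pow 2).isRegular.left ?_⟩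
  change S.K A (t + 1) ^ 2 * wronskian (y (t + 1)) g =
    S.K A (t + 1) ^ 2 * (S.T A (t + 1) * y t * y (t + 2))
  rw [← h1]
  linear_combination y t * y (t + 2) * S.K_mul_K A ht

/-- The Wronskians of a point of `Fl^o`, divided by the `K_i`, form a solution. -/
theorem exists_isSolution_of_mem_FlO [Nontrivial A] {E : Fin (S.N + 1) → Submodule A A[X]}
    (hE : E ∈ S.FlO A) :
    ∃ y U, S.IsSolution y ∧ S.SpansFlag U E ∧ ∀ k ≤ S.N + 1, seqWr U k = S.K A k * y k := by
  obtain ⟨U, hU, hmon⟩ := IsUPoint.exists_monic S hE.1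
  have hdvd : ∀ k, ∃ y, k ≤ S.N + 1 → seqWr U k = S.K A k * y := by
    intro k
    by_cases hk : k ≤ S.N + 1
    · obtain ⟨y, hy⟩ := hU.K_dvd_seqWr hE.1 hk
      exact ⟨y, fun _ => hy⟩
    · exact ⟨0, fun h => absurd h hk⟩
  choose y hy using hdvd
  have hymon : ∀ k ≤ S.N + 1, (y k).Monic := fun k hk =>
    (S.K_monic A k).of_mul_monic_left (hy k hk ▸ hmon k hk)
  have hdeg : ∀ k ≤ S.N + 1, ((y k).natDegree : ℤ) = S.l k := fun k hk =>
    hU.natDegree_eq hE.1 hk (hymon k hk) (hy k hk)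
  have heval : ∀ k ≤ S.N + 1, ∀ s, IsUnit ((y k).eval (algebraMap ℂ A (S.z s))) := fun k hk =>
    hU.isUnit_eval hE.1 hk (hy k hk)
  have hone : ∀ k ≤ S.N + 1, S.l k = 0 → y k = 1 := by
    intro k hk h0
    have := hdeg k hk
    rw [h0] at this
    exact (hymon k hk).natDegree_eq_zero.1 (by exact_mod_cast this)
  have hy0 : y 0 = 1 := hone 0 (by omega) S.l_zero
  have hyN : y (S.N + 1) = 1 := hone _ le_rfl S.l_last
  have hcop : ∀ i ≤ S.N, IsCoprime (y i) (y (i + 1)) := by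
    intro i hi
    rcases hi.eq_or_lt with rfl | hlt
    · rw [hyN]; exact isCoprime_one_right
    cases i with
    | zero => rw [hy0]; exact isCoprime_one_left
    | succ i => exact hU.isCoprime hE hlt (hy _ (by omega)) (hy _ (by omega))
  refine ⟨y, U, ⟨hy0, hyN, hymon, hdeg, heval, hcop, ?_, ?_⟩, hU, hy⟩
  · intro i hi
    rcases hi.eq_or_lt with rfl | hlt
    · rw [hyN]; exact isCoprime_one_left
    cases i with
    | zero => rw [hy0]; exact isCoprime_one_left
    | succ t =>
      obtain ⟨g, hg⟩ := hU.exists_wronskian_eq hE.1 hy (show t + 1 ≤ S.N by omega)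
      -- `T y_t y_{t+2}` is prime to `y_{t+1}` and equals `-y_{t+1}' g` modulo `y_{t+1}`
      have h1 : IsCoprime (y (t + 1)) (S.T A (t + 1) * y t * y (t + 2)) :=
        ((S.isCoprime_zProd A (heval (t + 1) (by omega)) _).mul_right
          (hcop t (by omega)).symm).mul_right (hcop (t + 1) (by omega))
      have h2 : S.T A (t + 1) * y t * y (t + 2) =
          y (t + 1) * derivative g + derivative (y (t + 1)) * (-g) := by
        rw [← hg, wronskian]; ring
      rw [h2] at h1
      exact (IsCoprime.of_mul_add_left_right h1).of_mul_right_left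
  · intro i hi
    obtain ⟨g, hg⟩ := hU.exists_wronskian_eq hE.1 hy hi
    rw [← hg]
    exact dvd_wronskian_derivative_wronskian _ _

end ToSolutions

end BasicSituation

/-! ### Lines of polynomials -/

section Lines

variable {A : Type} [CommRing A]

/-- The line spanned by a monic polynomial of degree `m` is a subbundle. -/
theorem isSubbundle_span_singleton {y : A[X]} (hy : y.Monic) {m : ℕ} (hm : y.natDegree = m) :
    IsSubbundle (m + 1) 1 (Submodule.span A {y}) := by
  classical
  have hdeg : y ∈ degreeLT A (m + 1) := by
    rw [mem_degreeLT]
    refine lt_of_le_of_lt degree_le_natDegree ?_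
    rw [hm]
    exact_mod_cast Nat.lt_succ_self m
  have ht : IsTriangular (degreeLT A (m + 1)) (m + 1) (fun k => lcoeff A k)
      fun k => if k = m then y else X ^ k := by
    constructor
    · intro f hf h
      ext k
      by_cases hk : k < m + 1
      · exact h k hk
      · rw [mem_degreeLT, degree_lt_iff_coeff_zero] at hf
        exact hf k (by omega)
    · intro k hk
      by_cases hkm : k = m
      · rw [if_pos hkm]; exact hdeg
      · rw [if_neg hkm, mem_degreeLT]
        exact lt_of_le_of_lt (degree_X_pow_le k) (by exact_mod_cast hk)
    · intro k hk
      by_cases hkm : k = m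
      · rw [if_pos hkm, lcoeff_apply, hkm, ← hm, coeff_natDegree, hy]; exact isUnit_one
      · rw [if_neg hkm, lcoeff_apply, coeff_X_pow, if_pos rfl]; exact isUnit_one
    · intro k hk j hj hkj
      rw [if_neg (by omega), lcoeff_apply, coeff_X_pow, if_neg (by omega)]
  have hQ := ht.coordFlag_eq le_rfl
  rw [coordFlag_top] at hQ
  have hspan : Submodule.span A {y} =
      Submodule.span A ((fun k => if k = m then y else X ^ k) '' {m}) := by
    simp
  have hsub : ({m} : Set ℕ) ⊆ Set.Iio (m + 1) := by simp
  refine ⟨?_, ?_, fun q => ?_⟩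
  · rw [Submodule.span_singleton_le_iff_mem]; exact hdeg
  · rw [hspan, hQ]
    exact projective_quotient_span_image hsub ht.linearIndepOn
  · rw [hspan, rankAtStalk_span_image (Set.finite_singleton m) (ht.linearIndepOn.mono hsub)]
    simp

/-- A line subbundle of the polynomials of degree at most `m` on which the coefficient of `x ^ m`
is surjective is spanned by a monic polynomial of degree `m`. -/
theorem exists_monic_of_isSubbundle [Nontrivial A] {m : ℤ} {L : Submodule A A[X]}
    (hL : IsSubbundle (m + 1).toNat 1 L) (hlead : L.map (lcoeff A m.toNat) = ⊤) :
    ∃ y : A[X], y.Monic ∧ (y.natDegree : ℤ) = m ∧ L = Submodule.span A {y} := by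
  have h1 : (1 : A) ∈ L.map (lcoeff A m.toNat) := hlead ▸ Submodule.mem_top
  obtain ⟨y, hy, hy1⟩ := h1
  have hdeg := hL.1 hy
  rw [mem_degreeLT, degree_lt_iff_coeff_zero] at hdeg
  have hm : 0 ≤ m := by
    by_contra hneg
    have := hdeg m.toNat (by omega)
    rw [lcoeff_apply, this] at hy1
    exact zero_ne_one hy1
  obtain ⟨m, rfl⟩ := Int.eq_ofNat_of_zero_le hm
  rw [show (((m : ℤ) + 1).toNat) = m + 1 by omega] at hdeg
  rw [Int.toNat_natCast, lcoeff_apply] at hy1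
  have hle : y.natDegree ≤ m := natDegree_le_iff_coeff_eq_zero.2 fun k hk => hdeg k (by omega)
  have hmon : y.Monic := monic_of_natDegree_le_of_coeff_eq_one m hle hy1
  have hnat : y.natDegree = m :=
    le_antisymm hle (le_natDegree_of_ne_zero (by rw [hy1]; exact one_ne_zero))
  refine ⟨y, hmon, by rw [hnat], ?_⟩
  obtain ⟨hfin, hproj⟩ := hL.finite_and_projective
  have h2 := eq_span_of_rankAtStalk_eq L (r := 1) hL.2.2 (fun _ => y) (fun _ => hy)
    (LinearMap.pi fun _ => lcoeff A m) (by
      rw [eq_top_iff]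
      intro a _
      refine ⟨a 0 • y, Submodule.smul_mem _ _ (Submodule.subset_span ⟨0, rfl⟩), ?_⟩
      funext i
      rw [LinearMap.pi_apply, map_smul, lcoeff_apply, hy1, smul_eq_mul, mul_one,
        Subsingleton.elim i 0])
  rw [h2, Set.range_const]

theorem span_union_span_eq_top_iff {f g : A[X]} :
    Ideal.span ((Submodule.span A {f} : Set A[X]) ∪ Submodule.span A {g}) = ⊤ ↔
      IsCoprime f g := by
  have : Ideal.span ((Submodule.span A {f} : Set A[X]) ∪ Submodule.span A {g}) =
      Ideal.span {f, g} := by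
    apply le_antisymm
    · refine Ideal.span_le.2 (Set.union_subset ?_ ?_)
      · intro h hh
        obtain ⟨a, rfl⟩ := Submodule.mem_span_singleton.1 hh
        rw [smul_eq_C_mul]
        exact Ideal.mul_mem_left _ _ (Ideal.subset_span (by simp))
      · intro h hh
        obtain ⟨a, rfl⟩ := Submodule.mem_span_singleton.1 hh
        rw [smul_eq_C_mul]
        exact Ideal.mul_mem_left _ _ (Ideal.subset_span (by simp))
    · refine Ideal.span_mono ?_
      rintro h (rfl | rfl)
      · exact Or.inl (Submodule.mem_span_singleton_self _)
      · exact Or.inr (Submodule.mem_span_singleton_self _)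
  rw [this, Ideal.eq_top_iff_one, Ideal.mem_span_pair]
  rfl

theorem derivative_image_span (f : A[X]) :
    derivative '' (Submodule.span A {f} : Set A[X]) = Submodule.span A {derivative f} := by
  have h := Submodule.map_span (derivative : A[X] →ₗ[A] A[X]) {f}
  rw [Set.image_singleton] at h
  rw [← h]
  rfl

theorem map_span_singleton_eq_top_iff (φ : A[X] →ₗ[A] A) (f : A[X]) :
    (Submodule.span A {f}).map φ = ⊤ ↔ IsUnit (φ f) := by
  rw [Submodule.map_span, Set.image_singleton]
  exact Ideal.span_singleton_eq_top

theorem map_mulLeft_injective {K : A[X]} (hK : K.Monic) :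
    Function.Injective (Submodule.map (LinearMap.mulLeft A K)) :=
  Submodule.map_injective_of_injective fun _ _ h => hK.isRegular.left h

theorem eq_of_span_singleton_eq [Nontrivial A] {f g : A[X]} (hf : f.Monic) (hg : g.Monic)
    (h : Submodule.span A {f} = Submodule.span A {g}) : f = g := by
  have h1 : f ∈ Submodule.span A {g} := h ▸ Submodule.mem_span_singleton_self _
  have h2 : g ∈ Submodule.span A {f} := h ▸ Submodule.mem_span_singleton_self _
  obtain ⟨a, rfl⟩ := Submodule.mem_span_singleton.1 h1
  obtain ⟨b, hb⟩ := Submodule.mem_span_singleton.1 h2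
  have h3 : b * a = 1 := by
    have := congrArg (fun p : A[X] => p.coeff g.natDegree) hb
    simpa [smul_smul, hg.coeff_natDegree] using this
  have ha : IsUnit a := IsUnit.of_mul_eq_one b (by rw [mul_comm, h3])
  have h4 := hf.leadingCoeff
  rw [leadingCoeff_smul_of_smul_regular _ (ha.isSMulRegular A), hg.leadingCoeff, smul_eq_mul,
    mul_one] at h4
  rw [h4, one_smul]

theorem baseChange_span {B : Type} [CommRing B] (φ : A →+* B) (s : Set A[X]) :
    baseChange φ (Submodule.span A s) = Submodule.span B (Polynomial.map φ '' s) := by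
  apply le_antisymm
  · refine Submodule.span_le.2 ?_
    rintro _ ⟨f, hf, rfl⟩
    induction hf using Submodule.span_induction with
    | mem x hx => exact Submodule.subset_span ⟨x, hx, rfl⟩
    | zero => rw [Polynomial.map_zero]; exact Submodule.zero_mem _
    | add x y _ _ hx hy => rw [Polynomial.map_add]; exact Submodule.add_mem _ hx hy
    | smul a x _ hx =>
      rw [smul_eq_C_mul, Polynomial.map_mul, map_C, ← smul_eq_C_mul]
      exact Submodule.smul_mem _ _ hx
  · exact Submodule.span_mono (Set.image_mono Submodule.subset_span)

end Lines

namespace BasicSituation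

variable (S : BasicSituation)

/-! ### Points of `𝒜` and solutions -/

section Points

variable {A : Type} [CommRing A] [Algebra ℂ A]

/-- The lines of the tuple `L` are spanned by `y_1, …, y_N`. -/
def SpansLines (y : ℕ → A[X]) (L : Fin S.N → Submodule A A[X]) : Prop :=
  ∀ j : Fin S.N, L j = Submodule.span A {y (j + 1)}

variable {S}

omit [Algebra ℂ A] in
theorem SpansLines.line_eq {y : ℕ → A[X]} {L : Fin S.N → Submodule A A[X]}
    (h : S.SpansLines y L) (h0 : y 0 = 1) (hN : y (S.N + 1) = 1) {i : ℕ} (hi : i ≤ S.N + 1) :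
    S.line L i = Submodule.span A {y i} := by
  unfold line
  split_ifs with hc
  · rw [h]
    congr 3
    simp only
    omega
  · have : i = 0 ∨ i = S.N + 1 := by omega
    rcases this with rfl | rfl
    · rw [h0]
    · rw [hN]

theorem IsSolution.mem_AA {y : ℕ → A[X]} (hy : S.IsSolution y)
    {L : Fin S.N → Submodule A A[X]} (hL : S.SpansLines y L) : L ∈ S.AA A := by
  refine ⟨⟨fun j => ?_, fun j => ?_, fun j s => ?_, fun i j hij => ?_, fun j => ?_⟩, ?_⟩
  · have h1 := hy.natDegree (j + 1) (by omega)
    rw [hL]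
    have h2 := isSubbundle_span_singleton (hy.monic (j + 1) (by omega)) rfl
    rwa [show (S.l (j + 1) + 1).toNat = (y (j + 1)).natDegree + 1 by omega]
  · have h1 := hy.natDegree (j + 1) (by omega)
    rw [hL, map_span_singleton_eq_top_iff, lcoeff_apply, ← h1, Int.toNat_natCast, coeff_natDegree,
      hy.monic _ (by omega)]
    exact isUnit_one
  · rw [hL, map_span_singleton_eq_top_iff]
    exact hy.isUnit_eval _ (by omega) s
  · rw [hL, hL, span_union_span_eq_top_iff, hij]
    exact hy.isCoprime _ (by omega)
  · rw [hL, derivative_image_span, span_union_span_eq_top_iff]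
    exact hy.isCoprime_derivative _ (by omega)
  · intro i hi hiN f hf v hv w hw
    obtain ⟨i, rfl⟩ := Nat.exists_eq_add_of_le' hi
    rw [hL.line_eq hy.zero hy.last (by omega)] at hf hv hw
    obtain ⟨a, rfl⟩ := Submodule.mem_span_singleton.1 hf
    obtain ⟨b, rfl⟩ := Submodule.mem_span_singleton.1 hv
    obtain ⟨c, rfl⟩ := Submodule.mem_span_singleton.1 hw
    obtain ⟨q, hq⟩ := hy.dvd i hiN
    refine ⟨C (b * c) * q, ?_⟩
    rw [Nat.add_sub_cancel]
    have : wronskian (derivative (a • y (i + 1)))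
        (S.T A (i + 1) * b • y i * c • y (i + 1 + 1)) = C (a * (b * c)) *
        wronskian (derivative (y (i + 1))) (S.T A (i + 1) * y i * y (i + 2)) := by
      simp only [wronskian, smul_eq_C_mul, derivative_mul, derivative_C, zero_mul, zero_add, C_mul]
      ring
    rw [this, hq, smul_eq_C_mul, C_mul]
    ring

/-- The monic generators of the lines of a point of `𝒜` form a solution. -/
theorem exists_isSolution_of_mem_AA [Nontrivial A] {L : Fin S.N → Submodule A A[X]}
    (hL : L ∈ S.AA A) : ∃ y, S.IsSolution y ∧ S.SpansLines y L := by
  obtain ⟨⟨h1, h2, h3, h4, h5⟩, h6⟩ := hL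
  choose v hv using fun j => exists_monic_of_isSubbundle (h1 j) (h2 j)
  let y : ℕ → A[X] := fun i => if h : 1 ≤ i ∧ i ≤ S.N then v ⟨i - 1, by omega⟩ else 1
  have hy : ∀ j : Fin S.N, y (j + 1) = v j := by
    intro j
    have : 1 ≤ (j : ℕ) + 1 ∧ (j : ℕ) + 1 ≤ S.N := by omega
    simp only [y, dif_pos this]
    rfl
  have hy0 : y 0 = 1 := by simp [y]
  have hyN : y (S.N + 1) = 1 := by simp [y]
  have hspan : S.SpansLines y L := fun j => by rw [hy]; exact (hv j).2.2
  -- the entries outside `1, …, N` are `1`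
  have hcases : ∀ P : ℕ → Prop, P 0 → P (S.N + 1) → (∀ j : Fin S.N, P (j + 1)) →
      ∀ i ≤ S.N + 1, P i := by
    intro P hP0 hPN hPj i hi
    by_cases h0 : i = 0
    · rw [h0]; exact hP0
    by_cases hN : i = S.N + 1
    · rw [hN]; exact hPN
    have := hPj ⟨i - 1, by omega⟩
    rwa [show i - 1 + 1 = i by omega] at this
  refine ⟨y, ⟨hy0, hyN, ?_, ?_, ?_, ?_, ?_, ?_⟩, hspan⟩
  · refine hcases _ (by rw [hy0]; exact monic_one) (by rw [hyN]; exact monic_one) fun j => ?_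
    rw [hy]; exact (hv j).1
  · refine hcases _ (by rw [hy0, S.l_zero]; simp) (by rw [hyN, S.l_last]; simp) fun j => ?_
    rw [hy]; exact (hv j).2.1
  · refine hcases _ (by intro s; rw [hy0]; simp) (by intro s; rw [hyN]; simp) fun j s => ?_
    have := h3 j s
    rwa [hspan, map_span_singleton_eq_top_iff] at this
  · intro i hi
    rcases hi.eq_or_lt with rfl | hlt
    · rw [hyN]; exact isCoprime_one_right
    cases i with
    | zero => rw [hy0]; exact isCoprime_one_left
    | succ i =>
      have := h4 ⟨i, by omega⟩ ⟨i + 1, hlt⟩ rfl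
      rwa [hspan, hspan, span_union_span_eq_top_iff] at this
  · refine hcases _ (by rw [hy0]; exact isCoprime_one_left) (by rw [hyN]; exact isCoprime_one_left)
      fun j => ?_
    have := h5 j
    rwa [hspan, derivative_image_span, span_union_span_eq_top_iff] at this
  · intro i hi
    refine h6 (i + 1) (by omega) hi _ ?_ _ ?_ _ ?_
    · rw [hspan.line_eq hy0 hyN (by omega)]; exact Submodule.mem_span_singleton_self _
    · rw [hspan.line_eq hy0 hyN (by omega)]; exact Submodule.mem_span_singleton_self _
    · rw [hspan.line_eq hy0 hyN (by omega)]; exact Submodule.mem_span_singleton_self _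

variable (S) in
/-- The graph of the Wronskian map on `A`-points: `K_i y_i = Wr(E_i)`. -/
def WronskiRel (E : Fin (S.N + 1) → Submodule A A[X]) (L : Fin S.N → Submodule A A[X]) : Prop :=
  ∀ i : Fin S.N, (L i).map (LinearMap.mulLeft A (S.K A (i + 1))) = wrLine (i + 1) (E i.castSucc)

/-- If `W_k = K_k y_k`, then the flag and the tuple of lines are related by the Wronskian map. -/
theorem SpansFlag.wronskiRel {U y : ℕ → A[X]} {E : Fin (S.N + 1) → Submodule A A[X]}
    {L : Fin S.N → Submodule A A[X]} (hU : S.SpansFlag U E) (hL : S.SpansLines y L)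
    (h : ∀ k ≤ S.N + 1, seqWr U k = S.K A k * y k) : S.WronskiRel E L := by
  intro i
  have h1 := hU.wrLine_eq i.castSucc
  rw [Fin.val_castSucc] at h1
  rw [h1, hL, Submodule.map_span, Set.image_singleton, h _ (by omega)]
  rfl

omit [Algebra ℂ A] in
theorem subsingleton_submodule [Subsingleton A] : Subsingleton (Submodule A A[X]) :=
  ⟨fun M M' => by ext x; rw [Subsingleton.elim x 0]; simp⟩

theorem mem_FlO_of_subsingleton [Subsingleton A] (E : Fin (S.N + 1) → Submodule A A[X]) :
    E ∈ S.FlO A := by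
  have := subsingleton_submodule (A := A)
  have hp : ∀ (M : Type) [AddCommGroup M] [Module A M], Module.Projective A M := fun M _ _ => by
    have : Subsingleton M := Module.subsingleton A M
    infer_instance
  have hq : ∀ p : PrimeSpectrum A, False := fun p =>
    not_subsingleton_iff_nontrivial.2 p.nontrivial inferInstance
  have hsub : ∀ (m k : ℕ) (V : Submodule A A[X]), IsSubbundle m k V := fun m k V =>
    ⟨(Subsingleton.elim _ _).le, hp _, fun p => (hq p).elim⟩
  refine ⟨⟨⟨fun _ _ _ => (Subsingleton.elim _ _).le, fun j => hsub _ _ _, hsub _ _ _,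
    fun p ℓ u _ _ _ => ⟨hp _, fun p => (hq p).elim⟩⟩, fun p j => Subsingleton.elim _ _⟩,
    fun i j _ _ => ?_⟩
  rw [Subsingleton.elim (S.zProd A fun _ => 1) 0]
  exact Ideal.zero_mem _

theorem mem_AA_of_subsingleton [Subsingleton A] (L : Fin S.N → Submodule A A[X]) :
    L ∈ S.AA A := by
  have := subsingleton_submodule (A := A)
  have hp : ∀ (M : Type) [AddCommGroup M] [Module A M], Module.Projective A M := fun M _ _ => by
    have : Subsingleton M := Module.subsingleton A M
    infer_instance
  have hq : ∀ p : PrimeSpectrum A, False := fun p =>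
    not_subsingleton_iff_nontrivial.2 p.nontrivial inferInstance
  have hA : ∀ M : Submodule A A, M = ⊤ := fun M => by
    rw [eq_top_iff]; intro x _; rw [Subsingleton.elim x 0]; exact M.zero_mem
  have hI : ∀ M : Ideal A[X], M = ⊤ := fun M => by
    rw [eq_top_iff]; intro x _; rw [Subsingleton.elim x 0]; exact M.zero_mem
  refine ⟨⟨fun j => ⟨(Subsingleton.elim _ _).le, hp _, fun p => (hq p).elim⟩, fun j => hA _,
    fun j s => hA _, fun i j _ => hI _, fun j => hI _⟩, fun i _ _ y _ v _ w _ => ?_⟩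
  rw [Subsingleton.elim (wronskian _ _) 0]
  exact dvd_zero y

/-- Over every algebra the Wronskian map takes points of `Fl^o` to points of `𝒜`. -/
theorem exists_wronskiRel_of_mem_FlO {E : Fin (S.N + 1) → Submodule A A[X]} (hE : E ∈ S.FlO A) :
    ∃ L ∈ S.AA A, S.WronskiRel E L := by
  rcases subsingleton_or_nontrivial A with h | h
  · have := subsingleton_submodule (A := A)
    exact ⟨fun _ => ⊥, mem_AA_of_subsingleton _, fun _ => Subsingleton.elim _ _⟩
  · obtain ⟨y, U, hy, hU, hUy⟩ := S.exists_isSolution_of_mem_FlO hE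
    have hL : S.SpansLines y (fun j => Submodule.span A {y (j + 1)}) := fun _ => rfl
    exact ⟨_, hy.mem_AA hL, hU.wronskiRel hL hUy⟩

/-- Over every algebra the Wronskian map is surjective on points. -/
theorem exists_wronskiRel_of_mem_AA {L : Fin S.N → Submodule A A[X]} (hL : L ∈ S.AA A) :
    ∃ E ∈ S.FlO A, S.WronskiRel E L := by
  rcases subsingleton_or_nontrivial A with h | h
  · have := subsingleton_submodule (A := A)
    exact ⟨fun _ => ⊥, mem_FlO_of_subsingleton _, fun _ => Subsingleton.elim _ _⟩
  · obtain ⟨y, hy, hyL⟩ := exists_isSolution_of_mem_AA hL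
    obtain ⟨E, hE, U, hU, hUy⟩ := hy.exists_mem_FlO
    exact ⟨E, hE, hU.wronskiRel hyL hUy⟩

/-- The values of the Wronskian map are unique, as the `K_i` are monic. -/
theorem WronskiRel.right_unique {E : Fin (S.N + 1) → Submodule A A[X]}
    {L L' : Fin S.N → Submodule A A[X]} (h : S.WronskiRel E L) (h' : S.WronskiRel E L') :
    L = L' :=
  funext fun i => map_mulLeft_injective (S.K_monic A _) ((h i).trans (h' i).symm)

/-- Over every algebra the Wronskian map is injective on points. -/
theorem WronskiRel.left_unique {E E' : Fin (S.N + 1) → Submodule A A[X]}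
    {L : Fin S.N → Submodule A A[X]} (hE : E ∈ S.FlO A) (hE' : E' ∈ S.FlO A)
    (h : S.WronskiRel E L) (h' : S.WronskiRel E' L) : E = E' := by
  rcases subsingleton_or_nontrivial A with hA | hA
  · have := subsingleton_submodule (A := A)
    exact Subsingleton.elim _ _
  · obtain ⟨y, U, hy, hU, hUy⟩ := S.exists_isSolution_of_mem_FlO hE
    obtain ⟨y', U', hy', hU', hUy'⟩ := S.exists_isSolution_of_mem_FlO hE'
    have hmon : ∀ k ≤ S.N + 1, (S.K A k * y k).Monic := fun k hk =>
      (S.K_monic A k).mul (hy.monic k hk)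
    have hmon' : ∀ k ≤ S.N + 1, (S.K A k * y' k).Monic := fun k hk =>
      (S.K_monic A k).mul (hy'.monic k hk)
    refine hU.eq_of_seqWr_eq hU' (fun k hk => hUy k hk ▸ hmon k hk) fun k hk => ?_
    rw [hUy k hk, hUy' k hk]
    by_cases h0 : k = 0
    · rw [h0, hy.zero, hy'.zero]
    by_cases hN : k = S.N + 1
    · rw [hN, hy.last, hy'.last]
    obtain ⟨i, rfl⟩ := Nat.exists_eq_succ_of_ne_zero h0
    refine eq_of_span_singleton_eq (hmon _ hk) (hmon' _ hk) ?_
    have h1 := (h ⟨i, by omega⟩).symm.trans (h' ⟨i, by omega⟩)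
    have h2 := hU.wrLine_eq (Fin.castSucc ⟨i, by omega⟩)
    have h3 := hU'.wrLine_eq (Fin.castSucc ⟨i, by omega⟩)
    rw [Fin.val_castSucc] at h2 h3
    rw [h2, h3, hUy _ (by simp only; omega), hUy' _ (by simp only; omega)] at h1
    exact h1

end Points

/-! ### Base change -/

section BaseChange

variable {A B : Type} [CommRing A] [Algebra ℂ A] [CommRing B] [Algebra ℂ B] (φ : A →ₐ[ℂ] B)

theorem map_zProd (e : Fin S.n → ℕ) : (S.zProd A e).map (φ : A →+* B) = S.zProd B e := by
  simp [zProd, Polynomial.map_prod]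

omit [Algebra ℂ A] [Algebra ℂ B] in
theorem map_wronskian (ψ : A →+* B) (f g : A[X]) :
    (wronskian f g).map ψ = wronskian (f.map ψ) (g.map ψ) := by
  simp [wronskian, derivative_map]

omit [Algebra ℂ A] [Algebra ℂ B] in
theorem map_seqWr (ψ : A →+* B) (u : ℕ → A[X]) (k : ℕ) :
    (seqWr u k).map ψ = seqWr (fun j => (u j).map ψ) k :=
  map_wr (mapRingHom ψ) (fun f => (derivative_map f ψ).symm) _

variable {S}

theorem IsSolution.map [Nontrivial B] {y : ℕ → A[X]} (hy : S.IsSolution y) :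
    S.IsSolution fun i => (y i).map (φ : A →+* B) where
  zero := by rw [hy.zero, Polynomial.map_one]
  last := by rw [hy.last, Polynomial.map_one]
  monic i hi := (hy.monic i hi).map _
  natDegree i hi := by rw [(hy.monic i hi).natDegree_map, hy.natDegree i hi]
  isUnit_eval i hi s := by
    have h := (hy.isUnit_eval i hi s).map (φ : A →+* B)
    rw [← eval_map_apply] at h
    simpa using h
  isCoprime i hi := (hy.isCoprime i hi).map (mapRingHom (φ : A →+* B))
  isCoprime_derivative i hi := by
    have := (hy.isCoprime_derivative i hi).map (mapRingHom (φ : A →+* B))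
    simpa [derivative_map] using this
  dvd i hi := by
    have h := _root_.map_dvd (mapRingHom (φ : A →+* B)) (hy.dvd i hi)
    rw [coe_mapRingHom, map_wronskian, Polynomial.map_mul, Polynomial.map_mul,
      ← derivative_map] at h
    rwa [T, map_zProd] at h

/-- The points of `Fl^o` and of `𝒜` that correspond to each other under the Wronskian map are stable
under base change. For `Fl^o` this follows from the case of solutions: the base change of the flag
has the same Wronskians as the flag of the base changed solution. -/
theorem WronskiRel.baseChange {E : Fin (S.N + 1) → Submodule A A[X]}
    {L : Fin S.N → Submodule A A[X]} (hE : E ∈ S.FlO A) (h : S.WronskiRel E L) :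
    (fun i => baseChange (φ : A →+* B) (E i)) ∈ S.FlO B ∧
      (fun i => WronskiMap.baseChange (φ : A →+* B) (L i)) ∈ S.AA B ∧
      S.WronskiRel (fun i => WronskiMap.baseChange (φ : A →+* B) (E i))
        (fun i => WronskiMap.baseChange (φ : A →+* B) (L i)) := by
  rcases subsingleton_or_nontrivial B with hB | hB
  · have := subsingleton_submodule (A := B)
    exact ⟨mem_FlO_of_subsingleton _, mem_AA_of_subsingleton _, fun _ => Subsingleton.elim _ _⟩
  have hA : Nontrivial A := (φ : A →+* B).domain_nontrivial
  obtain ⟨y, U, hy, hU, hUy⟩ := S.exists_isSolution_of_mem_FlO hE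
  have hyL : S.SpansLines y L := by
    have hL' : S.SpansLines y (fun j => Submodule.span A {y (j + 1)}) := fun _ => rfl
    have := h.right_unique (hU.wronskiRel hL' hUy)
    exact fun j => congrFun this j
  have hyB := hy.map φ
  have hUB : S.SpansFlag (fun j => (U j).map (φ : A →+* B))
      (fun i => WronskiMap.baseChange (φ : A →+* B) (E i)) := by
    intro j
    simp only
    rw [hU j, baseChange_span, ← Set.image_comp]
    rfl
  have hLB : S.SpansLines (fun j => (y j).map (φ : A →+* B))
      (fun i => WronskiMap.baseChange (φ : A →+* B) (L i)) := by
    intro j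
    simp only
    rw [hyL j, baseChange_span, Set.image_singleton]
  have hUyB : ∀ k ≤ S.N + 1, seqWr (fun j => (U j).map (φ : A →+* B)) k =
      S.K B k * (y k).map (φ : A →+* B) := by
    intro k hk
    rw [← map_seqWr, hUy k hk, Polynomial.map_mul, K, map_zProd]
    rfl
  refine ⟨?_, hyB.mem_AA hLB, hUB.wronskiRel hLB hUyB⟩
  obtain ⟨E', hE', U', hU', hUy'⟩ := hyB.exists_mem_FlO
  have : E' = fun i => WronskiMap.baseChange (φ : A →+* B) (E i) := by
    refine hU'.eq_of_seqWr_eq hUB (fun k hk => ?_) fun k hk => by rw [hUy' k hk, hUyB k hk]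
    rw [hUy' k hk]
    exact (S.K_monic B k).mul (hyB.monic k hk)
  exact this ▸ hE'

end BaseChange

/-! ### The coordinate algebra of `𝒜` -/

/-- The pairs `(i, k)` with `0 ≤ i ≤ N + 1` and `0 ≤ k < l_i`. -/
abbrev CoeffIndex : Type :=
  {q : Σ _ : ℕ, ℕ //
    q ∈ (Finset.range (S.N + 2)).sigma fun i => Finset.range (S.l i).toNat}

/-- The polynomial ring whose variables are, for each `(i, k)`, the coefficients of `x^k` in a
monic polynomial `y_i` of degree `l_i` (marked `false`) and in a polynomial `r_i` of degree `< l_i`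
(marked `true`). -/
abbrev CoeffRing : Type := MvPolynomial (Bool × S.CoeffIndex) ℂ

/-- The polynomial of degree `< l_i` whose coefficients are variables, for `i ≤ N + 1`. (It is `0`
for other `i`.) -/
noncomputable def genericPoly (b : Bool) (i : ℕ) : S.CoeffRing[X] :=
  ∑ k ∈ Finset.range (S.l i).toNat, C (if h : (⟨i, k⟩ : Σ _ : ℕ, ℕ) ∈
    (Finset.range (S.N + 2)).sigma fun i => Finset.range (S.l i).toNat then
      MvPolynomial.X (b, ⟨_, h⟩) else 0) * X ^ k

/-- The monic polynomial `y_i` of degree `l_i` whose lower coefficients are variables. -/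
noncomputable def genericY (i : ℕ) : S.CoeffRing[X] :=
  X ^ (S.l i).toNat + S.genericPoly false i

theorem degree_genericPoly_lt (b : Bool) (i : ℕ) :
    (S.genericPoly b i).degree < ((S.l i).toNat : WithBot ℕ) := by
  refine (degree_sum_le _ _).trans_lt ((Finset.sup_lt_iff (WithBot.bot_lt_coe _)).2 fun k hk => ?_)
  refine (degree_C_mul_X_pow_le _ _).trans_lt ?_
  exact_mod_cast Finset.mem_range.1 hk

theorem genericY_monic (i : ℕ) : (S.genericY i).Monic :=
  monic_X_pow_add (S.degree_genericPoly_lt false i)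

theorem degree_genericY (i : ℕ) : (S.genericY i).degree = ((S.l i).toNat : WithBot ℕ) := by
  rw [genericY, degree_add_eq_left_of_degree_lt, degree_X_pow]
  rw [degree_X_pow]
  exact S.degree_genericPoly_lt false i

/-- The product `y_i' y_{i+1} ∏_s (x - z_s)`; a polynomial `y_i` is coprime to it if and only if it
has no multiple roots, no common roots with `y_{i+1}` and no roots among the `z_s`. -/
noncomputable def coprimeFactor {A : Type} [CommRing A] [Algebra ℂ A] (y : ℕ → A[X]) (i : ℕ) :
    A[X] :=
  derivative (y i) * y (i + 1) * S.zProd A fun _ => 1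

/-- The relations between the coefficients of the `y_i` and the `r_i`: the polynomial `r_i` is
inverse to `y_i' y_{i+1} ∏_s (x - z_s)` modulo `y_i`, and `y_i` divides
`Wr(y_i', T_i y_{i-1} y_{i+1})`. If some `l_i` is negative, then `1` is added, as `𝒜` is empty. -/
noncomputable def relationIdeal : Ideal S.CoeffRing :=
  Ideal.span
    ({c | ∃ i ≤ S.N, ∃ k, c =
        ((S.coprimeFactor S.genericY i * S.genericPoly true i - 1) %ₘ S.genericY i).coeff k} ∪
      {c | ∃ i, i + 1 ≤ S.N ∧ ∃ k, c =
        (wronskian (derivative (S.genericY (i + 1)))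
          (S.T S.CoeffRing (i + 1) * S.genericY i * S.genericY (i + 2)) %ₘ
            S.genericY (i + 1)).coeff k} ∪
      {c | c = 1 ∧ ∃ i ≤ S.N + 1, S.l i < 0})

/-- The coordinate algebra of the affine scheme `𝒜`. -/
abbrev CoordRing : Type := S.CoeffRing ⧸ S.relationIdeal

section Points

variable {S} {A : Type} [CommRing A] [Algebra ℂ A]

theorem map_coprimeFactor {B : Type} [CommRing B] [Algebra ℂ B] (φ : A →ₐ[ℂ] B) (y : ℕ → A[X])
    (i : ℕ) : (S.coprimeFactor y i).map (φ : A →+* B) =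
      S.coprimeFactor (fun j => (y j).map (φ : A →+* B)) i := by
  rw [coprimeFactor, Polynomial.map_mul, Polynomial.map_mul, map_zProd, ← derivative_map]
  rfl

theorem isCoprime_coprimeFactor_iff {y : ℕ → A[X]} {i : ℕ} :
    IsCoprime (y i) (S.coprimeFactor y i) ↔ IsCoprime (y i) (derivative (y i)) ∧
      IsCoprime (y i) (y (i + 1)) ∧ ∀ s, IsUnit ((y i).eval (algebraMap ℂ A (S.z s))) := by
  rw [coprimeFactor, IsCoprime.mul_right_iff, IsCoprime.mul_right_iff, and_assoc, zProd,
    IsCoprime.prod_right_iff]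
  simp [isCoprime_X_sub_C]

theorem IsSolution.congr {y y' : ℕ → A[X]} (hy : S.IsSolution y)
    (h : ∀ i ≤ S.N + 1, y' i = y i) : S.IsSolution y' where
  zero := by rw [h 0 (by omega), hy.zero]
  last := by rw [h _ le_rfl, hy.last]
  monic i hi := by rw [h i hi]; exact hy.monic i hi
  natDegree i hi := by rw [h i hi]; exact hy.natDegree i hi
  isUnit_eval i hi := by rw [h i hi]; exact hy.isUnit_eval i hi
  isCoprime i hi := by rw [h i (by omega), h (i + 1) (by omega)]; exact hy.isCoprime i hi
  isCoprime_derivative i hi := by rw [h i hi]; exact hy.isCoprime_derivative i hi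
  dvd i hi := by
    rw [h i (by omega), h (i + 1) (by omega), h (i + 2) (by omega)]
    exact hy.dvd i hi

omit [Algebra ℂ A] in
/-- The inverse of a polynomial modulo a monic polynomial `y`, normalized to have degree less than
the degree of `y`, is unique. -/
theorem eq_of_dvd_mul_sub_one {y q r r' : A[X]} (hy : y.Monic) (h : y ∣ q * r - 1)
    (h' : y ∣ q * r' - 1) (hr : r.degree < y.degree) (hr' : r'.degree < y.degree) : r = r' := by
  have h1 : y ∣ r - r' := by
    rw [show r - r' = r * (q * r - 1 - (q * r' - 1)) - (r - r') * (q * r - 1) by ring]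
    exact dvd_sub ((dvd_sub h h').mul_left _) (h.mul_left _)
  by_contra hne
  exact hy.not_dvd_of_degree_lt (sub_ne_zero.2 hne)
    ((degree_sub_le _ _).trans_lt (max_lt hr hr')) h1

/-- An algebra homomorphism from `CoeffRing` is determined by the images of the generic
polynomials. -/
theorem algHom_ext_of_map_genericPoly {φ ψ : S.CoeffRing →ₐ[ℂ] A}
    (h : ∀ b, ∀ i ≤ S.N + 1, (S.genericPoly b i).map (φ : S.CoeffRing →+* A) =
      (S.genericPoly b i).map (ψ : S.CoeffRing →+* A)) : φ = ψ := by
  refine MvPolynomial.algHom_ext fun ⟨b, ⟨⟨i, k⟩, hik⟩⟩ => ?_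
  have hik' := hik
  rw [Finset.mem_sigma, Finset.mem_range, Finset.mem_range] at hik'
  have := congrArg (coeff · k) (h b i (by simp only at hik'; omega))
  simp only [coeff_map] at this
  have hc : (S.genericPoly b i).coeff k = MvPolynomial.X (b, ⟨⟨i, k⟩, hik⟩) := by
    rw [genericPoly, finsetSum_coeff, Finset.sum_eq_single k]
    · rw [coeff_C_mul, coeff_X_pow, if_pos rfl, mul_one, dif_pos hik]
    · intro j _ hj
      rw [coeff_C_mul, coeff_X_pow, if_neg hj.symm, mul_zero]
    · intro hk
      exact (hk (Finset.mem_range.2 hik'.2)).elim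
  rwa [hc] at this

/-- The generic polynomials specialize to all polynomials of degree less than `l_i`. -/
theorem exists_map_genericPoly_eq (p : Bool → ℕ → A[X])
    (hp : ∀ b, ∀ i ≤ S.N + 1, (p b i).degree < ((S.l i).toNat : WithBot ℕ)) :
    ∃ φ : S.CoeffRing →ₐ[ℂ] A, ∀ b, ∀ i ≤ S.N + 1,
      (S.genericPoly b i).map (φ : S.CoeffRing →+* A) = p b i := by
  refine ⟨MvPolynomial.aeval fun q => (p q.1 q.2.1.1).coeff q.2.1.2, fun b i hi => ?_⟩
  rw [genericPoly, Polynomial.map_sum]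
  ext n
  have hterm : ∀ k ∈ Finset.range (S.l i).toNat, ((C (if h : (⟨i, k⟩ : Σ _ : ℕ, ℕ) ∈
      (Finset.range (S.N + 2)).sigma fun i => Finset.range (S.l i).toNat then
        MvPolynomial.X (b, ⟨_, h⟩) else 0) * X ^ k : S.CoeffRing[X]).map
      ((MvPolynomial.aeval fun q : Bool × S.CoeffIndex => (p q.1 q.2.1.1).coeff q.2.1.2 :
        S.CoeffRing →ₐ[ℂ] A) : S.CoeffRing →+* A)).coeff n =
        if n = k then (p b i).coeff k else 0 := by
    intro k hk
    rw [dif_pos (Finset.mem_sigma.2 ⟨Finset.mem_range.2 (show i < S.N + 2 by omega), hk⟩),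
      coeff_map, coeff_C_mul_X_pow]
    split_ifs
    · simp
    · simp
  rw [finsetSum_coeff, Finset.sum_congr rfl hterm, Finset.sum_ite_eq]
  split_ifs with hn
  · rfl
  · rw [Finset.mem_range, not_lt] at hn
    rw [coeff_eq_zero_of_degree_lt ((hp b i hi).trans_le (by exact_mod_cast hn))]

variable (S A) in
/-- A specialization of the generic polynomials satisfies the relations if and only if it gives a
solution, together with inverses. -/
theorem relationIdeal_le_ker_iff [Nontrivial A] (φ : S.CoeffRing →ₐ[ℂ] A) :
    (∀ a ∈ S.relationIdeal, φ a = 0) ↔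
      (S.IsSolution fun i => (S.genericY i).map (φ : S.CoeffRing →+* A)) ∧
      ∀ i ≤ S.N, (S.genericY i).map (φ : S.CoeffRing →+* A) ∣
        S.coprimeFactor (fun i => (S.genericY i).map (φ : S.CoeffRing →+* A)) i *
          (S.genericPoly true i).map (φ : S.CoeffRing →+* A) - 1 := by
  set y : ℕ → A[X] := fun i => (S.genericY i).map (φ : S.CoeffRing →+* A) with hy
  have hmod : ∀ (G : S.CoeffRing[X]) (i : ℕ), (∀ k, φ ((G %ₘ S.genericY i).coeff k) = 0) ↔
      y i ∣ G.map (φ : S.CoeffRing →+* A) := by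
    intro G i
    rw [← modByMonic_eq_zero_iff_dvd ((S.genericY_monic i).map _),
      ← map_modByMonic _ (S.genericY_monic i), Polynomial.ext_iff]
    simp only [coeff_map, coeff_zero]
    rfl
  have h1 : (∀ a ∈ S.relationIdeal, φ a = 0) ↔
      (∀ i ≤ S.N, y i ∣ S.coprimeFactor y i *
        (S.genericPoly true i).map (φ : S.CoeffRing →+* A) - 1) ∧
      (∀ i, i + 1 ≤ S.N → y (i + 1) ∣
        wronskian (derivative (y (i + 1))) (S.T A (i + 1) * y i * y (i + 2))) ∧
      ∀ i ≤ S.N + 1, 0 ≤ S.l i := by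
    have h2 : (∀ a ∈ S.relationIdeal, φ a = 0) ↔
        S.relationIdeal ≤ RingHom.ker (φ : S.CoeffRing →+* A) := Iff.rfl
    rw [h2, relationIdeal, Ideal.span_le, Set.union_subset_iff, Set.union_subset_iff, and_assoc]
    refine and_congr ?_ (and_congr ?_ ?_)
    · have : ∀ i, S.coprimeFactor y i *
          (S.genericPoly true i).map (φ : S.CoeffRing →+* A) - 1 =
          (S.coprimeFactor S.genericY i * S.genericPoly true i - 1).map
            (φ : S.CoeffRing →+* A) := fun i => by
        rw [Polynomial.map_sub, Polynomial.map_mul, map_coprimeFactor, Polynomial.map_one]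
      simp only [this, ← hmod]
      exact ⟨fun h i hi k => h ⟨i, hi, k, rfl⟩, fun h c ⟨i, hi, k, hc⟩ => hc ▸ h i hi k⟩
    · have : ∀ i, wronskian (derivative (y (i + 1))) (S.T A (i + 1) * y i * y (i + 2)) =
          (wronskian (derivative (S.genericY (i + 1))) (S.T S.CoeffRing (i + 1) * S.genericY i *
            S.genericY (i + 2))).map (φ : S.CoeffRing →+* A) := fun i => by
        rw [map_wronskian, Polynomial.map_mul, Polynomial.map_mul, ← derivative_map, T, T,
          map_zProd]
      simp only [this, ← hmod]
      exact ⟨fun h i hi k => h ⟨i, hi, k, rfl⟩, fun h c ⟨i, hi, k, hc⟩ => hc ▸ h i hi k⟩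
    · constructor
      · intro h i hi
        by_contra hneg
        exact one_ne_zero ((map_one φ).symm.trans (h ⟨rfl, i, hi, not_le.1 hneg⟩))
      · rintro h c ⟨-, i, hi, hneg⟩
        exact absurd (h i hi) (not_le.2 hneg)
  have hone : ∀ i, S.l i = 0 → y i = 1 := fun i hi => by
    simp [y, genericY, genericPoly, hi]
  have hmonic : ∀ i, (y i).Monic := fun i => (S.genericY_monic i).map _
  have hdeg : ∀ i, (y i).natDegree = (S.l i).toNat := fun i => by
    rw [(S.genericY_monic i).natDegree_map,
      natDegree_eq_of_degree_eq_some (S.degree_genericY i)]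
  have hlast : y (S.N + 1) = 1 := hone _ S.l_last
  rw [h1]
  constructor
  · rintro ⟨ha, hb, hc⟩
    have hcop : ∀ i ≤ S.N, IsCoprime (y i) (S.coprimeFactor y i) := by
      intro i hi
      obtain ⟨q, hq⟩ := ha i hi
      exact ⟨-q, (S.genericPoly true i).map (φ : S.CoeffRing →+* A), by linear_combination hq⟩
    refine ⟨⟨hone 0 S.l_zero, hlast, fun i _ => hmonic i, fun i hi => ?_, fun i hi s => ?_,
      fun i hi => (isCoprime_coprimeFactor_iff.1 (hcop i hi)).2.1, fun i hi => ?_, hb⟩, ha⟩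
    · rw [hdeg, Int.toNat_of_nonneg (hc i hi)]
    · rcases hi.eq_or_lt with rfl | hi
      · rw [hlast]; simp
      · exact (isCoprime_coprimeFactor_iff.1 (hcop i (by omega))).2.2 s
    · rcases hi.eq_or_lt with rfl | hi
      · rw [hlast]; exact isCoprime_one_left
      · exact (isCoprime_coprimeFactor_iff.1 (hcop i (by omega))).1
  · rintro ⟨hs, ha⟩
    exact ⟨ha, hs.dvd, fun i hi => hs.natDegree i hi ▸ Int.natCast_nonneg _⟩

/-- A specialization of the generic polynomials that satisfies the relations is determined by the
lines of the `y_i`, because inverses modulo `y_i` are unique. -/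
theorem algHom_ext_of_span_eq [Nontrivial A] {φ ψ : S.CoeffRing →ₐ[ℂ] A}
    (hφ0 : ∀ a ∈ S.relationIdeal, φ a = 0) (hψ0 : ∀ a ∈ S.relationIdeal, ψ a = 0)
    (h : ∀ j : Fin S.N,
      Submodule.span A {(S.genericY (j + 1)).map (φ : S.CoeffRing →+* A)} =
        Submodule.span A {(S.genericY (j + 1)).map (ψ : S.CoeffRing →+* A)}) : φ = ψ := by
  obtain ⟨hφ, hφr⟩ := (relationIdeal_le_ker_iff S A φ).1 hφ0
  obtain ⟨hψ, hψr⟩ := (relationIdeal_le_ker_iff S A ψ).1 hψ0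
  have hY : ∀ i ≤ S.N + 1, (S.genericY i).map (φ : S.CoeffRing →+* A) =
      (S.genericY i).map (ψ : S.CoeffRing →+* A) := by
    intro i hi
    by_cases h0 : i = 0
    · rw [h0]; exact hφ.zero.trans hψ.zero.symm
    by_cases hN : i = S.N + 1
    · rw [hN]; exact hφ.last.trans hψ.last.symm
    have := eq_of_span_singleton_eq ((S.genericY_monic _).map _) ((S.genericY_monic _).map _)
      (h ⟨i - 1, by omega⟩)
    simpa only [show i - 1 + 1 = i by omega] using this
  refine algHom_ext_of_map_genericPoly fun b i hi => ?_
  cases b with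
  | false => simpa [genericY] using hY i hi
  | true =>
    rcases hi.eq_or_lt with rfl | hi'
    · simp [genericPoly, S.l_last]
    -- both are the inverse of the same polynomial modulo `y_i`
    have hQ : S.coprimeFactor (fun i => (S.genericY i).map (φ : S.CoeffRing →+* A)) i =
        S.coprimeFactor (fun i => (S.genericY i).map (ψ : S.CoeffRing →+* A)) i := by
      rw [coprimeFactor, coprimeFactor, hY i hi, hY (i + 1) hi']
    have h1 := hφr i (by omega)
    have h2 := hψr i (by omega)
    rw [← hY i hi, ← hQ] at h2
    have hdeg : ∀ χ : S.CoeffRing →ₐ[ℂ] A,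
        ((S.genericPoly true i).map (χ : S.CoeffRing →+* A)).degree <
        ((S.genericY i).map (φ : S.CoeffRing →+* A)).degree := fun χ => by
      rw [(S.genericY_monic i).degree_map, S.degree_genericY]
      exact degree_map_le.trans_lt (S.degree_genericPoly_lt true i)
    exact eq_of_dvd_mul_sub_one ((S.genericY_monic i).map _) h1 h2 (hdeg φ) (hdeg ψ)

/-- Every solution is a specialization of the generic polynomials. -/
theorem IsSolution.exists_algHom [Nontrivial A] {y : ℕ → A[X]} (hy : S.IsSolution y) :
    ∃ φ : S.CoeffRing →ₐ[ℂ] A, (∀ a ∈ S.relationIdeal, φ a = 0) ∧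
      ∀ i ≤ S.N + 1, (S.genericY i).map (φ : S.CoeffRing →+* A) = y i := by
  have hr : ∀ i, ∃ r : A[X], r.degree < ((S.l i).toNat : WithBot ℕ) ∧
      (i ≤ S.N → y i ∣ S.coprimeFactor y i * r - 1) := by
    intro i
    by_cases hi : i ≤ S.N
    · obtain ⟨a, b, hab⟩ := isCoprime_coprimeFactor_iff.2 ⟨hy.isCoprime_derivative i (by omega),
        hy.isCoprime i hi, hy.isUnit_eval i (by omega)⟩
      have hm := hy.monic i (by omega)
      refine ⟨b %ₘ y i, ?_, fun _ => ⟨-a - S.coprimeFactor y i * (b /ₘ y i), ?_⟩⟩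
      · refine (degree_modByMonic_lt b hm).trans_eq ?_
        rw [degree_eq_natDegree hm.ne_zero, ← hy.natDegree i (by omega), Int.toNat_natCast]
      · have := modByMonic_add_div b (y i)
        linear_combination S.coprimeFactor y i * this + hab
    · exact ⟨0, by simp, fun h => absurd h hi⟩
  choose r hrdeg hr using hr
  obtain ⟨φ, hφ⟩ := exists_map_genericPoly_eq (S := S)
    (fun b i => if b then r i else y i - X ^ (S.l i).toNat) (by
      intro b i hi
      cases b with
      | true => exact hrdeg i
      | false =>
        have hm := hy.monic i hi
        have hd : (y i).degree = ((S.l i).toNat : WithBot ℕ) := by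
          rw [degree_eq_natDegree hm.ne_zero, ← hy.natDegree i hi, Int.toNat_natCast]
        refine (degree_sub_lt_left ?_ hm.ne_zero ?_).trans_eq hd
        · rw [hd, degree_X_pow]
        · rw [hm.leadingCoeff, leadingCoeff_X_pow])
  have hY : ∀ i ≤ S.N + 1, (S.genericY i).map (φ : S.CoeffRing →+* A) = y i := by
    intro i hi
    rw [genericY, Polynomial.map_add, hφ false i hi]
    simp
  refine ⟨φ, (relationIdeal_le_ker_iff S A φ).2 ⟨?_, fun i hi => ?_⟩, hY⟩
  · exact hy.congr fun i hi => hY i hi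
  · have hQ : S.coprimeFactor (fun i => (S.genericY i).map (φ : S.CoeffRing →+* A)) i =
        S.coprimeFactor y i := by
      rw [coprimeFactor, coprimeFactor, hY i (by omega), hY (i + 1) (by omega)]
    rw [hY i (by omega), hQ, hφ true i (by omega)]
    exact hr i hi

/-- The tuple of lines that belongs to a point of the coordinate algebra of `𝒜`. -/
noncomputable def linesOf (φ : S.CoordRing →ₐ[ℂ] A) (j : Fin S.N) : Submodule A A[X] :=
  Submodule.span A {(S.genericY (j + 1)).map
    ((φ.comp (Ideal.Quotient.mkₐ ℂ S.relationIdeal) : S.CoeffRing →ₐ[ℂ] A) : S.CoeffRing →+* A)}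

variable (S A) in
/-- The coordinate algebra represents `𝒜`. -/
theorem linesOf_bijOn :
    Set.BijOn (linesOf : (S.CoordRing →ₐ[ℂ] A) → _) Set.univ (S.AA A) := by
  rcases subsingleton_or_nontrivial A with hA | hA
  · have := subsingleton_submodule (A := A)
    refine ⟨fun _ _ => mem_AA_of_subsingleton _, fun φ _ ψ _ _ => ?_, fun L _ => ?_⟩
    · exact AlgHom.ext fun _ => Subsingleton.elim _ _
    · refine ⟨Ideal.Quotient.liftₐ _ (MvPolynomial.aeval 0) fun _ _ => Subsingleton.elim _ _,
        trivial, Subsingleton.elim _ _⟩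
  have hker : ∀ φ : S.CoordRing →ₐ[ℂ] A, ∀ a ∈ S.relationIdeal,
      (φ.comp (Ideal.Quotient.mkₐ ℂ S.relationIdeal)) a = 0 := by
    intro φ a ha
    rw [AlgHom.comp_apply, Ideal.Quotient.mkₐ_eq_mk, Ideal.Quotient.eq_zero_iff_mem.2 ha, map_zero]
  refine ⟨fun φ _ => ?_, fun φ _ ψ _ h => ?_, fun L hL => ?_⟩
  · exact ((relationIdeal_le_ker_iff S A _).1 (hker φ)).1.mem_AA fun j => rfl
  · exact Ideal.Quotient.algHom_ext _ (algHom_ext_of_span_eq (hker φ) (hker ψ) (congrFun h))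
  · obtain ⟨y, hy, hyL⟩ := exists_isSolution_of_mem_AA hL
    obtain ⟨φ, hφ0, hφ⟩ := hy.exists_algHom
    refine ⟨Ideal.Quotient.liftₐ _ φ hφ0, trivial, funext fun j => ?_⟩
    rw [hyL j, linesOf, Ideal.Quotient.liftₐ_comp, hφ _ (by omega)]

theorem linesOf_comp {B : Type} [CommRing B] [Algebra ℂ B] (ψ : A →ₐ[ℂ] B)
    (φ : S.CoordRing →ₐ[ℂ] A) (j : Fin S.N) :
    linesOf (ψ.comp φ) j = baseChange (ψ : A →+* B) (linesOf φ j) := by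
  rw [linesOf, linesOf, baseChange_span, Set.image_singleton, Polynomial.map_map]
  rfl

end Points

end BasicSituation

/-! ### Morphisms of schemes from their action on points -/

section RestrictedYoneda

/-- A map of `A`-valued points for all `ℂ`-algebras `A`, natural in `A`. -/
def IsNaturalOnPoints {X Y : SchemeC} (η : ∀ A, PointsOf X A → PointsOf Y A) : Prop :=
  ∀ (A B : CommAlgCat.{0} ℂ) (φ : A ⟶ B) (p : PointsOf X A),
    η B ((algSpec (CommRingCat.of ℂ)).map φ.op ≫ p) =
      (algSpec (CommRingCat.of ℂ)).map φ.op ≫ η A p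

variable {X Y : SchemeC}

/-- Morphisms of `ℂ`-schemes are equal if they agree on points with values in `ℂ`-algebras. -/
theorem hom_ext_of_points {f g : X ⟶ Y} (h : ∀ A (p : PointsOf X A), p ≫ f = p ≫ g) : f = g := by
  ext1
  refine X.left.affineCover.hom_ext _ _ fun i => ?_
  let T : SchemeC := Over.mk (X.left.affineCover.f i ≫ X.hom)
  let q : T ⟶ X := Over.homMk (X.left.affineCover.f i)
  have hT : (algSpec (CommRingCat.of ℂ)).essImage T :=
    essImage_algSpec.2 (inferInstanceAs (IsAffine (X.left.affineCover.X i)))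
  obtain ⟨⟨A⟩, ⟨e⟩⟩ := hT
  have h1 : q ≫ f = q ≫ g := by
    rw [← cancel_epi e.hom, ← Category.assoc, ← Category.assoc]
    exact h A (e.hom ≫ q)
  exact congrArg CommaMorphism.left h1

/-- A natural map of points with values in algebras extends to points with values in affine
`ℂ`-schemes. -/
theorem IsNaturalOnPoints.exists_affine {η : ∀ A, PointsOf X A → PointsOf Y A}
    (hη : IsNaturalOnPoints η) :
    ∃ ζ : ∀ T : SchemeC, IsAffine T.left → (T ⟶ X) → (T ⟶ Y),
      (∀ T T' hT hT' (g : T' ⟶ T) p, ζ T' hT' (g ≫ p) = g ≫ ζ T hT p) ∧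
      ∀ A hA p, ζ ((algSpec (CommRingCat.of ℂ)).obj (op A)) hA p = η A p := by
  have hex : ∀ T : SchemeC, IsAffine T.left →
      ∃ A : CommAlgCat.{0} ℂ, Nonempty ((algSpec (CommRingCat.of ℂ)).obj (op A) ≅ T) := by
    intro T hT
    obtain ⟨⟨A⟩, e⟩ := essImage_algSpec.2 hT
    exact ⟨A, e⟩
  choose A e using hex
  let e' := fun T hT => (e T hT).some
  have hη' : ∀ (A B : CommAlgCat.{0} ℂ) (g : (algSpec (CommRingCat.of ℂ)).obj (op B) ⟶
      (algSpec (CommRingCat.of ℂ)).obj (op A)) (p : PointsOf X A), η B (g ≫ p) = g ≫ η A p := by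
    intro A B g p
    obtain ⟨φ, rfl⟩ : ∃ φ, (algSpec (CommRingCat.of ℂ)).map φ = g :=
      ⟨_, (algSpec.fullyFaithful (R := CommRingCat.of ℂ)).map_preimage g⟩
    exact hη A B φ.unop p
  refine ⟨fun T hT p => (e' T hT).inv ≫ η (A T hT) ((e' T hT).hom ≫ p), ?_, ?_⟩
  · intro T T' hT hT' g p
    simp only
    have h1 := hη' _ _ ((e' T' hT').hom ≫ g ≫ (e' T hT).inv) ((e' T hT).hom ≫ p)
    simp only [Category.assoc, Iso.inv_hom_id_assoc] at h1
    rw [h1, Iso.inv_hom_id_assoc]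
  · intro B hB p
    simp only
    rw [← hη', Iso.inv_hom_id_assoc]

/-- A natural map of points is induced by a morphism of schemes: glue the morphisms given by an
affine open cover. -/
theorem IsNaturalOnPoints.exists_hom {η : ∀ A, PointsOf X A → PointsOf Y A}
    (hη : IsNaturalOnPoints η) : ∃ f : X ⟶ Y, ∀ A (p : PointsOf X A), p ≫ f = η A p := by
  obtain ⟨ζ, hζ, hζη⟩ := hη.exists_affine
  let 𝒰 := X.left.affineCover
  have h𝒰 : ∀ i, IsAffine (𝒰.X i) := fun i => inferInstanceAs (IsAffine (X.left.affineCover.X i))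
  -- the morphism on a piece of the cover, and its compatibility with morphisms from affine schemes
  let F : ∀ i, Over.mk (𝒰.f i ≫ X.hom) ⟶ Y := fun i => ζ _ (h𝒰 i) (Over.homMk (𝒰.f i))
  have hF : ∀ (T : SchemeC) (hT : IsAffine T.left) (p : T ⟶ X) (i) (v : T.left ⟶ 𝒰.X i),
      v ≫ 𝒰.f i = p.left → v ≫ (F i).left = (ζ T hT p).left := by
    intro T hT p i v hv
    let v' : T ⟶ Over.mk (𝒰.f i ≫ X.hom) := Over.homMk v (by
      change v ≫ 𝒰.f i ≫ X.hom = T.hom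
      rw [← Category.assoc, hv, Over.w])
    have h1 : v' ≫ Over.homMk (𝒰.f i) = p := by
      ext1
      exact hv
    rw [← h1, hζ _ _ (h𝒰 i)]
    rfl
  have hglue : ∀ i j, Limits.pullback.fst (𝒰.f i) (𝒰.f j) ≫ (F i).left =
      Limits.pullback.snd (𝒰.f i) (𝒰.f j) ≫ (F j).left := by
    intro i j
    refine (Limits.pullback (𝒰.f i) (𝒰.f j)).affineCover.hom_ext _ _ fun k => ?_
    set c := (Limits.pullback (𝒰.f i) (𝒰.f j)).affineCover.f k
    let T : SchemeC := Over.mk (c ≫ Limits.pullback.fst (𝒰.f i) (𝒰.f j) ≫ 𝒰.f i ≫ X.hom)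
    have hT : IsAffine T.left :=
      inferInstanceAs (IsAffine ((Limits.pullback (𝒰.f i) (𝒰.f j)).affineCover.X k))
    let p : T ⟶ X := Over.homMk (c ≫ Limits.pullback.fst (𝒰.f i) (𝒰.f j) ≫ 𝒰.f i)
      (by simp [T])
    have h1 := hF T hT p i (c ≫ Limits.pullback.fst (𝒰.f i) (𝒰.f j)) (by simp [p])
    have h2 := hF T hT p j (c ≫ Limits.pullback.snd (𝒰.f i) (𝒰.f j))
      (by simp [p, Limits.pullback.condition])
    rw [← Category.assoc, ← Category.assoc]
    exact h1.trans h2.symm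
  let f₀ : X.left ⟶ Y.left := 𝒰.glueMorphisms (fun i => (F i).left) hglue
  have hf₀ : ∀ i, 𝒰.f i ≫ f₀ = (F i).left := 𝒰.ι_glueMorphisms _ hglue
  let f : X ⟶ Y := Over.homMk f₀ (by
    refine 𝒰.hom_ext _ _ fun i => ?_
    rw [← Category.assoc, hf₀]
    exact Over.w (F i))
  refine ⟨f, fun A p => ?_⟩
  have hA : IsAffine ((algSpec (CommRingCat.of ℂ)).obj (op A)).left :=
    essImage_algSpec.1 ((algSpec (CommRingCat.of ℂ)).obj_mem_essImage _)
  rw [← hζη A hA p]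
  ext1
  -- compare on an affine cover of the preimage of each piece of the cover
  refine Scheme.Cover.hom_ext (𝒰.pullback₁ p.left) _ _ fun (i : 𝒰.I₀) => ?_
  refine (Limits.pullback p.left (𝒰.f i)).affineCover.hom_ext _ _ fun k => ?_
  set c := (Limits.pullback p.left (𝒰.f i)).affineCover.f k
  let T : SchemeC := Over.mk (c ≫ Limits.pullback.fst p.left (𝒰.f i) ≫
    ((algSpec (CommRingCat.of ℂ)).obj (op A)).hom)
  have hT : IsAffine T.left :=
    inferInstanceAs (IsAffine ((Limits.pullback p.left (𝒰.f i)).affineCover.X k))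
  let w : T ⟶ (algSpec (CommRingCat.of ℂ)).obj (op A) :=
    Over.homMk (c ≫ Limits.pullback.fst p.left (𝒰.f i)) (Category.assoc _ _ _)
  have h1 := hF T hT (w ≫ p) i (c ≫ Limits.pullback.snd p.left (𝒰.f i))
    (by simp [w, Limits.pullback.condition])
  rw [hζ _ _ hA, ← hf₀, Over.comp_left] at h1
  change c ≫ Limits.pullback.fst p.left (𝒰.f i) ≫ p.left ≫ f₀ =
    c ≫ Limits.pullback.fst p.left (𝒰.f i) ≫ (ζ _ hA p).left
  rw [Limits.pullback.condition_assoc]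
  simpa [w] using h1

/-- A natural bijection of points is induced by an isomorphism of schemes. -/
theorem isIso_of_points_bijective (f : X ⟶ Y)
    (h : ∀ A, Function.Bijective fun p : PointsOf X A => p ≫ f) : IsIso f := by
  let η : ∀ A, PointsOf Y A → PointsOf X A := fun A => (Equiv.ofBijective _ (h A)).symm
  have hηf : ∀ A q, η A q ≫ f = q := fun A q => (Equiv.ofBijective _ (h A)).apply_symm_apply q
  obtain ⟨g, hg⟩ := IsNaturalOnPoints.exists_hom (η := η) fun A B φ q => (h B).1 (by
    simp only
    rw [hηf, Category.assoc, hηf])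
  refine ⟨g, hom_ext_of_points fun A p => (h A).1 ?_, hom_ext_of_points fun A q => ?_⟩
  · simp only
    rw [← Category.assoc, hg, hηf, Category.comp_id]
  · rw [← Category.assoc, hg, hηf, Category.comp_id]

end RestrictedYoneda

/-! ### Representability, and the isomorphism -/

section Representability

/-- The algebra homomorphism that corresponds to a point of an affine `ℂ`-scheme. -/
noncomputable def algHomOfPoint {R A : CommAlgCat.{0} ℂ}
    (p : PointsOf ((algSpec (CommRingCat.of ℂ)).obj (op R)) A) : R →ₐ[ℂ] A :=
  ((algSpec.fullyFaithful (R := CommRingCat.of ℂ)).preimage p).unop.hom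

theorem algHomOfPoint_bijective (R A : CommAlgCat.{0} ℂ) : Function.Bijective
    (algHomOfPoint : PointsOf ((algSpec (CommRingCat.of ℂ)).obj (op R)) A → (R →ₐ[ℂ] A)) := by
  constructor
  · intro p q h
    rw [← (algSpec.fullyFaithful (R := CommRingCat.of ℂ)).map_preimage p,
      ← (algSpec.fullyFaithful (R := CommRingCat.of ℂ)).map_preimage q]
    exact congrArg _ (Quiver.Hom.unop_inj (CommAlgCat.hom_ext h))
  · intro φ
    refine ⟨(algSpec (CommRingCat.of ℂ)).map (CommAlgCat.ofHom φ).op, ?_⟩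
    rw [algHomOfPoint, (algSpec.fullyFaithful (R := CommRingCat.of ℂ)).preimage_map]
    rfl

theorem algHomOfPoint_comp {R A B : CommAlgCat.{0} ℂ} (φ : A ⟶ B)
    (p : PointsOf ((algSpec (CommRingCat.of ℂ)).obj (op R)) A) :
    algHomOfPoint ((algSpec (CommRingCat.of ℂ)).map φ.op ≫ p) = φ.hom.comp (algHomOfPoint p) := by
  rw [algHomOfPoint, (algSpec.fullyFaithful (R := CommRingCat.of ℂ)).preimage_comp,
    (algSpec.fullyFaithful (R := CommRingCat.of ℂ)).preimage_map]
  rfl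

theorem isAlgebraicScheme_algSpec (R : CommAlgCat.{0} ℂ) [Algebra.FiniteType ℂ R] :
    IsAlgebraicScheme ((algSpec (CommRingCat.of ℂ)).obj (op R)) := by
  have h1 : LocallyOfFiniteType (Spec.map (CommRingCat.ofHom (algebraMap ℂ R))) := by
    rw [HasRingHomProperty.Spec_iff (P := @LocallyOfFiniteType)]
    exact RingHom.finiteType_algebraMap.2 ‹_›
  have h2 : QuasiCompact (Spec.map (CommRingCat.ofHom (algebraMap ℂ R))) := inferInstance
  exact ⟨h1, h2⟩

variable (S : BasicSituation)

/-- The scheme `𝒜`. -/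
noncomputable abbrev schemeAA : SchemeC :=
  (algSpec (CommRingCat.of ℂ)).obj (op (CommAlgCat.of ℂ S.CoordRing))

theorem isAlgebraicScheme_schemeAA : IsAlgebraicScheme (schemeAA S) := by
  have : Algebra.FiniteType ℂ (CommAlgCat.of ℂ S.CoordRing) :=
    inferInstanceAs (Algebra.FiniteType ℂ S.CoordRing)
  exact isAlgebraicScheme_algSpec _

/-- The points of `𝒜` with values in `A` are the homomorphisms from its coordinate algebra. -/
noncomputable def schemeAAPoints : PointsIdentification (schemeAA S) S.AA where
  tuple A p := BasicSituation.linesOf (algHomOfPoint p)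
  bijOn A := by
    exact (S.linesOf_bijOn A).comp
      (Set.bijOn_univ.2 (algHomOfPoint_bijective (CommAlgCat.of ℂ S.CoordRing) A))
  natural A B φ p i := by
    exact (congrArg (fun ψ => BasicSituation.linesOf ψ i) (algHomOfPoint_comp φ p)).trans
      (BasicSituation.linesOf_comp φ.hom _ i)

variable {S}

/-- As the Wronskian map is bijective on points, a scheme with the points of `𝒜` also has the points
of `Fl^o`. -/
theorem nonempty_points_FlO {Y : SchemeC} (β : PointsIdentification Y S.AA) :
    Nonempty (PointsIdentification Y S.FlO) := by
  choose E hE hrel using fun (A : CommAlgCat.{0} ℂ) (p : PointsOf Y A) =>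
    BasicSituation.exists_wronskiRel_of_mem_AA ((β.bijOn A).mapsTo (Set.mem_univ p))
  refine ⟨⟨E, fun A => ⟨fun p _ => hE A p, fun p _ q _ h => ?_, fun F hF => ?_⟩, ?_⟩⟩
  · refine (β.bijOn A).injOn trivial trivial ?_
    exact (hrel A p).right_unique (h ▸ hrel A q)
  · obtain ⟨L, hL, hFL⟩ := BasicSituation.exists_wronskiRel_of_mem_FlO hF
    obtain ⟨p, -, rfl⟩ := (β.bijOn A).surjOn hL
    exact ⟨p, trivial, (hrel A p).left_unique (hE A p) hF hFL⟩
  · intro A B φ p i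
    obtain ⟨h1, -, h2⟩ := (hrel A p).baseChange φ.hom (hE A p)
    have h3 := hrel B ((algSpec (CommRingCat.of ℂ)).map φ.op ≫ p)
    rw [funext (β.natural A B φ p)] at h3
    exact congrFun (h3.left_unique (hE B _) h1 h2) i

/-- The Wronskian map is the morphism induced by the bijection of points. -/
theorem exists_wronskianMap {X Y : SchemeC} (α : PointsIdentification X S.FlO)
    (β : PointsIdentification Y S.AA) : ∃ Θ : X ⟶ Y, IsWronskianMap S α β Θ := by
  have hex : ∀ (A : CommAlgCat.{0} ℂ) (p : PointsOf X A),
      ∃ q : PointsOf Y A, S.WronskiRel (α.tuple A p) (β.tuple A q) := by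
    intro A p
    obtain ⟨L, hL, h⟩ :=
      BasicSituation.exists_wronskiRel_of_mem_FlO ((α.bijOn A).mapsTo (Set.mem_univ p))
    obtain ⟨q, -, rfl⟩ := (β.bijOn A).surjOn hL
    exact ⟨q, h⟩
  choose η hη using hex
  have hnat : IsNaturalOnPoints η := by
    intro A B φ p
    refine (β.bijOn B).injOn trivial trivial ?_
    obtain ⟨-, -, h2⟩ := (hη A p).baseChange φ.hom ((α.bijOn A).mapsTo (Set.mem_univ p))
    have h3 := hη B ((algSpec (CommRingCat.of ℂ)).map φ.op ≫ p)
    rw [funext (α.natural A B φ p)] at h3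
    rw [funext (β.natural A B φ (η A p))]
    exact h3.right_unique h2
  obtain ⟨Θ, hΘ⟩ := hnat.exists_hom
  refine ⟨Θ, fun A p => ?_⟩
  rw [hΘ]
  exact hη A p

theorem IsWronskianMap.unique {X Y : SchemeC} {α : PointsIdentification X S.FlO}
    {β : PointsIdentification Y S.AA} {Θ Θ' : X ⟶ Y} (h : IsWronskianMap S α β Θ)
    (h' : IsWronskianMap S α β Θ') : Θ' = Θ :=
  hom_ext_of_points fun A p => (β.bijOn A).injOn trivial trivial
    (BasicSituation.WronskiRel.right_unique (h' A p) (h A p))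

theorem IsWronskianMap.isIso {X Y : SchemeC} {α : PointsIdentification X S.FlO}
    {β : PointsIdentification Y S.AA} {Θ : X ⟶ Y} (h : IsWronskianMap S α β Θ) : IsIso Θ := by
  refine isIso_of_points_bijective Θ fun A => ⟨fun p p' hp => ?_, fun q => ?_⟩
  · refine (α.bijOn A).injOn trivial trivial ?_
    have h1 : S.WronskiRel (α.tuple A p) (β.tuple A (p ≫ Θ)) := h A p
    have h2 : S.WronskiRel (α.tuple A p') (β.tuple A (p' ≫ Θ)) := h A p'
    simp only at hp
    rw [← hp] at h2
    exact h1.left_unique ((α.bijOn A).mapsTo (Set.mem_univ p))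
      ((α.bijOn A).mapsTo (Set.mem_univ p')) h2
  · obtain ⟨E, hE, hrel⟩ :=
      BasicSituation.exists_wronskiRel_of_mem_AA ((β.bijOn A).mapsTo (Set.mem_univ q))
    obtain ⟨p, -, rfl⟩ := (α.bijOn A).surjOn hE
    exact ⟨p, (β.bijOn A).injOn trivial trivial
      (BasicSituation.WronskiRel.right_unique (h A p) hrel)⟩

end Representability

end WronskiMap

/-- `Fl^o` and `𝒜` are algebraic schemes over `ℂ`, the Wronskian map is a (unique, well defined)
morphism of schemes `Θ : Fl^o → 𝒜`, and it is an isomorphism of schemes. -/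
theorem mainTheorem1 (S : WronskiMap.BasicSituation) :
    (∃ X : WronskiMap.SchemeC, WronskiMap.IsAlgebraicScheme X ∧
      Nonempty (WronskiMap.PointsIdentification X S.FlO)) ∧
    (∃ Y : WronskiMap.SchemeC, WronskiMap.IsAlgebraicScheme Y ∧
      Nonempty (WronskiMap.PointsIdentification Y S.AA)) ∧
    (∀ (X Y : WronskiMap.SchemeC) (α : WronskiMap.PointsIdentification X S.FlO)
      (β : WronskiMap.PointsIdentification Y S.AA),
      ∃ Θ : X ⟶ Y, WronskiMap.IsWronskianMap S α β Θ ∧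
        (∀ Θ' : X ⟶ Y, WronskiMap.IsWronskianMap S α β Θ' → Θ' = Θ) ∧ IsIso Θ) := by
  refine ⟨⟨WronskiMap.schemeAA S, WronskiMap.isAlgebraicScheme_schemeAA S,
      WronskiMap.nonempty_points_FlO (WronskiMap.schemeAAPoints S)⟩,
    ⟨WronskiMap.schemeAA S, WronskiMap.isAlgebraicScheme_schemeAA S,
      ⟨WronskiMap.schemeAAPoints S⟩⟩, fun X Y α β => ?_⟩
  obtain ⟨Θ, hΘ⟩ := WronskiMap.exists_wronskianMap α β
  exact ⟨Θ, hΘ, fun _ h => hΘ.unique h, hΘ.isIso⟩
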